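/- Setting. Let $(\Omega,\mathbb P)$ be a probability space and $\theta:\Omega\to\Omega$ an invertible bimeasurable map that preserves $\mathbb P$ and is ergodic. Let $\mathbb S$ (resp. $\mathbb S^\circ$) be the set of positive semidefinite (resp. positive definite) complex $d\times d$ matrices of trace $1$, let $\|\cdot\|_1$ be the trace norm, and let ${}^*$ denote, for linear maps of matrices, the adjoint for the Hilbert–Schmidt inner product. A completely positive map $\phi$ of $d\times d$ matrices is positivity improving if it sends nonzero positive semidefinite matrices to positive definite ones, and irreducible if $(\mathrm{id}+\phi)^{d-1}$ is positivity improving. Let $\omega\mapsto U_\omega$ be a measurable family of unitaries on $\mathbb C^d\otimes\mathbb C^m$ and $\omega\mapsto\xi_\omega$ a measurable family of Gibbs states (of trace $1$) on $\mathbb C^m$, with spectral decomposition $\xi_\omega=\sum_{\epsilon=1}^m e^{-\beta_\omega E_{\omega,\epsilon}}\pi_{\omega,\epsilon}$, where $\beta_\omega>0$, $E_{\omega,1}<\dots<E_{\omega,m}$ and the $\pi_{\omega,\epsilon}$ are mutually orthogonal rank-one orthogonal projectors. For $(\epsilon,\epsilon')\in\{1,\dots,m\}^2$ put $$\psi_{\omega,(\epsilon,\epsilon')}(\rho)=\operatorname{tr}_{\mathbb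 C^m}\big[(\mathbf I\otimes\pi_{\omega,\epsilon'})\,U_\omega(\rho\otimes\pi_{\omega,\epsilon}\xi_\omega)U_\omega^*\big],\qquad f_\omega(\epsilon,\epsilon')=\beta_\omega(E_{\omega,\epsilon'}-E_{\omega,\epsilon}),$$ and $\varphi_\omega=\sum_{\epsilon,\epsilon'}\psi_{\omega,(\epsilon,\epsilon')}$, which is completely positive and trace preserving. Suppose that $\varphi_\omega$ is irreducible for every $\omega$. For a state $\rho$ and outcomes $a_j=(\epsilon_j,\epsilon_j')$ let $$p^{(n)}_{\omega,\rho}(a_1,\dots,a_n)=\operatorname{tr}\big[(\psi_{\theta^{n-1}\omega,a_n}\circ\cdots\circ\psi_{\omega,a_1})(\rho)\big].$$ Assumptions. (A1) With $v(\phi)=\inf\{\|\phi(X)\|_1: X\in\mathbb S\}$, the function $\omega\mapsto\log v(\varphi_\omega^*)$ is in $L^1(\mathbb P)$. (A2) There is $N_0\ge1$ such that $\varphi_{\theta^{N_0-1}\omega}\circ\cdots\circ\varphi_\omega$ is positivity improving with positive $\mathbb P$-probability. (A3) With $F_\omega=\max_{\epsilon,\epsilon'}|f_\omega(\epsilon,\epsilon')|$,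 one has $e^{\alpha F}\in L^1(\mathbb P)$ for all $\alpha\in\mathbb R$. (TRI) There is a measurable involution $\mathsf T:\Omega\to\Omega$ with $\mathsf T\circ\theta=\theta^{-1}\circ\mathsf T$ and $\mathbb P\circ\mathsf T^{-1}=\mathbb P$, and there are antiunitary involutions $\tau$ of $\mathbb C^d$ and $\tau'$ of $\mathbb C^m$ such that, for all $\omega$, $(\tau\otimes\tau')U_\omega=U_{\mathsf T\omega}^*(\tau\otimes\tau')$ and $\tau'\xi_\omega=\xi_{\mathsf T\omega}\tau'$. For $\rho\in\mathbb S^\circ$ let $$\sigma_{\omega,\rho,n}(a_1,\dots,a_n)=\log\frac{p^{(n)}_{\omega,\rho}\big((\epsilon_1,\epsilon_1'),\dots,(\epsilon_n,\epsilon_n')\big)}{p^{(n)}_{\mathsf T(\theta^{n-1}\omega),\rho}\big((\epsilon_n',\epsilon_n),\dots,(\epsilon_1',\epsilon_1)\big)}$$ (outcomes where both probabilities vanish do not matter). Theorem. Assume (A1)–(A3) and (TRI). Then there is a convex lower semicontinuous function $J:\mathbb R\to[0,\infty]$, depending neither on $\omega$ nor on $\rho$, such that for $\mathbb P$-almost every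 $\omega$, for every $\rho\in\mathbb S^\circ$ and every Borel set $E\subseteq\mathbb R$, $$-\inf_{s\in\operatorname{int}E}J(s)\le\liminf_{n\to\infty}\frac1n\log p^{(n)}_{\omega,\rho}\Big\{\tfrac1n\sigma_{\omega,\rho,n}\in E\Big\}\le\limsup_{n\to\infty}\frac1n\log p^{(n)}_{\omega,\rho}\Big\{\tfrac1n\sigma_{\omega,\rho,n}\in E\Big\}\le-\inf_{s\in\operatorname{cl}E}J(s).$$ Moreover $J(-s)=J(s)+s$ for all $s\in\mathbb R$. -/

import Mathlib

open MeasureTheory Filter Set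
open scoped ENNReal NNReal Kronecker ComplexOrder

noncomputable section

namespace QMeas

/-! ## Density matrices and maps on matrices -/

/-- `ℬ(ℂ^d)`, as complex `d × d` matrices. -/
abbrev Mat (d : ℕ) := Matrix (Fin d) (Fin d) ℂ

/-- The density matrices `𝕊`: positive semidefinite matrices of trace one. -/
def densityMatrices (d : ℕ) : Set (Mat d) := {X | X.PosSemidef ∧ X.trace = 1}

/-- The faithful density matrices `𝕊°`: positive definite matrices of trace one. -/
def faithfulStates (d : ℕ) : Set (Mat d) := {X | X.PosDef ∧ X.trace = 1}

/-- The trace norm `‖A‖₁`: the sum of the singular values of `A`, i.e. of the square roots of the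
eigenvalues of `Aᴴ A`. -/
def traceNorm {d : ℕ} (A : Mat d) : ℝ :=
  ∑ i, √((Matrix.isHermitian_conjTranspose_mul_self A).eigenvalues i)

/-- The adjoint of a linear map of matrices for the Hilbert–Schmidt inner product
`⟨Y, X⟩ = tr (Yᴴ X)`; its `(i, j)` entry at `X` is `⟨φ (E_{ij}), X⟩`, where `E_{ij}` is the matrix
unit. -/
def hsAdjoint {d : ℕ} (φ : Mat d →ₗ[ℂ] Mat d) : Mat d →ₗ[ℂ] Mat d where
  toFun X := Matrix.of fun i j => ((φ (Matrix.single i j 1)).conjTranspose * X).trace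
  map_add' X Y := by
    ext i j
    simp [Matrix.mul_add]
  map_smul' c X := by
    ext i j
    simp

/-- The defining property of the Hilbert–Schmidt adjoint. -/
theorem trace_hsAdjoint {d : ℕ} (φ : Mat d →ₗ[ℂ] Mat d) (X Y : Mat d) :
    (Y.conjTranspose * hsAdjoint φ X).trace = ((φ Y).conjTranspose * X).trace := by
  have h : φ Y = ∑ i, ∑ j, Y i j • φ (Matrix.single i j 1) := by
    conv_lhs => rw [Matrix.matrix_eq_sum_single Y]
    simp only [map_sum]
    refine Finset.sum_congr rfl fun i _ => Finset.sum_congr rfl fun j _ => ?_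
    rw [← map_smul]
    simp [Matrix.smul_single]
  rw [h]
  simp only [Matrix.conjTranspose_sum, Matrix.conjTranspose_smul, Matrix.sum_mul,
    Matrix.trace_sum, Matrix.smul_mul, Matrix.trace_smul]
  rw [Matrix.trace]
  simp only [Matrix.diag_apply, Matrix.mul_apply, Matrix.conjTranspose_apply, hsAdjoint,
    LinearMap.coe_mk, AddHom.coe_mk, Matrix.of_apply, smul_eq_mul]
  rw [Finset.sum_comm]

/-- Positivity improving maps: they send nonzero positive semidefinite matrices to positive
definite ones. (Only used for completely positive maps.) -/
def IsPositivityImproving {d : ℕ} (φ : Mat d →ₗ[ℂ] Mat d) : Prop :=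
  ∀ X : Mat d, X.PosSemidef → X ≠ 0 → (φ X).PosDef

/-- Irreducible maps: `(id + φ)^(d-1)` is positivity improving. (Only used for completely positive
maps.) -/
def IsIrreducibleMap {d : ℕ} (φ : Mat d →ₗ[ℂ] Mat d) : Prop :=
  IsPositivityImproving (((1 : Module.End ℂ (Mat d)) + φ) ^ (d - 1))

/-- `v(φ) = inf {‖φ(X)‖₁ : X ∈ 𝕊}`. -/
def vMin {d : ℕ} (φ : Mat d →ₗ[ℂ] Mat d) : ℝ :=
  sInf ((fun X => traceNorm (φ X)) '' densityMatrices d)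

/-- The composition `φ_{θ^{n-1} ω} ∘ ⋯ ∘ φ_{θ ω} ∘ φ_ω`. -/
def compAlong {Ω : Type*} {d : ℕ} (θ : Ω → Ω) (φ : Ω → (Mat d →ₗ[ℂ] Mat d)) (ω : Ω) :
    ℕ → (Mat d →ₗ[ℂ] Mat d)
  | 0 => LinearMap.id
  | n + 1 => φ (θ^[n] ω) ∘ₗ compAlong θ φ ω n

/-! ## The three assumptions -/

/-- Assumption (A1): `ω ↦ log v(φ_ω^*)` is integrable. -/
def AssumptionA1 {Ω : Type*} [MeasurableSpace Ω] {d : ℕ} (P : Measure Ω)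
    (φ : Ω → (Mat d →ₗ[ℂ] Mat d)) : Prop :=
  Integrable (fun ω => Real.log (vMin (hsAdjoint (φ ω)))) P

/-- Assumption (A2): for some `N₀`, with positive probability the composition of the first `N₀`
maps is positivity improving. -/
def AssumptionA2 {Ω : Type*} [MeasurableSpace Ω] {d : ℕ} (P : Measure Ω) (θ : Ω → Ω)
    (φ : Ω → (Mat d →ₗ[ℂ] Mat d)) : Prop :=
  ∃ N₀ : ℕ, 1 ≤ N₀ ∧ 0 < P {ω | IsPositivityImproving (compAlong θ φ ω N₀)}

/-- Assumption (A3): `F_ω = max_a |f_ω(a)|` has all exponential moments. -/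
def AssumptionA3 {Ω : Type*} [MeasurableSpace Ω] {A : Type*} (P : Measure Ω)
    (f : Ω → A → ℝ) : Prop :=
  ∀ α : ℝ, Integrable (fun ω => Real.exp (α * ⨆ a, |f ω a|)) P

/-! ## Repeated measurements -/

/-- The unnormalized state `(ψ_{θ^{n-1} ω, a_n} ∘ ⋯ ∘ ψ_{ω, a_1})(ρ)`. -/
def stateAfter {Ω A : Type*} {d : ℕ} (θ : Ω → Ω) (ψ : Ω → A → (Mat d →ₗ[ℂ] Mat d))
    (ω : Ω) (ρ : Mat d) : (n : ℕ) → (Fin n → A) → Mat d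
  | 0, _ => ρ
  | n + 1, a => ψ (θ^[n] ω) (a (Fin.last n)) (stateAfter θ ψ ω ρ n (Fin.init a))

/-- The probability `p^{(n)}_{ω,ρ}(a_1, …, a_n)` of the first `n` outcomes. -/
def outcomeProb {Ω A : Type*} {d : ℕ} (θ : Ω → Ω) (ψ : Ω → A → (Mat d →ₗ[ℂ] Mat d))
    (ω : Ω) (ρ : Mat d) (n : ℕ) (a : Fin n → A) : ℝ :=
  (stateAfter θ ψ ω ρ n a).trace.re

/-! ## Two-time measurements -/

/-- The partial trace over the second tensor factor. -/
def partialTrace {d m : ℕ} (X : Matrix (Fin d × Fin m) (Fin d × Fin m) ℂ) : Mat d :=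
  Matrix.of fun i j => ∑ k, X (i, k) (j, k)

/-- The data of the two-time measurement scheme: measurable families of unitaries `U_ω` on
`ℂ^d ⊗ ℂ^m` and of Gibbs states `ξ_ω = ∑ exp(-β_ω E_{ω,ε}) π_{ω,ε}` on `ℂ^m`, given with their
spectral decomposition into rank-one projectors, with simple energies in increasing order
(normalized so that `∑ exp(-β_ω E_{ω,ε}) = 1`), at positive inverse temperature `β_ω`. -/
structure TwoTimeModel (Ω : Type*) [MeasurableSpace Ω] (d m : ℕ) where
  /-- the interaction unitary -/
  U : Ω → Matrix (Fin d × Fin m) (Fin d × Fin m) ℂ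
  /-- the initial state of the probe -/
  ξ : Ω → Mat m
  /-- the inverse temperature -/
  β : Ω → ℝ
  /-- the energies -/
  E : Ω → Fin m → ℝ
  /-- the spectral projectors -/
  π : Ω → Fin m → Mat m
  measurable_U : ∀ p q, Measurable fun ω => U ω p q
  measurable_ξ : ∀ i j, Measurable fun ω => ξ ω i j
  unitary_U : ∀ ω, U ω ∈ Matrix.unitaryGroup (Fin d × Fin m) ℂ
  β_pos : ∀ ω, 0 < β ω
  E_strictMono : ∀ ω, StrictMono (E ω)
  π_isHermitian : ∀ ω ε, (π ω ε).IsHermitian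
  π_idem : ∀ ω ε, π ω ε * π ω ε = π ω ε
  π_rank : ∀ ω ε, (π ω ε).rank = 1
  π_orthogonal : ∀ ω ε ε', ε ≠ ε' → π ω ε * π ω ε' = 0
  π_sum : ∀ ω, ∑ ε, π ω ε = 1
  ξ_eq : ∀ ω, ξ ω = ∑ ε, (Real.exp (-(β ω * E ω ε)) : ℂ) • π ω ε
  ξ_trace : ∀ ω, (ξ ω).trace = 1

namespace TwoTimeModel

variable {Ω : Type*} [MeasurableSpace Ω] {d m : ℕ}

/-- The instrument
`ψ_{ω,(ε,ε')}(ρ) = tr₂ [(1 ⊗ π_{ω,ε'}) U_ω (ρ ⊗ π_{ω,ε} ξ_ω) U_ω^*]`. -/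
def instrument (M : TwoTimeModel Ω d m) (ω : Ω) (a : Fin m × Fin m) : Mat d →ₗ[ℂ] Mat d where
  toFun ρ := partialTrace
    (((1 : Mat d) ⊗ₖ M.π ω a.2) * (M.U ω * (ρ ⊗ₖ (M.π ω a.1 * M.ξ ω)) * (M.U ω).conjTranspose))
  map_add' X Y := by
    ext i j
    simp [partialTrace, Matrix.add_kronecker, Matrix.mul_add, Matrix.add_mul,
      Finset.sum_add_distrib]
  map_smul' c X := by
    ext i j
    simp [partialTrace, Matrix.smul_kronecker, Finset.mul_sum]

/-- The channel `φ_ω = ∑_a ψ_{ω,a}`. -/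
def channel (M : TwoTimeModel Ω d m) (ω : Ω) : Mat d →ₗ[ℂ] Mat d :=
  ∑ a, M.instrument ω a

/-- `f_ω(ε,ε') = β_ω (E_{ω,ε'} - E_{ω,ε})`. -/
def entropyChange (M : TwoTimeModel Ω d m) (ω : Ω) (a : Fin m × Fin m) : ℝ :=
  M.β ω * (M.E ω a.2 - M.E ω a.1)

/-- The reversed record `((ε'_n, ε_n), …, (ε'_1, ε_1))` of `((ε_1, ε'_1), …, (ε_n, ε'_n))`. -/
def reverseRecord {n : ℕ} (a : Fin n → Fin m × Fin m) : Fin n → Fin m × Fin m :=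
  fun j => (a (Fin.rev j)).swap

/-- The information-theoretic entropy production `σ_{ω,ρ,n}`, the logarithm of the ratio of
`p^{(n)}_{ω,ρ}` at the record to `p^{(n)}_{T(θ^{n-1} ω),ρ}` at the reversed record. -/
def entropyProduction (M : TwoTimeModel Ω d m) (θ T : Ω → Ω) (ω : Ω) (ρ : Mat d) (n : ℕ)
    (a : Fin n → Fin m × Fin m) : ℝ :=
  Real.log (outcomeProb θ M.instrument ω ρ n a /
    outcomeProb θ M.instrument (T (θ^[n - 1] ω)) ρ n (reverseRecord a))

end TwoTimeModel

/-! ## Time-reversal invariance -/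

/-- The product vector `u ⊗ v` in `ℂ^d ⊗ ℂ^m`. -/
def tensorVec {d m : ℕ} (u : EuclideanSpace ℂ (Fin d)) (v : EuclideanSpace ℂ (Fin m)) :
    EuclideanSpace ℂ (Fin d × Fin m) :=
  WithLp.toLp 2 fun p => u p.1 * v p.2

/-- The tensor product `τ ⊗ τ'` of two antilinear maps: the antilinear map on `ℂ^d ⊗ ℂ^m` that
sends `e_i ⊗ e_k` to `τ e_i ⊗ τ' e_k`. -/
def antiTensor {d m : ℕ} (τ : EuclideanSpace ℂ (Fin d) ≃ₗᵢ⋆[ℂ] EuclideanSpace ℂ (Fin d))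
    (τ' : EuclideanSpace ℂ (Fin m) ≃ₗᵢ⋆[ℂ] EuclideanSpace ℂ (Fin m))
    (x : EuclideanSpace ℂ (Fin d × Fin m)) : EuclideanSpace ℂ (Fin d × Fin m) :=
  ∑ p : Fin d × Fin m, (starRingEnd ℂ) (x p) •
    tensorVec (τ (EuclideanSpace.single p.1 1)) (τ' (EuclideanSpace.single p.2 1))

/-- The defining property of `τ ⊗ τ'`. -/
theorem antiTensor_tensorVec {d m : ℕ}
    (τ : EuclideanSpace ℂ (Fin d) ≃ₗᵢ⋆[ℂ] EuclideanSpace ℂ (Fin d))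
    (τ' : EuclideanSpace ℂ (Fin m) ≃ₗᵢ⋆[ℂ] EuclideanSpace ℂ (Fin m))
    (u : EuclideanSpace ℂ (Fin d)) (v : EuclideanSpace ℂ (Fin m)) :
    antiTensor τ τ' (tensorVec u v) = tensorVec (τ u) (τ' v) := by
  have expand : ∀ {n : ℕ} (κ : EuclideanSpace ℂ (Fin n) ≃ₗᵢ⋆[ℂ] EuclideanSpace ℂ (Fin n))
      (w : EuclideanSpace ℂ (Fin n)) (q : Fin n),
      κ w q = ∑ i, (starRingEnd ℂ) (w i) * κ (EuclideanSpace.single i 1) q := by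
    intro n κ w q
    have hw : w = ∑ i, w i • EuclideanSpace.single i (1 : ℂ) := by
      ext j
      simp [Pi.single_apply]
    conv_lhs => rw [hw]
    simp [map_sum, LinearIsometryEquiv.map_smulₛₗ]
  ext q
  simp only [antiTensor, tensorVec, WithLp.ofLp_sum, Finset.sum_apply, WithLp.ofLp_smul,
    Pi.smul_apply, smul_eq_mul, map_mul]
  rw [expand τ u, expand τ' v, Finset.sum_mul_sum, ← Finset.univ_product_univ,
    Finset.sum_product]
  refine Finset.sum_congr rfl fun i _ => Finset.sum_congr rfl fun j _ => ?_
  ring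

/-- The time-reversal invariance assumption for the driving system and the two-time measurement
model, with time reversal `T` of the driving system. -/
structure TimeReversalInvariant {Ω : Type*} [MeasurableSpace Ω] {d m : ℕ} (P : Measure Ω)
    (θ : Ω ≃ᵐ Ω) (M : TwoTimeModel Ω d m) (T : Ω → Ω) : Prop where
  involutive : Function.Involutive T
  conj_shift : ∀ ω, T (θ ω) = θ.symm (T ω)
  measurePreserving : MeasurePreserving T P P
  exists_antiunitary :
    ∃ (τ : EuclideanSpace ℂ (Fin d) ≃ₗᵢ⋆[ℂ] EuclideanSpace ℂ (Fin d))
      (τ' : EuclideanSpace ℂ (Fin m) ≃ₗᵢ⋆[ℂ] EuclideanSpace ℂ (Fin m)),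
      Function.Involutive τ ∧ Function.Involutive τ' ∧
      (∀ ω x, antiTensor τ τ' (Matrix.toEuclideanLin (M.U ω) x) =
        Matrix.toEuclideanLin (M.U (T ω)).conjTranspose (antiTensor τ τ' x)) ∧
      (∀ ω x, τ' (Matrix.toEuclideanLin (M.ξ ω) x) = Matrix.toEuclideanLin (M.ξ (T ω)) (τ' x))

/-! ## Large deviations -/

/-- The large deviation bounds, at speed `n` and with rate `J`, for the sequence `Y n / n`, where
`Y n` is a real random variable on the finite set `X n` with probability weights `p n`. -/
def LargeDeviationBounds {X : ℕ → Type*} [∀ n, Fintype (X n)] (p Y : ∀ n, X n → ℝ)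
    (J : ℝ → ℝ≥0∞) : Prop :=
  ∀ E : Set ℝ, MeasurableSet E →
    (-(⨅ s ∈ interior E, (J s : EReal)) ≤
      liminf (fun n : ℕ => ENNReal.log (ENNReal.ofReal
        (∑ a, Set.indicator {a | Y n a / n ∈ E} (p n) a)) / (n : EReal)) atTop) ∧
    (limsup (fun n : ℕ => ENNReal.log (ENNReal.ofReal
        (∑ a, Set.indicator {a | Y n a / n ∈ E} (p n) a)) / (n : EReal)) atTop ≤
      -(⨅ s ∈ closure E, (J s : EReal)))

end QMeas

end

/-! Let S_n be the sum of the entropy changes `entropyChange` along a record (`recordSum`). Time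
reversal turns each instrument, up to the factor e^{-f}, into the adjoint of the original one. Hence
the reversed record started in ρ has e^{-S_n} times the weight obtained by pairing the conjugated ρ
with the evolution of the identity along the original record (`trace_stateAfter_reverse`). Faithful
states are comparable with the identity, so σ_n - S_n is bounded uniformly in ω, n and the record
(`exists_abs_entropyProduction_sub_recordSum_le`), and everything reduces to S_n under the maximally
mixed state.

No cumulant generating function is used. The central quantities are Z_n = E exp(-K |S_n - n s|), for
K natural and s real. If (1/n) log Z_n converges to Λ_K(s) for all K and s, then J(s) = sup_K
(-Λ_K(s)) is the rate function (`largeDeviationBounds_of_tendsto_penalized`): Z_n bounds the weight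
of a small ball around s from above, and for large K the part of Z_n outside the ball is negligible.
Exponential tightness is free, since |S_n| grows at most linearly.

The limits come from a superadditive ergodic theorem. By (A2) there is an event of positive
probability on which N consecutive steps dominate δ tr(·) 1; such steps forget the past, so log Z_n
is superadditive up to a constant when cut at a visit to this event. Visits have sublinear gaps, and
(A1) and (A3) make the cost of single steps integrable. This suffices for an almost sure constant
limit (`GappedSuperadditive.exists_ae_tendsto`).

Convexity of J is the same concatenation with two different slopes (`growthRate_concave`). For the
symmetry, reversal replaces S_n by -S_n at the price e^{-S_n}, and e^{-(K+1)|S_n - ns|} ≤ e^{ns}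
e^{-S_n} e^{-K|S_n - ns|}. So Λ_{K+1}(s) ≤ s + Λ_K(-s), the shift of K disappears in the supremum,
and J(-s) ≤ J(s) + s; exchanging s and -s gives equality. -/

noncomputable section

namespace QMeas

/-! ## The pointwise ergodic theorem -/

section Birkhoff

variable {Ω : Type*} {θ : Ω → Ω}

/-- The running maximum `max (0, g, S₂ g, …, S_n g)` of the Birkhoff sums of `g`. -/
def birkhoffMax (θ : Ω → Ω) (g : Ω → ℝ) : ℕ → Ω → ℝ
  | 0, _ => 0
  | n + 1, ω => max 0 (g ω + birkhoffMax θ g n (θ ω))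

theorem birkhoffMax_nonneg (g : Ω → ℝ) (n : ℕ) (ω : Ω) : 0 ≤ birkhoffMax θ g n ω := by
  cases n with
  | zero => exact le_rfl
  | succ n => exact le_max_left _ _

theorem birkhoffMax_mono (g : Ω → ℝ) (ω : Ω) : Monotone fun n => birkhoffMax θ g n ω := by
  refine monotone_nat_of_le_succ fun n => ?_
  induction n generalizing ω with
  | zero => exact birkhoffMax_nonneg g 1 ω
  | succ n ih => exact max_le_max le_rfl (by simpa using ih (θ ω))

theorem birkhoffSum_le_birkhoffMax (g : Ω → ℝ) (n : ℕ) (ω : Ω) :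
    birkhoffSum θ g n ω ≤ birkhoffMax θ g n ω := by
  induction n generalizing ω with
  | zero => simp [birkhoffMax]
  | succ n ih =>
    rw [birkhoffSum_succ']
    exact le_max_of_le_right (by simpa using ih (θ ω))

variable [MeasurableSpace Ω] {P : Measure Ω}

theorem measurable_birkhoffMax (hθ : Measurable θ) {g : Ω → ℝ} (hg : Measurable g) (n : ℕ) :
    Measurable (birkhoffMax θ g n) := by
  induction n with
  | zero => exact measurable_const
  | succ n ih => exact measurable_const.max (hg.add (ih.comp hθ))

theorem integrable_birkhoffMax [IsFiniteMeasure P] (hθ : MeasurePreserving θ P P) {g : Ω → ℝ}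
    (hg : Integrable g P) (n : ℕ) : Integrable (birkhoffMax θ g n) P := by
  induction n with
  | zero => exact integrable_const 0
  | succ n ih => exact (integrable_const 0).sup (hg.add (hθ.integrable_comp_of_integrable ih))

/-- Boundedness of the running maxima M_n is an invariant event, so by ergodicity it is almost sure
or null. If it were null, M_{n+1} - M_n ∘ θ = max(-M_n ∘ θ, g) would converge to g almost
everywhere, dominated by |g|, while its integrals are nonnegative; then ∫ g ≥ 0. -/
theorem ae_bddAbove_birkhoffMax [IsProbabilityMeasure P] (hθ : Ergodic θ P) {g : Ω → ℝ}
    (hgm : Measurable g) (hg : Integrable g P) (hneg : ∫ ω, g ω ∂P < 0) :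
    ∀ᵐ ω ∂P, BddAbove (range fun n => birkhoffMax θ g n ω) := by
  have hms : MeasurableSet {ω | BddAbove (range fun n => birkhoffMax θ g n ω)} :=
    measurableSet_bddAbove_range fun n => measurable_birkhoffMax hθ.measurable hgm n
  have hinv : θ ⁻¹' {ω | BddAbove (range fun n => birkhoffMax θ g n ω)} =
      {ω | BddAbove (range fun n => birkhoffMax θ g n ω)} := by
    ext ω
    simp only [mem_preimage, mem_ofPred_eq, bddAbove_def, mem_range, forall_exists_index,
      forall_apply_eq_imp_iff]
    constructor
    · rintro ⟨c, hc⟩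
      refine ⟨max 0 (g ω + c), fun n => ?_⟩
      cases n with
      | zero => exact le_max_left _ _
      | succ n => exact max_le_max le_rfl (by simpa using hc n)
    · rintro ⟨c, hc⟩
      refine ⟨c - g ω, fun n => ?_⟩
      have := (le_max_right _ _).trans (hc (n + 1))
      linarith
  rcases hθ.ae_mem_or_ae_notMem hms hinv with h | h
  · exact h
  exfalso
  -- By invariance of P the integral equals ∫ (M_{n+1} - M_n), and M_n is nondecreasing in n.
  have key : ∀ n, 0 ≤ ∫ ω, max (-birkhoffMax θ g n (θ ω)) (g ω) ∂P := by
    intro n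
    have h1 : ∫ ω, birkhoffMax θ g n (θ ω) ∂P = ∫ ω, birkhoffMax θ g n ω ∂P := by
      rw [← integral_map hθ.measurable.aemeasurable, hθ.map_eq]
      rw [hθ.map_eq]
      exact (measurable_birkhoffMax hθ.measurable hgm n).aestronglyMeasurable
    have h2 : ∀ ω, max (-birkhoffMax θ g n (θ ω)) (g ω) =
        birkhoffMax θ g (n + 1) ω - birkhoffMax θ g n (θ ω) := by
      intro ω
      rw [birkhoffMax, ← max_sub_sub_right]
      simp
    have i1 := integrable_birkhoffMax hθ.toMeasurePreserving hg n
    have i2 := integrable_birkhoffMax hθ.toMeasurePreserving hg (n + 1)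
    have i3 : Integrable (fun ω => birkhoffMax θ g n (θ ω)) P :=
      hθ.toMeasurePreserving.integrable_comp_of_integrable i1
    simp_rw [h2]
    rw [integral_sub i2 i3, h1, ← integral_sub i2 i1]
    exact integral_nonneg fun ω => sub_nonneg.2 (birkhoffMax_mono g ω n.le_succ)
  have hlim : Tendsto (fun n => ∫ ω, max (-birkhoffMax θ g n (θ ω)) (g ω) ∂P) atTop
      (nhds (∫ ω, g ω ∂P)) := by
    refine tendsto_integral_of_dominated_convergence (fun ω => |g ω|) (fun n => ?_) hg.abs
      (fun n => ae_of_all _ fun ω => ?_) ?_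
    · exact (((measurable_birkhoffMax hθ.measurable hgm n).comp hθ.measurable).neg.max
        hgm).aestronglyMeasurable
    · have := birkhoffMax_nonneg (θ := θ) g n (θ ω)
      rw [Real.norm_eq_abs, abs_le]
      refine ⟨(neg_abs_le _).trans (le_max_right _ _), max_le ?_ (le_abs_self _)⟩
      linarith [abs_nonneg (g ω)]
    · filter_upwards [h] with ω hω
      have hω' : ¬ BddAbove (range fun n => birkhoffMax θ g n (θ ω)) := fun hb =>
        hω (hinv.subset hb)
      have hev : ∀ᶠ n in atTop, -g ω ≤ birkhoffMax θ g n (θ ω) := by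
        obtain ⟨n, hn⟩ : ∃ n, -g ω < birkhoffMax θ g n (θ ω) := by
          by_contra! hcon
          exact hω' ⟨-g ω, by rintro _ ⟨n, rfl⟩; exact hcon n⟩
        exact eventually_atTop.2 ⟨n, fun k hk => hn.le.trans (birkhoffMax_mono g (θ ω) hk)⟩
      refine tendsto_const_nhds.congr' ?_
      filter_upwards [hev] with n hn
      rw [max_eq_right (by linarith)]
  exact absurd (ge_of_tendsto' hlim key) (not_le.2 hneg)

/-- For b strictly between ∫ g and c, the running maxima of g - b are bounded by some B, so the
averages of g are at most b + B/n. -/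
theorem ae_eventually_birkhoffSum_le [IsProbabilityMeasure P] (hθ : Ergodic θ P) {g : Ω → ℝ}
    (hgm : Measurable g) (hg : Integrable g P) {c : ℝ} (hc : ∫ ω, g ω ∂P < c) :
    ∀ᵐ ω ∂P, ∀ᶠ n : ℕ in atTop, birkhoffSum θ g n ω / n < c := by
  obtain ⟨b, hb, hbc⟩ := exists_between hc
  have hi : Integrable (fun ω => g ω - b) P := hg.sub (integrable_const b)
  have hint : ∫ ω, (g ω - b) ∂P < 0 := by
    rw [integral_sub hg (integrable_const b)]
    simpa using hb
  filter_upwards [ae_bddAbove_birkhoffMax hθ (hgm.sub_const b) hi hint] with ω ⟨B, hB⟩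
  have hlim : Tendsto (fun n : ℕ => b + B / n) atTop (nhds (b + 0)) :=
    tendsto_const_nhds.add (tendsto_const_div_atTop_nhds_zero_nat B)
  rw [add_zero] at hlim
  filter_upwards [hlim.eventually_lt_const hbc, eventually_gt_atTop 0] with n hn hn0
  refine lt_of_le_of_lt ?_ hn
  have hn' : (0 : ℝ) < n := by exact_mod_cast hn0
  have h1 : birkhoffSum θ (fun ω => g ω - b) n ω ≤ B :=
    (birkhoffSum_le_birkhoffMax _ n ω).trans (hB ⟨n, rfl⟩)
  have h2 : birkhoffSum θ (fun ω => g ω - b) n ω = birkhoffSum θ g n ω - n * b := by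
    simp [birkhoffSum, Finset.sum_sub_distrib]
  rw [div_le_iff₀ hn', add_mul, div_mul_cancel₀ _ hn'.ne']
  linarith

theorem ae_tendsto_birkhoffSum_div_of_measurable [IsProbabilityMeasure P] (hθ : Ergodic θ P)
    {g : Ω → ℝ} (hgm : Measurable g) (hg : Integrable g P) :
    ∀ᵐ ω ∂P, Tendsto (fun n : ℕ => birkhoffSum θ g n ω / n) atTop (nhds (∫ ω, g ω ∂P)) := by
  have hup : ∀ k : ℕ, ∀ᵐ ω ∂P, ∀ᶠ n : ℕ in atTop,
      birkhoffSum θ g n ω / n < ∫ ω, g ω ∂P + 1 / ((k : ℝ) + 1) := fun k =>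
    ae_eventually_birkhoffSum_le hθ hgm hg (by linarith [Nat.one_div_pos_of_nat (α := ℝ) (n := k)])
  have hlow : ∀ k : ℕ, ∀ᵐ ω ∂P, ∀ᶠ n : ℕ in atTop,
      birkhoffSum θ (fun ω => -g ω) n ω / n < -∫ ω, g ω ∂P + 1 / ((k : ℝ) + 1) := fun k =>
    ae_eventually_birkhoffSum_le hθ hgm.neg hg.neg (by
      rw [integral_neg']; linarith [Nat.one_div_pos_of_nat (α := ℝ) (n := k)])
  filter_upwards [ae_all_iff.2 hup, ae_all_iff.2 hlow] with ω h1 h2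
  rw [Metric.tendsto_nhds]
  intro ε hε
  obtain ⟨k, hk⟩ := exists_nat_one_div_lt hε
  filter_upwards [h1 k, h2 k] with n hn1 hn2
  have h3 : birkhoffSum θ (fun ω => -g ω) n ω = -birkhoffSum θ g n ω := by simp [birkhoffSum]
  rw [h3, neg_div] at hn2
  rw [Real.dist_eq, abs_lt]
  constructor <;> linarith

/-- **Birkhoff's ergodic theorem** for an ergodic transformation of a probability space. -/
theorem ae_tendsto_birkhoffSum_div [IsProbabilityMeasure P] (hθ : Ergodic θ P)
    {g : Ω → ℝ} (hg : Integrable g P) :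
    ∀ᵐ ω ∂P, Tendsto (fun n : ℕ => birkhoffSum θ g n ω / n) atTop (nhds (∫ ω, g ω ∂P)) := by
  obtain ⟨g', hg'm, hgg'⟩ := hg.1
  have h1 := ae_tendsto_birkhoffSum_div_of_measurable hθ hg'm.measurable (hg.congr hgg')
  have h2 := ae_all_iff.2 fun n =>
    hθ.quasiMeasurePreserving.birkhoffSum_ae_eq_of_ae_eq hgg' n
  rw [integral_congr_ae hgg']
  filter_upwards [h1, h2] with ω hω h
  simpa only [h] using hω

end Birkhoff

/-! ## A superadditive ergodic theorem with gaps -/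

section Gapped

/-- Applied to Birkhoff sums, this measures what happens in a window of relative length ε after time
n. -/
theorem tendsto_shift_floor_div {u : ℕ → ℝ} {l ε : ℝ}
    (hu : Tendsto (fun n : ℕ => u n / n) atTop (nhds l)) (hε : 0 ≤ ε) :
    Tendsto (fun n : ℕ => u (n + ⌊ε * n⌋₊) / n) atTop (nhds (l * (1 + ε))) := by
  have h1 : Tendsto (fun n : ℕ => n + ⌊ε * (n : ℝ)⌋₊) atTop atTop :=
    tendsto_atTop_mono (fun n => Nat.le_add_right n _) tendsto_id
  have h2 : Tendsto (fun n : ℕ => (1 : ℝ) + (⌊ε * (n : ℝ)⌋₊ : ℝ) / (n : ℝ)) atTop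
      (nhds (1 + ε)) :=
    tendsto_const_nhds.add ((tendsto_nat_floor_mul_div_atTop hε).comp tendsto_natCast_atTop_atTop)
  refine ((hu.comp h1).mul h2).congr' ?_
  filter_upwards [eventually_gt_atTop 0] with n hn
  have hn' : (n : ℝ) ≠ 0 := by exact_mod_cast hn.ne'
  have hn2 : ((n : ℝ) + (⌊ε * (n : ℝ)⌋₊ : ℝ)) ≠ 0 := by positivity
  simp only [Function.comp_apply, Nat.cast_add]
  field_simp

theorem tendsto_sub_shift_const_div {u : ℕ → ℝ} {l : ℝ} (M : ℕ)
    (hu : Tendsto (fun n : ℕ => u n / n) atTop (nhds l)) :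
    Tendsto (fun n : ℕ => (u n - u (n - M)) / n) atTop (nhds 0) := by
  have h1 : Tendsto (fun n : ℕ => ((n - M : ℕ) : ℝ) / n) atTop (nhds 1) := by
    have : Tendsto (fun n : ℕ => 1 - (M : ℝ) / n) atTop (nhds (1 - 0)) :=
      tendsto_const_nhds.sub (tendsto_const_div_atTop_nhds_zero_nat _)
    rw [sub_zero] at this
    refine this.congr' ?_
    filter_upwards [eventually_gt_atTop M] with n hn
    have hn' : (n : ℝ) ≠ 0 := by
      have : 0 < n := by omega
      exact_mod_cast this.ne'
    rw [Nat.cast_sub hn.le]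
    field_simp
  have h2 : Tendsto (fun n : ℕ => u (n - M) / (n - M : ℕ)) atTop (nhds l) :=
    hu.comp (tendsto_sub_atTop_nat M)
  have h3 := hu.sub (h2.mul h1)
  rw [mul_one, sub_self] at h3
  refine h3.congr' ?_
  filter_upwards [eventually_gt_atTop M] with n hn
  have hn' : (n : ℝ) ≠ 0 := by
    have : 0 < n := by omega
    exact_mod_cast this.ne'
  have hn2 : ((n - M : ℕ) : ℝ) ≠ 0 := by
    have : 0 < n - M := by omega
    exact_mod_cast this.ne'
  field_simp

variable {Ω : Type*} {θ : Ω → Ω}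

theorem birkhoffSum_mono_of_nonneg {L : Ω → ℝ} (hL : ∀ ω, 0 ≤ L ω) (ω : Ω) :
    Monotone fun n => birkhoffSum θ L n ω :=
  monotone_nat_of_le_succ fun n => by
    rw [birkhoffSum_succ]
    linarith [hL (θ^[n] ω)]

variable [MeasurableSpace Ω] {P : Measure Ω}

/-- Visits to a set of positive measure happen with sublinear gaps. -/
theorem ae_eventually_exists_visit [IsProbabilityMeasure P] (hθ : Ergodic θ P) {G : Set Ω}
    (hG : MeasurableSet G) (hPG : P G ≠ 0) :
    ∀ᵐ ω ∂P, ∀ ε > (0 : ℝ), ∀ᶠ n : ℕ in atTop,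
      ∃ k, n ≤ k ∧ k ≤ n + ⌊ε * n⌋₊ ∧ θ^[k] ω ∈ G := by
  have hint : Integrable (G.indicator fun _ => (1 : ℝ)) P := (integrable_const 1).indicator hG
  filter_upwards [ae_tendsto_birkhoffSum_div hθ hint] with ω hω ε hε
  have hp : 0 < ∫ ω, G.indicator (fun _ => (1 : ℝ)) ω ∂P := by
    rw [integral_indicator hG]
    simp only [integral_const, smul_eq_mul, mul_one]
    simpa [Measure.real, ENNReal.toReal_pos_iff, pos_iff_ne_zero] using hPG
  have h1 := tendsto_shift_floor_div hω hε.le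
  -- The averages tend to p and p(1 + ε) with p > 0, so the count of visits strictly increases in
  -- the window; without a visit it would stay constant.
  have hlt := hω.eventually_lt h1 (by nlinarith)
  filter_upwards [hlt, eventually_gt_atTop 0] with n hn hn0
  by_contra! hcon
  have hn' : (0 : ℝ) < n := by exact_mod_cast hn0
  rw [div_lt_div_iff_of_pos_right hn', birkhoffSum_add] at hn
  have : birkhoffSum θ (G.indicator fun _ => (1 : ℝ)) ⌊ε * (n : ℝ)⌋₊ (θ^[n] ω) = 0 := by
    refine Finset.sum_eq_zero fun i hi => ?_
    rw [← Function.iterate_add_apply]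
    refine indicator_of_notMem (hcon _ (by omega) ?_) _
    have := Finset.mem_range.1 hi
    omega
  linarith

/-- A sequence of nonpositive functions `W n`, superadditive along the orbits of `θ` up to the
constant `C` whenever the cutting time is a visit to `G`, with increments controlled by `L`. -/
structure GappedSuperadditive (P : Measure Ω) (θ : Ω → Ω) (W : ℕ → Ω → ℝ) (L : Ω → ℝ)
    (G : Set Ω) (C : ℝ) : Prop where
  measurable : ∀ n, Measurable (W n)
  zero : ∀ ω, W 0 ω = 0
  nonpos : ∀ n ω, W n ω ≤ 0
  bound_nonneg : ∀ ω, 0 ≤ L ω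
  bound_integrable : Integrable L P
  right : ∀ n ω, W n ω - L (θ^[n] ω) ≤ W (n + 1) ω
  left : ∀ n ω, W n (θ ω) - L ω ≤ W (n + 1) ω
  measurableSet : MeasurableSet G
  measure_ne_zero : P G ≠ 0
  superadd : ∀ n m ω, θ^[n] ω ∈ G → W n ω + W m (θ^[n] ω) - C ≤ W (n + m) ω

namespace GappedSuperadditive

variable {W : ℕ → Ω → ℝ} {L : Ω → ℝ} {G : Set Ω} {C : ℝ}

theorem right_iterate (h : GappedSuperadditive P θ W L G C) (n : ℕ) (ω : Ω) {k : ℕ} (hk : n ≤ k) :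
    W n ω - (birkhoffSum θ L k ω - birkhoffSum θ L n ω) ≤ W k ω := by
  induction k, hk using Nat.le_induction with
  | base => simp
  | succ k hk ih =>
    have := h.right k ω
    rw [birkhoffSum_succ]
    linarith

theorem left_iterate (h : GappedSuperadditive P θ W L G C) (n k : ℕ) (ω : Ω) :
    W n (θ^[k] ω) - birkhoffSum θ L k ω ≤ W (n + k) ω := by
  induction k generalizing ω with
  | zero => simp
  | succ k ih =>
    have h1 := ih (θ ω)
    have h2 := h.left (n + k) ω
    rw [birkhoffSum_succ', Function.iterate_succ_apply, ← add_assoc]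
    linarith

theorem neg_birkhoffSum_le (h : GappedSuperadditive P θ W L G C) (n : ℕ) (ω : Ω) :
    -birkhoffSum θ L n ω ≤ W n ω := by
  have := h.right_iterate 0 ω (Nat.zero_le n)
  simpa [h.zero] using this

theorem measurableSet_frequently (h : GappedSuperadditive P θ W L G C) (c : ℝ) :
    MeasurableSet {ω | ∃ᶠ n : ℕ in atTop, c * n ≤ W n ω} := by
  simp only [frequently_atTop, ofPred_forall, ofPred_exists, ofPred_and]
  refine MeasurableSet.iInter fun a => MeasurableSet.iUnion fun b => ?_
  exact (MeasurableSet.const _).inter (measurableSet_le measurable_const (h.measurable b))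

/-- Almost every orbit reaches the event where c n ≤ W n happens infinitely often. Pulling this back
k steps with `left_iterate` costs a fixed amount, absorbed by (c - c') n. -/
theorem ae_frequently_of_lt [IsProbabilityMeasure P] (hθ : Ergodic θ P)
    (h : GappedSuperadditive P θ W L G C) {c c' : ℝ} (hc : c' < c)
    (hpos : P {ω | ∃ᶠ n : ℕ in atTop, c * n ≤ W n ω} ≠ 0) :
    ∀ᵐ ω ∂P, ∃ᶠ n : ℕ in atTop, c' * n ≤ W n ω := by
  filter_upwards [ae_eventually_exists_visit hθ (h.measurableSet_frequently c) hpos] with ω hω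
  obtain ⟨n, k, -, -, hk⟩ := (hω 1 one_pos).exists
  have hk' : ∃ᶠ n : ℕ in atTop, c * n ≤ W n (θ^[k] ω) := hk
  have hlin : ∀ᶠ n : ℕ in atTop, birkhoffSum θ L k ω + c' * k ≤ (c - c') * n :=
    (tendsto_natCast_atTop_atTop.const_mul_atTop (sub_pos.2 hc)).eventually_ge_atTop _
  have h1 : ∃ᶠ n : ℕ in atTop, c' * (n + k : ℕ) ≤ W (n + k) ω := by
    refine (hk'.and_eventually hlin).mono fun n ⟨h1, h2⟩ => ?_
    have h3 := h.left_iterate n k ω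
    push_cast
    linarith
  exact (tendsto_add_atTop_nat k).frequently h1

/-- A good time n can be delayed to the next visit k ≤ n + εn to G. The delay costs the increments
of L over the window, about ε n ∫ L; as c' < 0, the requirement c' k is even weaker than c' n. -/
theorem ae_frequently_visit [IsProbabilityMeasure P] (hθ : Ergodic θ P)
    (h : GappedSuperadditive P θ W L G C) {c c' : ℝ} (hc : c' < c) (hc0 : c ≤ 0) :
    ∀ᵐ ω ∂P, (∃ᶠ n : ℕ in atTop, c * n ≤ W n ω) →
      ∃ᶠ n : ℕ in atTop, θ^[n] ω ∈ G ∧ c' * n ≤ W n ω := by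
  filter_upwards [ae_eventually_exists_visit hθ h.measurableSet h.measure_ne_zero,
    ae_tendsto_birkhoffSum_div hθ h.bound_integrable] with ω hv hL hfr
  set l := ∫ ω, L ω ∂P
  have hl : 0 ≤ l := integral_nonneg h.bound_nonneg
  -- Chosen so that ε ∫ L < c - c'; the summand 1 covers the case ∫ L = 0.
  set ε := (c - c') / (2 * (l + 1)) with hε
  have hε0 : 0 < ε := div_pos (sub_pos.2 hc) (by positivity)
  have hlε : l * ε < c - c' := by
    rw [hε, mul_div_assoc', div_lt_iff₀ (by positivity)]
    nlinarith
  have hlim := (tendsto_shift_floor_div hL hε0.le).sub hL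
  have hlim' := hlim.eventually_lt_const (show l * (1 + ε) - l < c - c' by linarith)
  rw [frequently_atTop] at hfr ⊢
  intro a
  obtain ⟨N, hN⟩ := eventually_atTop.1
    ((hlim'.and (hv ε hε0)).and ((eventually_ge_atTop a).and (eventually_gt_atTop 0)))
  obtain ⟨n, hn, hcn⟩ := hfr N
  obtain ⟨⟨h1, k, hnk, hkn, hkG⟩, hna, hn0⟩ := hN n hn
  refine ⟨k, hna.trans hnk, hkG, ?_⟩
  have hn' : (0 : ℝ) < n := by exact_mod_cast hn0
  rw [← sub_div, div_lt_iff₀ hn'] at h1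
  have h2 := h.right_iterate n ω hnk
  have h3 := birkhoffSum_mono_of_nonneg (θ := θ) h.bound_nonneg ω hkn
  have h4 : (n : ℝ) ≤ k := by exact_mod_cast hnk
  simp only at h3
  nlinarith

/-- Cutting an orbit segment into good blocks of length at most `M` and bad points. -/
theorem block_bound (h : GappedSuperadditive P θ W L G C) {b : ℝ} (hb : 0 ≤ b) {M : ℕ}
    {B : Set Ω} (hB : ∀ ω ∉ B, ∃ n, 1 ≤ n ∧ n ≤ M ∧ θ^[n] ω ∈ G ∧ -b * n ≤ W n ω - C)
    (N : ℕ) (ω : Ω) :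
    -b * N - birkhoffSum θ (B.indicator L) N ω -
      (birkhoffSum θ L N ω - birkhoffSum θ L (N - M) ω) ≤ W N ω := by
  induction N using Nat.strong_induction_on generalizing ω with
  | _ N ih =>
  have hBL : ∀ ω, 0 ≤ B.indicator L ω := fun ω => indicator_nonneg (fun ω _ => h.bound_nonneg ω) ω
  -- The boundary term, the sum of L over the last M points, does not grow when an initial piece is
  -- removed.
  have hshift : ∀ n, n ≤ N →
      birkhoffSum θ L (N - n) (θ^[n] ω) - birkhoffSum θ L (N - n - M) (θ^[n] ω) ≤
        birkhoffSum θ L N ω - birkhoffSum θ L (N - M) ω := by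
    intro n hn
    have h1 := birkhoffSum_add θ L n (N - n) ω
    have h2 := birkhoffSum_add θ L n (N - n - M) ω
    have h3 := birkhoffSum_mono_of_nonneg (θ := θ) h.bound_nonneg ω
      (show N - M ≤ n + (N - n - M) by omega)
    rw [Nat.add_sub_cancel' hn] at h1
    simp only at h3
    linarith
  rcases Nat.eq_zero_or_pos N with rfl | hN
  · simp [h.zero]
  -- A bad point is skipped alone at the cost L ω. A good point starts a block ending in G, where
  -- superadditivity applies and its constant C is already paid by the block.
  by_cases hω : ω ∈ B
  · have h1 := ih (N - 1) (by omega) (θ ω)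
    have h2 := h.left (N - 1) ω
    have h3 := hshift 1 hN
    have h4 := birkhoffSum_succ' θ (B.indicator L) (N - 1) ω
    rw [Nat.sub_add_cancel hN] at h2 h4
    rw [indicator_of_mem hω] at h4
    rw [Function.iterate_one] at h3
    have h5 : ((N - 1 : ℕ) : ℝ) = N - 1 := by simp [Nat.cast_sub hN]
    rw [h5] at h1
    linarith
  · obtain ⟨n, hn1, hnM, hnG, hn⟩ := hB ω hω
    rcases le_or_gt n N with hnN | hnN
    · have h1 := ih (N - n) (by omega) (θ^[n] ω)
      have h2 := h.superadd n (N - n) ω hnG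
      have h3 := hshift n hnN
      have h4 := birkhoffSum_add θ (B.indicator L) n (N - n) ω
      rw [Nat.add_sub_cancel' hnN] at h2 h4
      have h5 : ((N - n : ℕ) : ℝ) = N - n := by simp [Nat.cast_sub hnN]
      rw [h5] at h1
      have h6 : 0 ≤ birkhoffSum θ (B.indicator L) n ω := Finset.sum_nonneg fun _ _ => hBL _
      linarith
    -- The block overshoots the segment, so N < M and the boundary term contains all of the sum of
    -- L.
    · have h1 := h.neg_birkhoffSum_le N ω
      have h2 : 0 ≤ birkhoffSum θ (B.indicator L) N ω := Finset.sum_nonneg fun _ _ => hBL _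
      have h3 : 0 ≤ b * N := by positivity
      rw [show N - M = 0 by omega]
      simp only [birkhoffSum_zero]
      linarith

/-- A lower rate attained infinitely often on a set of positive measure is attained eventually
almost everywhere: good blocks of length at most M cover most of an orbit, and the uncovered points
carry little of L when M is large. -/
theorem ae_eventually_ge [IsProbabilityMeasure P] (hθ : Ergodic θ P)
    (h : GappedSuperadditive P θ W L G C) {c c' : ℝ} (hc : c' < c) (hc0 : c ≤ 0)
    (hpos : P {ω | ∃ᶠ n : ℕ in atTop, c * n ≤ W n ω} ≠ 0) :
    ∀ᵐ ω ∂P, ∀ᶠ n : ℕ in atTop, c' < W n ω / n := by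
  -- The ladder c' < e < e₁ < e₂ < c pays in turn for the bad points (e - c'), the constant C (e₁ -
  -- e), the delay until a visit (e₂ - e₁) and the change of starting point (c - e₂).
  obtain ⟨e, he1, he2⟩ := exists_between hc
  obtain ⟨e₁, he11, he12⟩ := exists_between he2
  obtain ⟨e₂, he21, he22⟩ := exists_between he12
  let B : ℕ → Set Ω := fun M =>
    {ω | ∀ n, 1 ≤ n → n ≤ M → ¬(θ^[n] ω ∈ G ∧ e * n ≤ W n ω - C)}
  have hBm : ∀ M, MeasurableSet (B M) := by
    intro M
    simp only [B, ofPred_forall]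
    refine MeasurableSet.iInter fun n => MeasurableSet.iInter fun _ => MeasurableSet.iInter
      fun _ => MeasurableSet.compl ?_
    exact (hθ.measurable.iterate n h.measurableSet).inter
      (measurableSet_le measurable_const ((h.measurable n).sub_const C))
  have hBanti : Antitone B := fun M M' hM ω hω n h1 h2 => hω n h1 (h2.trans hM)
  have hgood : ∀ᵐ ω ∂P, ω ∉ ⋂ M, B M := by
    filter_upwards [h.ae_frequently_of_lt hθ he22 hpos,
      h.ae_frequently_visit hθ he21 (he22.le.trans hc0)] with ω h1 h2
    have hlin : ∀ᶠ n : ℕ in atTop, C ≤ (e₁ - e) * n :=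
      (tendsto_natCast_atTop_atTop.const_mul_atTop (sub_pos.2 he11)).eventually_ge_atTop _
    obtain ⟨n, ⟨hnG, hnW⟩, hnC, hn1⟩ :=
      ((h2 h1).and_eventually (hlin.and (eventually_ge_atTop 1))).exists
    intro hω
    exact mem_iInter.1 hω n n hn1 le_rfl ⟨hnG, by linarith⟩
  have hnull : P (⋂ M, B M) = 0 := by
    exact measure_eq_zero_iff_ae_notMem.2 hgood
  -- The bad sets decrease to a null set, so their share of the integral of L vanishes.
  have hint : Tendsto (fun M => ∫ ω in B M, L ω ∂P) atTop (nhds 0) := by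
    have := tendsto_setIntegral_of_antitone (μ := P) (f := L) hBm hBanti
      ⟨0, h.bound_integrable.integrableOn⟩
    rwa [Measure.restrict_eq_zero.2 hnull, integral_zero_measure] at this
  obtain ⟨M, hM⟩ := (hint.eventually_lt_const (show 0 < e - c' by linarith)).exists
  filter_upwards [ae_tendsto_birkhoffSum_div hθ h.bound_integrable,
    ae_tendsto_birkhoffSum_div hθ (h.bound_integrable.indicator (hBm M))] with ω hL hBL
  rw [integral_indicator (hBm M)] at hBL
  have hlim := (hBL.add (tendsto_sub_shift_const_div M hL)).eventually_lt_const
    (show _ < e - c' by simpa using hM)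
  filter_upwards [hlim, eventually_gt_atTop 0] with n hn hn0
  have hn' : (0 : ℝ) < n := by exact_mod_cast hn0
  have hblock := h.block_bound (b := -e) (by linarith) (M := M) (B := B M) (by
    intro ω hω
    simp only [B, mem_ofPred_eq, not_forall, not_not] at hω
    obtain ⟨n, h1, h2, h3, h4⟩ := hω
    exact ⟨n, h1, h2, h3, by simpa using h4⟩) n ω
  rw [← add_div, div_lt_iff₀ hn'] at hn
  rw [lt_div_iff₀ hn']
  linarith

/-- The limit is the largest rate reached infinitely often with positive probability. Above it, the
rate fails eventually almost surely by definition; below it, `ae_eventually_ge` applies. -/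
theorem exists_ae_tendsto [IsProbabilityMeasure P] (hθ : Ergodic θ P)
    (h : GappedSuperadditive P θ W L G C) :
    ∃ w : ℝ, w ≤ 0 ∧ ∀ᵐ ω ∂P, Tendsto (fun n : ℕ => W n ω / n) atTop (nhds w) := by
  set S : Set ℝ := {c | P {ω | ∃ᶠ n : ℕ in atTop, c * n ≤ W n ω} ≠ 0} with hS
  have hS0 : ∀ c ∈ S, c ≤ 0 := by
    intro c hc
    by_contra! hpos
    refine hc ?_
    convert measure_empty (μ := P)
    refine eq_empty_of_forall_notMem fun ω hω => ?_
    obtain ⟨n, hn, hn0⟩ := ((show ∃ᶠ n : ℕ in atTop, c * n ≤ W n ω from hω).and_eventually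
      (eventually_gt_atTop 0)).exists
    have hn' : (0 : ℝ) < n := by exact_mod_cast hn0
    nlinarith [h.nonpos n ω]
  have hne : S.Nonempty := by
    refine ⟨-(∫ ω, L ω ∂P + 1), ?_⟩
    have hae : ∀ᵐ ω ∂P, ∃ᶠ n : ℕ in atTop, -(∫ ω, L ω ∂P + 1) * n ≤ W n ω := by
      filter_upwards [ae_tendsto_birkhoffSum_div hθ h.bound_integrable] with ω hω
      refine Eventually.frequently ?_
      filter_upwards [hω.eventually_lt_const (lt_add_one _), eventually_gt_atTop 0] with n hn hn0
      have hn' : (0 : ℝ) < n := by exact_mod_cast hn0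
      rw [div_lt_iff₀ hn'] at hn
      have := h.neg_birkhoffSum_le n ω
      linarith
    intro h0
    obtain ⟨ω, h1, h2⟩ := (hae.and (measure_eq_zero_iff_ae_notMem.1 h0)).exists
    exact h2 h1
  have hbdd : BddAbove S := ⟨0, hS0⟩
  refine ⟨sSup S, csSup_le hne hS0, ?_⟩
  have hlow : ∀ k : ℕ, ∀ᵐ ω ∂P, ∀ᶠ n : ℕ in atTop, sSup S - 1 / ((k : ℝ) + 1) < W n ω / n := by
    intro k
    obtain ⟨c, hcS, hc⟩ := exists_lt_of_lt_csSup hne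
      (sub_lt_self (sSup S) (Nat.one_div_pos_of_nat (α := ℝ) (n := k)))
    exact h.ae_eventually_ge hθ hc (hS0 c hcS) hcS
  have hup : ∀ k : ℕ, ∀ᵐ ω ∂P, ∀ᶠ n : ℕ in atTop, W n ω / n < sSup S + 1 / ((k : ℝ) + 1) := by
    intro k
    have hk : sSup S + 1 / ((k : ℝ) + 1) ∉ S := fun hmem => by
      have := le_csSup hbdd hmem
      linarith [Nat.one_div_pos_of_nat (α := ℝ) (n := k)]
    have hk' : ∀ᵐ ω ∂P, ¬∃ᶠ n : ℕ in atTop, (sSup S + 1 / ((k : ℝ) + 1)) * n ≤ W n ω := by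
      rw [ae_iff]
      simp only [not_not]
      exact not_not.1 hk
    filter_upwards [hk'] with ω hω
    filter_upwards [not_frequently.1 hω, eventually_gt_atTop 0] with n hn hn0
    have hn' : (0 : ℝ) < n := by exact_mod_cast hn0
    rw [div_lt_iff₀ hn']
    exact not_le.1 hn
  filter_upwards [ae_all_iff.2 hlow, ae_all_iff.2 hup] with ω h1 h2
  rw [Metric.tendsto_nhds]
  intro ε hε
  obtain ⟨k, hk⟩ := exists_nat_one_div_lt hε
  filter_upwards [h1 k, h2 k] with n hn1 hn2
  rw [Real.dist_eq, abs_lt]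
  constructor <;> linarith

end GappedSuperadditive

end Gapped

/-! ## Large deviation bounds from exponentially penalized deviations -/

section LargeDeviations

variable {X : ℕ → Type*} [∀ n, Fintype (X n)] {p Y : ∀ n, X n → ℝ}

/-- The `p n`-expectation of `exp (-K |Y n - n s|)`. -/
def penalized (p Y : ∀ n, X n → ℝ) (K s : ℝ) (n : ℕ) : ℝ :=
  ∑ a, Real.exp (-(K * |Y n a - n * s|)) * p n a

/-- The weight of the event that `Y n / n` lies in `S`. -/
def weightOf (p Y : ∀ n, X n → ℝ) (n : ℕ) (S : Set ℝ) : ℝ :=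
  ∑ a, Set.indicator {a | Y n a / n ∈ S} (p n) a

/-- The rate function associated with the growth rates of the penalized expectations. -/
def rateFunction (Λ : ℕ → ℝ → ℝ) (s : ℝ) : ℝ≥0∞ := ⨆ K : ℕ, ENNReal.ofReal (-Λ K s)

theorem weightOf_le_weightOf (hp : ∀ n a, 0 ≤ p n a) (n : ℕ) {S S' : Set ℝ}
    (h : ∀ a, p n a ≠ 0 → Y n a / n ∈ S → Y n a / n ∈ S') :
    weightOf p Y n S ≤ weightOf p Y n S' := by
  refine Finset.sum_le_sum fun a _ => ?_
  classical
  simp only [indicator_apply, mem_ofPred_eq]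
  have h1 := hp n a
  have h2 := h a
  by_cases h0 : p n a = 0
  · simp [h0]
  · split_ifs <;> simp_all

theorem weightOf_mono (hp : ∀ n a, 0 ≤ p n a) (n : ℕ) {S S' : Set ℝ} (h : S ⊆ S') :
    weightOf p Y n S ≤ weightOf p Y n S' :=
  weightOf_le_weightOf hp n fun _ _ ha => h ha

theorem weightOf_union_le (hp : ∀ n a, 0 ≤ p n a) (n : ℕ) (S S' : Set ℝ) :
    weightOf p Y n (S ∪ S') ≤ weightOf p Y n S + weightOf p Y n S' := by
  rw [weightOf, weightOf, weightOf, ← Finset.sum_add_distrib]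
  refine Finset.sum_le_sum fun a _ => ?_
  classical
  simp only [indicator_apply, mem_ofPred_eq, mem_union]
  have := hp n a
  split_ifs <;> first | linarith | simp_all

/-- Markov's inequality: on the ball the penalty is at least e^{-nKε}. -/
theorem weightOf_le_penalized (hp : ∀ n a, 0 ≤ p n a) {K : ℝ} (hK : 0 ≤ K) (s ε : ℝ) {n : ℕ}
    (hn : 0 < n) :
    weightOf p Y n (Metric.closedBall s ε) ≤ Real.exp (n * (K * ε)) * penalized p Y K s n := by
  rw [weightOf, penalized, Finset.mul_sum]
  refine Finset.sum_le_sum fun a _ => ?_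
  have hn' : (0 : ℝ) < n := by exact_mod_cast hn
  by_cases ha : Y n a / n ∈ Metric.closedBall s ε
  · rw [indicator_of_mem (by exact ha)]
    rw [← mul_assoc, ← Real.exp_add]
    have h1 : |Y n a / n - s| ≤ ε := by simpa [Real.dist_eq] using ha
    have h2 : |Y n a - n * s| ≤ n * ε := by
      have : Y n a - n * s = n * (Y n a / n - s) := by field_simp
      rw [this, abs_mul, abs_of_pos hn']
      exact mul_le_mul_of_nonneg_left h1 hn'.le
    have h3 : 1 ≤ Real.exp (n * (K * ε) + -(K * |Y n a - n * s|)) := by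
      rw [Real.one_le_exp_iff]
      nlinarith
    nlinarith [hp n a]
  · rw [indicator_of_notMem (by exact ha)]
    exact mul_nonneg (Real.exp_pos _).le (mul_nonneg (Real.exp_pos _).le (hp n a))

/-- Off the ball the penalty is at most e^{-nKε}, and the total mass is one. -/
theorem penalized_le_weightOf_add (hp : ∀ n a, 0 ≤ p n a) (hmass : ∀ n, ∑ a, p n a = 1) {K : ℝ}
    (hK : 0 ≤ K) (s ε : ℝ) {n : ℕ} (hn : 0 < n) :
    penalized p Y K s n ≤ weightOf p Y n (Metric.ball s ε) + Real.exp (-(n * (K * ε))) := by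
  have hn' : (0 : ℝ) < n := by exact_mod_cast hn
  rw [← mul_one (Real.exp (-(n * (K * ε)))), ← hmass n, Finset.mul_sum, weightOf,
    ← Finset.sum_add_distrib, penalized]
  refine Finset.sum_le_sum fun a _ => ?_
  have hpa := hp n a
  by_cases ha : Y n a / n ∈ Metric.ball s ε
  · rw [indicator_of_mem (by exact ha)]
    have h1 : Real.exp (-(K * |Y n a - n * s|)) ≤ 1 := by
      rw [Real.exp_le_one_iff]
      have := mul_nonneg hK (abs_nonneg (Y n a - n * s))
      linarith
    have := mul_nonneg (Real.exp_pos (-(n * (K * ε)))).le hpa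
    nlinarith
  · rw [indicator_of_notMem (by exact ha), zero_add]
    refine mul_le_mul_of_nonneg_right (Real.exp_le_exp.2 ?_) hpa
    have h1 : ε ≤ |Y n a / n - s| := by simpa [Real.dist_eq] using ha
    have h2 : n * ε ≤ |Y n a - n * s| := by
      have : Y n a - n * s = n * (Y n a / n - s) := by field_simp
      rw [this, abs_mul, abs_of_pos hn']
      exact mul_le_mul_of_nonneg_left h1 hn'.le
    nlinarith

theorem penalized_pos (hp : ∀ n a, 0 ≤ p n a) (hmass : ∀ n, ∑ a, p n a = 1) (K s : ℝ) (n : ℕ) :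
    0 < penalized p Y K s n := by
  obtain ⟨a, -, ha⟩ : ∃ a ∈ Finset.univ, p n a ≠ 0 :=
    Finset.exists_ne_zero_of_sum_ne_zero (by rw [hmass n]; exact one_ne_zero)
  exact Finset.sum_pos' (fun a _ => mul_nonneg (Real.exp_pos _).le (hp n a))
    ⟨a, Finset.mem_univ a, mul_pos (Real.exp_pos _) ((hp n a).lt_of_ne' ha)⟩

variable {Λ : ℕ → ℝ → ℝ}

theorem eventually_penalized_lt (hp : ∀ n a, 0 ≤ p n a) (hmass : ∀ n, ∑ a, p n a = 1) {K s l c : ℝ}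
    (hZ : Tendsto (fun n : ℕ => Real.log (penalized p Y K s n) / n) atTop (nhds l)) (hc : l < c) :
    ∀ᶠ n : ℕ in atTop, penalized p Y K s n < Real.exp (n * c) := by
  filter_upwards [hZ.eventually_lt_const hc, eventually_gt_atTop 0] with n hn hn0
  have hn' : (0 : ℝ) < n := by exact_mod_cast hn0
  rw [div_lt_iff₀ hn', Real.log_lt_iff_lt_exp (penalized_pos hp hmass K s n)] at hn
  rwa [mul_comm]

theorem eventually_lt_penalized (hp : ∀ n a, 0 ≤ p n a) (hmass : ∀ n, ∑ a, p n a = 1) {K s l c : ℝ}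
    (hZ : Tendsto (fun n : ℕ => Real.log (penalized p Y K s n) / n) atTop (nhds l)) (hc : c < l) :
    ∀ᶠ n : ℕ in atTop, Real.exp (n * c) < penalized p Y K s n := by
  filter_upwards [hZ.eventually_const_lt hc, eventually_gt_atTop 0] with n hn hn0
  have hn' : (0 : ℝ) < n := by exact_mod_cast hn0
  rw [lt_div_iff₀ hn', Real.lt_log_iff_exp_lt (penalized_pos hp hmass K s n)] at hn
  rwa [mul_comm]

theorem exists_eventually_weightOf_le (hp : ∀ n a, 0 ≤ p n a) (hmass : ∀ n, ∑ a, p n a = 1)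
    (hZ : ∀ (K : ℕ) (s : ℝ),
      Tendsto (fun n : ℕ => Real.log (penalized p Y K s n) / n) atTop (nhds (Λ K s)))
    {ℓ s : ℝ} {K : ℕ} (hℓ : ℓ < -Λ K s) :
    ∃ ε > 0, ∃ ℓ' > ℓ, ∀ᶠ n : ℕ in atTop,
      weightOf p Y n (Metric.closedBall s ε) ≤ Real.exp (-(n * ℓ')) := by
  -- One third of the slack pays for the radius of the ball, one for the convergence to Λ K s, and
  -- one is left as ℓ' - ℓ. The denominator K + 1 below allows K = 0.
  set δ := (-Λ K s - ℓ) / 3 with hδ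
  have hδ0 : 0 < δ := by rw [hδ]; linarith
  refine ⟨δ / (K + 1), by positivity, ℓ + δ, by linarith, ?_⟩
  have hKδ : K * (δ / (K + 1)) ≤ δ := by
    rw [mul_div_assoc', div_le_iff₀ (by positivity)]
    nlinarith
  filter_upwards [eventually_penalized_lt hp hmass (hZ K s) (show Λ K s < Λ K s + δ by linarith),
    eventually_gt_atTop 0] with n hn hn0
  refine (weightOf_le_penalized hp K.cast_nonneg s _ hn0).trans ?_
  refine (mul_le_mul_of_nonneg_left hn.le (Real.exp_pos _).le).trans ?_
  rw [← Real.exp_add, Real.exp_le_exp, ← mul_add, ← mul_neg]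
  refine mul_le_mul_of_nonneg_left ?_ n.cast_nonneg
  linarith

/-- The strict gain ℓ' > ℓ makes the property stable under finite unions: it absorbs the factor 2.
-/
theorem eventually_weightOf_le_of_isCompact (hp : ∀ n a, 0 ≤ p n a)
    (hmass : ∀ n, ∑ a, p n a = 1)
    (hZ : ∀ (K : ℕ) (s : ℝ),
      Tendsto (fun n : ℕ => Real.log (penalized p Y K s n) / n) atTop (nhds (Λ K s)))
    {ℓ : ℝ} {S : Set ℝ} (hS : IsCompact S) (hℓ : ∀ s ∈ S, ∃ K, ℓ < -Λ K s) :
    ∃ ℓ' > ℓ, ∀ᶠ n : ℕ in atTop, weightOf p Y n S ≤ Real.exp (-(n * ℓ')) := by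
  refine hS.induction_on (p := fun S => ∃ ℓ' > ℓ, ∀ᶠ n : ℕ in atTop,
    weightOf p Y n S ≤ Real.exp (-(n * ℓ'))) ?_ ?_ ?_ ?_
  · exact ⟨ℓ + 1, by linarith, Eventually.of_forall fun n => by
      simpa [weightOf] using (Real.exp_pos _).le⟩
  · rintro S S' h ⟨ℓ', hℓ', hev⟩
    exact ⟨ℓ', hℓ', hev.mono fun n hn => (weightOf_mono hp n h).trans hn⟩
  · rintro S S' ⟨ℓ₁, h1, hev1⟩ ⟨ℓ₂, h2, hev2⟩
    obtain ⟨ℓ', h3, h4⟩ := exists_between (lt_min h1 h2)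
    have hlin : ∀ᶠ n : ℕ in atTop, Real.log 2 ≤ (min ℓ₁ ℓ₂ - ℓ') * n :=
      (tendsto_natCast_atTop_atTop.const_mul_atTop (sub_pos.2 h4)).eventually_ge_atTop _
    refine ⟨ℓ', h3, ?_⟩
    filter_upwards [hev1, hev2, hlin] with n hn1 hn2 hn
    have h5 : 2 * Real.exp (-(n * min ℓ₁ ℓ₂)) ≤ Real.exp (-(n * ℓ')) := by
      rw [← Real.exp_log two_pos, ← Real.exp_add, Real.exp_le_exp]
      linarith
    have h6 : Real.exp (-(n * ℓ₁)) ≤ Real.exp (-(n * min ℓ₁ ℓ₂)) := by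
      rw [Real.exp_le_exp, neg_le_neg_iff]
      exact mul_le_mul_of_nonneg_left (min_le_left _ _) n.cast_nonneg
    have h7 : Real.exp (-(n * ℓ₂)) ≤ Real.exp (-(n * min ℓ₁ ℓ₂)) := by
      rw [Real.exp_le_exp, neg_le_neg_iff]
      exact mul_le_mul_of_nonneg_left (min_le_right _ _) n.cast_nonneg
    linarith [weightOf_union_le (Y := Y) hp n S S']
  · intro s hs
    obtain ⟨K, hK⟩ := hℓ s hs
    obtain ⟨ε, hε, h⟩ := exists_eventually_weightOf_le hp hmass hZ hK
    exact ⟨_, mem_nhdsWithin_of_mem_nhds (Metric.closedBall_mem_nhds s hε), h⟩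

theorem exists_ofReal_lt_of_lt_rateFunction {ℓ s : ℝ} (hℓ : 0 ≤ ℓ)
    (h : (ℓ : EReal) < rateFunction Λ s) : ∃ K, ℓ < -Λ K s := by
  have h1 : ENNReal.ofReal ℓ < rateFunction Λ s := by
    rw [← EReal.coe_ennreal_lt_coe_ennreal_iff, EReal.coe_ennreal_ofReal, max_eq_left hℓ]
    exact h
  obtain ⟨K, hK⟩ := lt_iSup_iff.1 h1
  exact ⟨K, (ENNReal.ofReal_lt_ofReal_iff_of_nonneg hℓ).1 hK⟩

theorem neg_le_of_rateFunction_lt {z s : ℝ} (h : (rateFunction Λ s : EReal) < z) (K : ℕ) :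
    -Λ K s < z ∧ 0 < z := by
  have h0 : (0 : EReal) < z := (EReal.coe_ennreal_nonneg _).trans_lt h
  have hz : 0 < z := by exact_mod_cast h0
  refine ⟨?_, hz⟩
  have h1 : (ENNReal.ofReal (-Λ K s) : EReal) ≤ rateFunction Λ s :=
    EReal.coe_ennreal_le_coe_ennreal_iff.2 (le_iSup (fun K => ENNReal.ofReal (-Λ K s)) K)
  have h2 := h1.trans_lt h
  rw [EReal.coe_ennreal_ofReal] at h2
  have h3 : max (-Λ K s) 0 < z := by exact_mod_cast h2
  exact (le_max_left _ _).trans_lt h3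

theorem log_ofReal_div_le {x z : ℝ} {n : ℕ} (hn : 0 < n) (h : x ≤ Real.exp (n * z)) :
    ENNReal.log (ENNReal.ofReal x) / (n : EReal) ≤ z := by
  rw [EReal.div_le_iff_le_mul (by exact_mod_cast hn) (EReal.natCast_ne_top n)]
  refine (ENNReal.log_monotone (ENNReal.ofReal_le_ofReal h)).trans ?_
  rw [ENNReal.log_ofReal_of_pos (Real.exp_pos _), Real.log_exp]
  push_cast
  exact le_rfl

theorem le_log_ofReal_div {x z : ℝ} {n : ℕ} (hn : 0 < n) (h : Real.exp (n * z) ≤ x) :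
    (z : EReal) ≤ ENNReal.log (ENNReal.ofReal x) / (n : EReal) := by
  rw [EReal.le_div_iff_mul_le (by exact_mod_cast hn) (EReal.natCast_ne_top n)]
  refine le_trans ?_ (ENNReal.log_monotone (ENNReal.ofReal_le_ofReal h))
  rw [ENNReal.log_ofReal_of_pos (Real.exp_pos _), Real.log_exp, mul_comm]
  push_cast
  exact le_rfl

/-- The lower bound uses one K so large that the part of the penalized expectation outside a ball is
negligible. The upper bound covers the compact set `closure E ∩ Icc (-R) R` by balls, each with its
own K. -/
theorem largeDeviationBounds_of_tendsto_penalized (hp : ∀ n a, 0 ≤ p n a)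
    (hmass : ∀ n, ∑ a, p n a = 1)
    (hZ : ∀ (K : ℕ) (s : ℝ),
      Tendsto (fun n : ℕ => Real.log (penalized p Y K s n) / n) atTop (nhds (Λ K s)))
    {R : ℝ} (hR : ∀ᶠ n : ℕ in atTop, ∀ a, p n a ≠ 0 → |Y n a| ≤ R * n) :
    LargeDeviationBounds p Y (rateFunction Λ) := by
  intro E _
  constructor
  · rw [EReal.neg_le]
    refine le_iInf₂ fun s hs => ?_
    rw [← EReal.le_of_forall_lt_iff_le]
    intro z hz
    rw [EReal.neg_le]
    obtain ⟨-, hz0⟩ := neg_le_of_rateFunction_lt hz 0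
    obtain ⟨ε, hε, hball⟩ := Metric.isOpen_iff.1 isOpen_interior s hs
    -- Then Kε > z, so the mass outside the ball contributes at most e^{-nz}, while the whole is at
    -- least 2e^{-nz} for large n.
    obtain ⟨K, hK⟩ := exists_nat_gt ((z + 1) / ε)
    rw [div_lt_iff₀ hε] at hK
    obtain ⟨hK1, -⟩ := neg_le_of_rateFunction_lt hz K
    refine le_liminf_of_le (by isBoundedDefault) ?_
    obtain ⟨c, hc1, hc2⟩ := exists_between (show -z < Λ K s by linarith)
    have hlin : ∀ᶠ n : ℕ in atTop, Real.log 2 ≤ (min c (-z + 1) - -z) * n :=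
      (tendsto_natCast_atTop_atTop.const_mul_atTop
        (sub_pos.2 (lt_min hc1 (by linarith)))).eventually_ge_atTop _
    filter_upwards [eventually_lt_penalized hp hmass (hZ K s) hc2, hlin,
      eventually_gt_atTop 0] with n hn hnl hn0
    rw [← EReal.coe_neg]
    refine le_log_ofReal_div hn0 ?_
    have h1 := penalized_le_weightOf_add (Y := Y) hp hmass K.cast_nonneg s ε hn0
    have h2 : weightOf p Y n (Metric.ball s ε) ≤ weightOf p Y n E :=
      weightOf_mono hp n (hball.trans interior_subset)
    have hn' : (0 : ℝ) < n := by exact_mod_cast hn0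
    have h3 : 2 * Real.exp (n * -z) ≤ Real.exp (n * c) := by
      rw [← Real.exp_log two_pos, ← Real.exp_add, Real.exp_le_exp]
      nlinarith [min_le_left c (-z + 1)]
    have h4 : Real.exp (-(n * (K * ε))) ≤ Real.exp (n * -z) := by
      rw [Real.exp_le_exp]
      nlinarith
    change Real.exp (n * -z) ≤ weightOf p Y n E
    linarith
  · rw [← EReal.le_of_forall_lt_iff_le]
    intro z hz
    have hz' : ∀ s ∈ closure E, ((-z : ℝ) : EReal) < rateFunction Λ s := by
      intro s hs
      rw [EReal.neg_lt_comm] at hz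
      exact hz.trans_le (iInf₂_le s hs)
    refine limsup_le_of_le (by isBoundedDefault) ?_
    -- For z ≥ 0 the bound is trivial for a probability. The truncation of the rate at zero matters
    -- only here.
    rcases le_or_gt 0 z with hz0 | hz0
    · filter_upwards [eventually_gt_atTop 0] with n hn0
      refine log_ofReal_div_le hn0 ?_
      have h1 : weightOf p Y n E ≤ 1 := by
        rw [← hmass n]
        exact Finset.sum_le_sum fun a _ => indicator_le_self' (fun a _ => hp n a) a
      exact h1.trans (Real.one_le_exp_iff.2 (by positivity))
    · obtain ⟨ℓ', hℓ', hev⟩ := eventually_weightOf_le_of_isCompact hp hmass hZ (ℓ := -z)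
        (S := closure E ∩ Icc (-R) R) (isCompact_Icc.inter_left isClosed_closure)
        (fun s hs => exists_ofReal_lt_of_lt_rateFunction (by linarith) (hz' s hs.1))
      filter_upwards [hev, hR, eventually_gt_atTop 0] with n hn hnR hn0
      have hn' : (0 : ℝ) < n := by exact_mod_cast hn0
      refine log_ofReal_div_le hn0 ?_
      have h1 : weightOf p Y n E ≤ weightOf p Y n (closure E ∩ Icc (-R) R) := by
        refine weightOf_le_weightOf hp n fun a ha haE => ⟨subset_closure haE, ?_⟩
        have h2 := abs_le.1 (hnR a ha)
        rw [mem_Icc, le_div_iff₀ hn', div_le_iff₀ hn']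
        exact ⟨by linarith, h2.2⟩
      refine (h1.trans hn).trans (Real.exp_le_exp.2 ?_)
      nlinarith

end LargeDeviations

/-! ## Weighted evolutions along a random sequence of instruments -/

section Evolution

open scoped MatrixOrder

variable {d : ℕ}

theorem trace_re_le_of_le {X Y : Mat d} (h : X ≤ Y) : X.trace.re ≤ Y.trace.re := by
  have h1 := (Complex.nonneg_iff.1 (Matrix.le_iff.1 h).trace_nonneg).1
  rw [Matrix.trace_sub, Complex.sub_re] at h1
  linarith

theorem trace_re_nonneg {X : Mat d} (h : 0 ≤ X) : 0 ≤ X.trace.re := by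
  simpa using trace_re_le_of_le h

theorem trace_re_smul (c : ℝ) (X : Mat d) : (c • X).trace.re = c * X.trace.re := by
  rw [Matrix.trace_smul, Complex.real_smul, Complex.re_ofReal_mul]

theorem le_trace_smul_one {X : Mat d} (hX : 0 ≤ X) : X ≤ X.trace.re • (1 : Mat d) := by
  have hX' := Matrix.nonneg_iff_posSemidef.1 hX
  rw [← Algebra.algebraMap_eq_smul_one]
  refine le_algebraMap_of_spectrum_le (fun x hx => ?_) (IsSelfAdjoint.of_nonneg hX)
  rw [hX'.1.spectrum_real_eq_range_eigenvalues] at hx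
  obtain ⟨i, rfl⟩ := hx
  rw [hX'.1.trace_eq_sum_eigenvalues]
  simp only [Complex.coe_algebraMap, Complex.re_sum, Complex.ofReal_re]
  exact Finset.single_le_sum (f := hX'.1.eigenvalues) (fun i _ => hX'.eigenvalues_nonneg i)
    (Finset.mem_univ i)

theorem exists_smul_one_le_of_posDef {X : Mat d} (hX : X.PosDef) :
    ∃ c > (0 : ℝ), c • (1 : Mat d) ≤ X := by
  obtain ⟨c, hc, h⟩ : ∃ c > (0 : ℝ), ∀ i, c ≤ hX.1.eigenvalues i := by
    rcases isEmpty_or_nonempty (Fin d) with hd | hd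
    · exact ⟨1, one_pos, fun i => hd.elim i⟩
    · obtain ⟨i, hi⟩ := Finite.exists_min hX.1.eigenvalues
      exact ⟨_, hX.eigenvalues_pos i, hi⟩
  refine ⟨c, hc, ?_⟩
  rw [← Algebra.algebraMap_eq_smul_one]
  refine (algebraMap_le_iff_le_spectrum
    (IsSelfAdjoint.of_nonneg (Matrix.nonneg_iff_posSemidef.2 hX.posSemidef))).2 fun x hx => ?_
  rw [hX.1.spectrum_real_eq_range_eigenvalues] at hx
  obtain ⟨i, rfl⟩ := hx
  exact h i

/-- Positive maps of matrices are monotone. -/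
theorem map_le_map_of_nonneg {φ : Mat d →ₗ[ℂ] Mat d} (hφ : ∀ X, 0 ≤ X → 0 ≤ φ X) {X Y : Mat d}
    (h : X ≤ Y) : φ X ≤ φ Y := by
  rw [← sub_nonneg, ← map_sub]
  exact hφ _ (sub_nonneg.2 h)

theorem map_real_smul (φ : Mat d →ₗ[ℂ] Mat d) (c : ℝ) (X : Mat d) : φ (c • X) = c • φ X := by
  rw [← Complex.coe_smul, map_smul, Complex.coe_smul]

variable {Ω A : Type*} {θ : Ω → Ω} {ψ : Ω → A → (Mat d →ₗ[ℂ] Mat d)} {f : Ω → A → ℝ}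
  {F : Ω → ℝ}

/-- The sum of `f` along a record. -/
def recordSum (θ : Ω → Ω) (f : Ω → A → ℝ) (ω : Ω) : (n : ℕ) → (Fin n → A) → ℝ
  | 0, _ => 0
  | n + 1, a => recordSum θ f ω n (Fin.init a) + f (θ^[n] ω) (a (Fin.last n))

theorem stateAfter_nonneg (hpos : ∀ ω a X, 0 ≤ X → 0 ≤ ψ ω a X) (ω : Ω) (n : ℕ) (a : Fin n → A)
    {X : Mat d} (hX : 0 ≤ X) : 0 ≤ stateAfter θ ψ ω X n a := by
  induction n with
  | zero => exact hX
  | succ n ih => exact hpos _ _ _ (ih _)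

theorem abs_recordSum_le (hF : ∀ ω a, |f ω a| ≤ F ω) (ω : Ω) (n : ℕ) (a : Fin n → A) :
    |recordSum θ f ω n a| ≤ birkhoffSum θ F n ω := by
  induction n with
  | zero => simp [recordSum]
  | succ n ih =>
    rw [birkhoffSum_succ]
    exact (abs_add_le _ _).trans (add_le_add (ih _) (hF _ _))

variable [Fintype A]

/-- The sum over all records of `n` outcomes of the unnormalized evolution, weighted with `g`
evaluated at the sum of `f` along the record. -/
def evolve (θ : Ω → Ω) (ψ : Ω → A → (Mat d →ₗ[ℂ] Mat d)) (f : Ω → A → ℝ) (ω : Ω) :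
    ℕ → (ℝ → ℝ) → (Mat d →ₗ[ℂ] Mat d)
  | 0, g => g 0 • LinearMap.id
  | n + 1, g => ∑ b, ψ (θ^[n] ω) b ∘ₗ evolve θ ψ f ω n fun x => g (x + f (θ^[n] ω) b)

theorem evolve_zero_apply (ω : Ω) (g : ℝ → ℝ) (X : Mat d) :
    evolve θ ψ f ω 0 g X = g 0 • X := rfl

theorem evolve_succ_apply (ω : Ω) (n : ℕ) (g : ℝ → ℝ) (X : Mat d) :
    evolve θ ψ f ω (n + 1) g X =
      ∑ b, ψ (θ^[n] ω) b (evolve θ ψ f ω n (fun x => g (x + f (θ^[n] ω) b)) X) := by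
  simp [evolve]

theorem evolve_apply_eq_sum (ω : Ω) (n : ℕ) (g : ℝ → ℝ) (X : Mat d) :
    evolve θ ψ f ω n g X =
      ∑ a, g (recordSum θ f ω n a) • stateAfter θ ψ ω X n a := by
  induction n generalizing g with
  | zero => simp [evolve_zero_apply, recordSum, stateAfter]
  | succ n ih =>
    rw [← (Fin.snocEquiv fun _ => A).sum_comp, Fintype.sum_prod_type, evolve_succ_apply]
    refine Finset.sum_congr rfl fun b _ => ?_
    rw [ih, map_sum]
    refine Finset.sum_congr rfl fun a _ => ?_
    rw [map_real_smul]
    simp [recordSum, stateAfter, Fin.snocEquiv]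

theorem trace_evolve_eq_sum (ω : Ω) (n : ℕ) (g : ℝ → ℝ) (X : Mat d) :
    (evolve θ ψ f ω n g X).trace.re =
      ∑ a, g (recordSum θ f ω n a) * outcomeProb θ ψ ω X n a := by
  rw [evolve_apply_eq_sum, Matrix.trace_sum, Complex.re_sum]
  exact Finset.sum_congr rfl fun a _ => trace_re_smul _ _

theorem evolve_one_eq_compAlong (ω : Ω) (n : ℕ) (X : Mat d) :
    evolve θ ψ f ω n (fun _ => 1) X = compAlong θ (fun ω => ∑ a, ψ ω a) ω n X := by
  induction n with
  | zero => simp [evolve_zero_apply, compAlong]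
  | succ n ih => simp [evolve_succ_apply, compAlong, ih]

theorem evolve_const_mul (ω : Ω) (n : ℕ) (c : ℝ) (g : ℝ → ℝ) (X : Mat d) :
    evolve θ ψ f ω n (fun x => c * g x) X = c • evolve θ ψ f ω n g X := by
  induction n generalizing g with
  | zero => simp [evolve_zero_apply, mul_smul]
  | succ n ih =>
    rw [evolve_succ_apply, evolve_succ_apply, Finset.smul_sum]
    exact Finset.sum_congr rfl fun b _ => by rw [ih, map_real_smul]

theorem evolve_nonneg (hpos : ∀ ω a X, 0 ≤ X → 0 ≤ ψ ω a X)
    (ω : Ω) (n : ℕ) {g : ℝ → ℝ} (hg : ∀ x, 0 ≤ g x) {X : Mat d} (hX : 0 ≤ X) :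
    0 ≤ evolve θ ψ f ω n g X := by
  rw [evolve_apply_eq_sum]
  exact Finset.sum_nonneg fun a _ => smul_nonneg (hg _) (stateAfter_nonneg hpos ω n a hX)

theorem evolve_le_evolve (hpos : ∀ ω a X, 0 ≤ X → 0 ≤ ψ ω a X)
    (hF : ∀ ω a, |f ω a| ≤ F ω) (ω : Ω) (n : ℕ) {g g' : ℝ → ℝ}
    (hg : ∀ x, |x| ≤ birkhoffSum θ F n ω → g x ≤ g' x) {X : Mat d} (hX : 0 ≤ X) :
    evolve θ ψ f ω n g X ≤ evolve θ ψ f ω n g' X := by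
  rw [evolve_apply_eq_sum, evolve_apply_eq_sum]
  refine Finset.sum_le_sum fun a _ => ?_
  exact smul_le_smul_of_nonneg_right (hg _ (abs_recordSum_le hF ω n a))
    (stateAfter_nonneg hpos ω n a hX)

/-- The induction removes the last outcome and translates both g and g₂ by its value of f, which
preserves the hypothesis; it is therefore stated for arbitrary weights rather than for one fixed
penalty. -/
theorem evolve_comp_le (hpos : ∀ ω a X, 0 ≤ X → 0 ≤ ψ ω a X)
    (ω : Ω) (n m : ℕ) {g g₁ g₂ : ℝ → ℝ} (hg : ∀ x y, g₁ x * g₂ y ≤ g (x + y))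
    {X : Mat d} (hX : 0 ≤ X) :
    evolve θ ψ f (θ^[n] ω) m g₂ (evolve θ ψ f ω n g₁ X) ≤ evolve θ ψ f ω (n + m) g X := by
  induction m generalizing g g₂ with
  | zero =>
    rw [evolve_zero_apply, evolve_apply_eq_sum, Finset.smul_sum, add_zero, evolve_apply_eq_sum]
    refine Finset.sum_le_sum fun a _ => ?_
    rw [smul_smul, mul_comm]
    refine smul_le_smul_of_nonneg_right ?_ (stateAfter_nonneg hpos ω n a hX)
    simpa using hg (recordSum θ f ω n a) 0
  | succ m ih =>
    rw [← add_assoc, evolve_succ_apply, evolve_succ_apply]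
    refine Finset.sum_le_sum fun b _ => ?_
    rw [← Function.iterate_add_apply, add_comm m n]
    refine map_le_map_of_nonneg (hpos _ _) (ih fun x y => ?_)
    rw [add_assoc]
    exact hg _ _

theorem evolve_le_comp (hpos : ∀ ω a X, 0 ≤ X → 0 ≤ ψ ω a X)
    (ω : Ω) (n m : ℕ) {g g₁ g₂ : ℝ → ℝ} (hg : ∀ x y, g (x + y) ≤ g₁ x * g₂ y)
    {X : Mat d} (hX : 0 ≤ X) :
    evolve θ ψ f ω (n + m) g X ≤ evolve θ ψ f (θ^[n] ω) m g₂ (evolve θ ψ f ω n g₁ X) := by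
  induction m generalizing g g₂ with
  | zero =>
    rw [evolve_zero_apply, evolve_apply_eq_sum, add_zero, evolve_apply_eq_sum, Finset.smul_sum]
    refine Finset.sum_le_sum fun a _ => ?_
    rw [smul_smul, mul_comm]
    refine smul_le_smul_of_nonneg_right ?_ (stateAfter_nonneg hpos ω n a hX)
    simpa using hg (recordSum θ f ω n a) 0
  | succ m ih =>
    rw [← add_assoc, evolve_succ_apply, evolve_succ_apply]
    refine Finset.sum_le_sum fun b _ => ?_
    rw [← Function.iterate_add_apply, add_comm m n]
    refine map_le_map_of_nonneg (hpos _ _) (ih fun x y => ?_)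
    rw [add_assoc]
    exact hg _ _

end Evolution

/-! ## Growth of the penalized outcome probabilities -/

section Penalty

open scoped MatrixOrder

/-- The penalty `exp (-K |x - n s|)` for a sum of `n` terms. -/
def penalty (K s : ℝ) (n : ℕ) (x : ℝ) : ℝ := Real.exp (-(K * |x - n * s|))

theorem penalty_pos (K s : ℝ) (n : ℕ) (x : ℝ) : 0 < penalty K s n x := Real.exp_pos _

theorem penalty_le_one {K : ℝ} (hK : 0 ≤ K) (s : ℝ) (n : ℕ) (x : ℝ) : penalty K s n x ≤ 1 :=
  Real.exp_le_one_iff.2 (neg_nonpos.2 (mul_nonneg hK (abs_nonneg _)))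

/-- The error e allows the two pieces to have different slopes whose weighted mean only approximates
s, as happens when lengths are rounded to integers. -/
theorem penalty_mul_penalty_le {K : ℝ} (hK : 0 ≤ K) {s s₁ s₂ e : ℝ} {n m : ℕ}
    (he : |((n + m : ℕ) : ℝ) * s - n * s₁ - m * s₂| ≤ e) (x y : ℝ) :
    penalty K s₁ n x * (Real.exp (-(K * e)) * penalty K s₂ m y) ≤ penalty K s (n + m) (x + y) := by
  rw [penalty, penalty, penalty, ← Real.exp_add, ← Real.exp_add, Real.exp_le_exp]
  have h : |x + y - (n + m : ℕ) * s| ≤ |x - n * s₁| + |y - m * s₂| + e := by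
    have h1 : x + y - (n + m : ℕ) * s =
        (x - n * s₁) + (y - m * s₂) - (((n + m : ℕ) : ℝ) * s - n * s₁ - m * s₂) := by ring
    rw [h1]
    exact (abs_sub _ _).trans (add_le_add (abs_add_le _ _) he)
  nlinarith [mul_le_mul_of_nonneg_left h hK]

theorem penalty_add_le {K : ℝ} (hK : 0 ≤ K) (s : ℝ) (n m : ℕ) (x y : ℝ) :
    penalty K s (n + m) (x + y) ≤ Real.exp (K * (|x| + n * |s|)) * penalty K s m y := by
  rw [penalty, penalty, ← Real.exp_add, Real.exp_le_exp]
  have h : |y - m * s| ≤ |x + y - (n + m : ℕ) * s| + (|x| + n * |s|) := by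
    have h1 : y - m * s = (x + y - (n + m : ℕ) * s) - (x - n * s) := by push_cast; ring
    have h2 : |(n : ℝ) * s| = n * |s| := by rw [abs_mul, Nat.abs_cast]
    rw [h1, ← h2]
    exact (abs_sub _ _).trans (add_le_add le_rfl (abs_sub _ _))
  nlinarith [mul_le_mul_of_nonneg_left h hK]

theorem le_penalty {K : ℝ} (hK : 0 ≤ K) (s : ℝ) (n : ℕ) (x : ℝ) :
    Real.exp (-(K * (|x| + n * |s|))) ≤ penalty K s n x := by
  rw [penalty, Real.exp_le_exp, neg_le_neg_iff]
  have h2 : |(n : ℝ) * s| = n * |s| := by rw [abs_mul, Nat.abs_cast]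
  rw [← h2]
  exact mul_le_mul_of_nonneg_left (abs_sub _ _) hK

theorem penalty_add_ge {K : ℝ} (hK : 0 ≤ K) (s : ℝ) (n m : ℕ) (x y : ℝ) :
    Real.exp (-(K * (|y| + m * |s|))) * penalty K s n x ≤ penalty K s (n + m) (x + y) := by
  have h := penalty_mul_penalty_le hK (s := s) (s₁ := s) (s₂ := s) (e := 0) (n := n) (m := m)
    (by push_cast; rw [abs_nonpos_iff]; ring) x y
  rw [mul_zero, neg_zero, Real.exp_zero, one_mul] at h
  refine le_trans ?_ h
  rw [mul_comm]
  exact mul_le_mul_of_nonneg_left (le_penalty hK s m y) (penalty_pos K s n x).le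

/-- A random family of instruments, with an observable `f` of the outcomes that is bounded by
`F`. -/
structure RandomInstrument {Ω A : Type*} [MeasurableSpace Ω] [Fintype A] {d : ℕ} (θ : Ω → Ω)
    (ψ : Ω → A → (Mat d →ₗ[ℂ] Mat d)) (f : Ω → A → ℝ) (F : Ω → ℝ) : Prop where
  map_nonneg : ∀ ω a X, 0 ≤ X → 0 ≤ ψ ω a X
  trace_sum : ∀ ω X, (∑ a, ψ ω a X).trace = X.trace
  abs_le : ∀ ω a, |f ω a| ≤ F ω
  bound_nonneg : ∀ ω, 0 ≤ F ω
  measurable_shift : Measurable θ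
  measurable_apply : ∀ a X i j, Measurable fun ω => ψ ω a X i j
  measurable_observable : ∀ a, Measurable fun ω => f ω a
  measurable_bound : Measurable F

/-- The expectation of the penalty for the outcomes of a sequence of measurements started in the
maximally mixed state. -/
def penalizedProb {Ω A : Type*} [Fintype A] {d : ℕ} (θ : Ω → Ω)
    (ψ : Ω → A → (Mat d →ₗ[ℂ] Mat d)) (f : Ω → A → ℝ) (K s : ℝ) (n : ℕ) (ω : Ω) : ℝ :=
  (evolve θ ψ f ω n (penalty K s n) 1).trace.re / d

variable {Ω A : Type*} [Fintype A] {d : ℕ} {θ : Ω → Ω}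
  {ψ : Ω → A → (Mat d →ₗ[ℂ] Mat d)} {f : Ω → A → ℝ} {F : Ω → ℝ}

theorem map_apply_eq_sum (φ : Mat d →ₗ[ℂ] Mat d) (X : Mat d) (i j : Fin d) :
    φ X i j = ∑ k, ∑ l, X k l * φ (Matrix.single k l 1) i j := by
  conv_lhs => rw [Matrix.matrix_eq_sum_single X]
  simp only [map_sum, Matrix.sum_apply]
  refine Finset.sum_congr rfl fun k _ => Finset.sum_congr rfl fun l _ => ?_
  have : Matrix.single k l (X k l) = X k l • Matrix.single k l (1 : ℂ) := by
    simp [Matrix.smul_single]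
  rw [this, map_smul, Matrix.smul_apply, smul_eq_mul]

theorem re_trace_one : ((1 : Mat d).trace).re = d := by simp

theorem penalizedProb_zero [NeZero d] (K s : ℝ) (ω : Ω) : penalizedProb θ ψ f K s 0 ω = 1 := by
  have hd : (d : ℝ) ≠ 0 := NeZero.ne _
  rw [penalizedProb, evolve_zero_apply, trace_re_smul, re_trace_one]
  simp [penalty, hd]

variable [MeasurableSpace Ω]

namespace RandomInstrument

theorem measurable_stateAfter (h : RandomInstrument θ ψ f F) (X : Mat d) (n : ℕ) (a : Fin n → A)
    (i j : Fin d) : Measurable fun ω => stateAfter θ ψ ω X n a i j := by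
  induction n generalizing i j with
  | zero => exact measurable_const
  | succ n ih =>
    simp only [stateAfter]
    simp_rw [map_apply_eq_sum _ (stateAfter θ ψ _ X n (Fin.init a))]
    refine Finset.measurable_sum _ fun k _ => Finset.measurable_sum _ fun l _ => ?_
    exact (ih _ k l).mul ((h.measurable_apply _ _ i j).comp (h.measurable_shift.iterate n))

theorem measurable_outcomeProb (h : RandomInstrument θ ψ f F) (X : Mat d) (n : ℕ)
    (a : Fin n → A) : Measurable fun ω => outcomeProb θ ψ ω X n a := by
  simp only [outcomeProb, Matrix.trace, Matrix.diag_apply]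
  exact Complex.measurable_re.comp
    (Finset.measurable_sum _ fun i _ => h.measurable_stateAfter X n a i i)

theorem measurable_recordSum (h : RandomInstrument θ ψ f F) (n : ℕ)
    (a : Fin n → A) : Measurable fun ω => recordSum θ f ω n a := by
  induction n with
  | zero => exact measurable_const
  | succ n ih =>
    exact (ih _).add ((h.measurable_observable _).comp (h.measurable_shift.iterate n))

theorem measurable_penalizedProb (h : RandomInstrument θ ψ f F) (K s : ℝ) (n : ℕ) :
    Measurable (penalizedProb θ ψ f K s n) := by
  unfold penalizedProb
  simp only [trace_evolve_eq_sum]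
  refine (Finset.measurable_sum _ fun a _ => ?_).div_const _
  refine Measurable.mul ?_ (h.measurable_outcomeProb 1 n a)
  refine Real.measurable_exp.comp (((((h.measurable_recordSum n a).sub_const _)).abs).const_mul
    K).neg

theorem trace_compAlong (h : RandomInstrument θ ψ f F) (ω : Ω) (n : ℕ) (X : Mat d) :
    (compAlong θ (fun ω => ∑ a, ψ ω a) ω n X).trace = X.trace := by
  induction n with
  | zero => rfl
  | succ n ih =>
    have h1 := h.trace_sum (θ^[n] ω) (compAlong θ (fun ω => ∑ a, ψ ω a) ω n X)
    rw [ih] at h1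
    rw [← h1]
    simp [compAlong]

theorem penalizedProb_le_one [NeZero d] (h : RandomInstrument θ ψ f F) {K : ℝ} (hK : 0 ≤ K) (s : ℝ)
    (n : ℕ) (ω : Ω) : penalizedProb θ ψ f K s n ω ≤ 1 := by
  have hd : (0 : ℝ) < d := by exact_mod_cast Nat.pos_of_ne_zero (NeZero.ne d)
  rw [penalizedProb, div_le_one hd]
  have h1 := trace_re_le_of_le (evolve_le_evolve (θ := θ) h.map_nonneg h.abs_le ω n
    (g := penalty K s n) (g' := fun _ => 1) (fun x _ => penalty_le_one hK s n x)
    (zero_le_one (α := Mat d)))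
  rwa [evolve_one_eq_compAlong, h.trace_compAlong, re_trace_one] at h1

/-- The last outcome moves the sum by at most F, so its effect on the penalty is bounded below
uniformly in the outcome; trace preservation then removes the last step. -/
theorem penalizedProb_right (h : RandomInstrument θ ψ f F) {K : ℝ} (hK : 0 ≤ K) (s : ℝ)
    (n : ℕ) (ω : Ω) :
    Real.exp (-(K * (|s| + F (θ^[n] ω)))) * penalizedProb θ ψ f K s n ω ≤
      penalizedProb θ ψ f K s (n + 1) ω := by
  rw [penalizedProb, penalizedProb, mul_div_assoc']
  refine div_le_div_of_nonneg_right ?_ d.cast_nonneg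
  set c := Real.exp (-(K * (|s| + F (θ^[n] ω))))
  have h1 : ∑ b, ψ (θ^[n] ω) b (c • evolve θ ψ f ω n (penalty K s n) 1) ≤
      evolve θ ψ f ω (n + 1) (penalty K s (n + 1)) 1 := by
    rw [evolve_succ_apply]
    refine Finset.sum_le_sum fun b _ => map_le_map_of_nonneg (h.map_nonneg _ _) ?_
    rw [← evolve_const_mul]
    refine evolve_le_evolve h.map_nonneg h.abs_le ω n (fun x _ => ?_) zero_le_one
    refine le_trans ?_ (penalty_add_ge hK s n 1 x _)
    refine mul_le_mul_of_nonneg_right (Real.exp_le_exp.2 ?_) (penalty_pos K s n x).le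
    rw [neg_le_neg_iff]
    refine mul_le_mul_of_nonneg_left ?_ hK
    have := h.abs_le (θ^[n] ω) b
    simp only [Nat.cast_one, one_mul]
    linarith
  have h2 := trace_re_le_of_le h1
  have h3 := h.trace_sum (θ^[n] ω) (c • evolve θ ψ f ω n (penalty K s n) 1)
  rwa [h3, trace_re_smul] at h2

theorem penalizedProb_pos [NeZero d] (h : RandomInstrument θ ψ f F) {K : ℝ} (hK : 0 ≤ K) (s : ℝ)
    (n : ℕ) (ω : Ω) : 0 < penalizedProb θ ψ f K s n ω := by
  induction n with
  | zero => rw [penalizedProb_zero]; exact one_pos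
  | succ n ih => exact (mul_pos (Real.exp_pos _) ih).trans_le (h.penalizedProb_right hK s n ω)

/-- If the first `n` steps dominate `c tr (·) 1`, they can be split off. -/
theorem penalizedProb_ge_of_le_evolve (h : RandomInstrument θ ψ f F) {K : ℝ} (hK : 0 ≤ K)
    (s : ℝ) (n m : ℕ) (ω : Ω) {c : ℝ} {Y : Mat d} (hY : 0 ≤ Y)
    (hc : c • (1 : Mat d) ≤ evolve θ ψ f ω n (penalty K s n) Y) :
    c * penalizedProb θ ψ f K s m (θ^[n] ω) ≤
      (evolve θ ψ f ω (n + m) (penalty K s (n + m)) Y).trace.re / d := by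
  rw [penalizedProb, mul_div_assoc']
  refine div_le_div_of_nonneg_right ?_ d.cast_nonneg
  rw [← trace_re_smul, ← map_real_smul]
  refine trace_re_le_of_le ((map_le_map_of_nonneg (fun X hX =>
    evolve_nonneg h.map_nonneg _ _ (fun x => (penalty_pos K s m x).le) hX) hc).trans ?_)
  refine evolve_comp_le h.map_nonneg ω n m (fun x y => ?_) hY
  have := penalty_mul_penalty_le hK (s := s) (s₁ := s) (s₂ := s) (e := 0) (n := n) (m := m)
    (by push_cast; rw [abs_nonpos_iff]; ring) x y
  simpa using this

theorem exp_smul_compAlong_le (h : RandomInstrument θ ψ f F) {K : ℝ} (hK : 0 ≤ K)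
    (s : ℝ) (n : ℕ) (ω : Ω) {Y : Mat d} (hY : 0 ≤ Y) :
    Real.exp (-(K * (birkhoffSum θ F n ω + n * |s|))) • compAlong θ (fun ω => ∑ a, ψ ω a) ω n Y ≤
      evolve θ ψ f ω n (penalty K s n) Y := by
  rw [← evolve_one_eq_compAlong (f := f), ← evolve_const_mul]
  refine evolve_le_evolve h.map_nonneg h.abs_le ω n (fun x hx => ?_) hY
  refine le_trans ?_ (le_penalty hK s n x)
  rw [mul_one, Real.exp_le_exp, neg_le_neg_iff]
  exact mul_le_mul_of_nonneg_left (by linarith) hK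

/-- Trace preservation cannot remove a first step. Instead its output on the identity dominates v
times the identity, which restarts the process. -/
theorem penalizedProb_left (h : RandomInstrument θ ψ f F) {K : ℝ} (hK : 0 ≤ K) (s : ℝ)
    (n : ℕ) (ω : Ω) {v : ℝ} (hv : v • (1 : Mat d) ≤ ∑ a, ψ ω a 1) :
    Real.exp (-(K * (|s| + F ω))) * v * penalizedProb θ ψ f K s n (θ ω) ≤
      penalizedProb θ ψ f K s (n + 1) ω := by
  have h1 := h.exp_smul_compAlong_le hK s 1 ω (zero_le_one (α := Mat d))
  have h2 : Real.exp (-(K * (|s| + F ω))) • v • (1 : Mat d) ≤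
      Real.exp (-(K * (|s| + F ω))) • compAlong θ (fun ω => ∑ a, ψ ω a) ω 1 1 := by
    refine smul_le_smul_of_nonneg_left ?_ (Real.exp_pos _).le
    simpa [compAlong] using hv
  have h3 := h.penalizedProb_ge_of_le_evolve hK s 1 n ω zero_le_one
    (c := Real.exp (-(K * (|s| + F ω))) * v) (by
      rw [mul_smul]
      refine h2.trans (le_trans (le_of_eq ?_) h1)
      simp [add_comm])
  rw [add_comm 1 n] at h3
  exact h3

/-- The output of the first step on the identity is positive of trace d, hence at most d times the
identity. -/
theorem penalizedProb_left_le (h : RandomInstrument θ ψ f F) {K : ℝ} (hK : 0 ≤ K) (s : ℝ)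
    (n : ℕ) (ω : Ω) :
    penalizedProb θ ψ f K s (n + 1) ω ≤
      Real.exp (K * (|s| + F ω)) * d * penalizedProb θ ψ f K s n (θ ω) := by
  rw [penalizedProb, penalizedProb, mul_div_assoc']
  refine div_le_div_of_nonneg_right ?_ d.cast_nonneg
  rw [← trace_re_smul, ← map_real_smul, add_comm n 1]
  refine trace_re_le_of_le ((evolve_le_comp h.map_nonneg ω 1 n (penalty_add_le hK s 1 n)
    zero_le_one).trans ?_)
  refine map_le_map_of_nonneg (fun X hX =>
    evolve_nonneg h.map_nonneg _ _ (fun x => (penalty_pos K s n x).le) hX) ?_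
  have h1 : evolve θ ψ f ω 1 (fun x => Real.exp (K * (|x| + (1 : ℕ) * |s|))) (1 : Mat d) ≤
      evolve θ ψ f ω 1 (fun _ => Real.exp (K * (|s| + F ω)) * 1) 1 := by
    refine evolve_le_evolve h.map_nonneg h.abs_le ω 1 (fun x hx => ?_) zero_le_one
    rw [mul_one, Real.exp_le_exp]
    rw [birkhoffSum_one] at hx
    refine mul_le_mul_of_nonneg_left ?_ hK
    push_cast
    linarith
  refine h1.trans ?_
  rw [evolve_const_mul, evolve_one_eq_compAlong, mul_smul]
  refine smul_le_smul_of_nonneg_left ?_ (Real.exp_pos _).le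
  have h2 : (0 : Mat d) ≤ compAlong θ (fun ω => ∑ a, ψ ω a) ω 1 1 := by
    rw [← evolve_one_eq_compAlong (f := f)]
    exact evolve_nonneg h.map_nonneg _ _ (fun _ => zero_le_one) zero_le_one
  have h3 := le_trace_smul_one h2
  rwa [h.trace_compAlong, re_trace_one] at h3

/-- Concatenation of two records through `N` strictly positive steps. -/
theorem penalizedProb_superadd [NeZero d] (h : RandomInstrument θ ψ f F) {K : ℝ} (hK : 0 ≤ K)
    {s s₁ s₂ e δ : ℝ} (n N m : ℕ) (ω : Ω)
    (he : |((n + (N + m) : ℕ) : ℝ) * s - n * s₁ - (N + m : ℕ) * s₂| ≤ e)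
    (hδ : ∀ X : Mat d, 0 ≤ X →
      (δ * X.trace.re) • (1 : Mat d) ≤ compAlong θ (fun ω => ∑ a, ψ ω a) (θ^[n] ω) N X) :
    Real.exp (-(K * e)) * (Real.exp (-(K * (birkhoffSum θ F N (θ^[n] ω) + N * |s₂|))) * (δ * d)) *
      (penalizedProb θ ψ f K s₁ n ω * penalizedProb θ ψ f K s₂ m (θ^[N] (θ^[n] ω))) ≤
      penalizedProb θ ψ f K s (n + (N + m)) ω := by
  have hd : (d : ℝ) ≠ 0 := NeZero.ne _
  set Y := evolve θ ψ f ω n (penalty K s₁ n) 1 with hY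
  have hY0 : 0 ≤ Y := evolve_nonneg h.map_nonneg _ _ (fun x => (penalty_pos K s₁ n x).le)
    zero_le_one
  have h1 := evolve_comp_le (θ := θ) (f := f) h.map_nonneg ω n (N + m)
    (penalty_mul_penalty_le hK he)
    (zero_le_one (α := Mat d))
  rw [evolve_const_mul, ← hY] at h1
  have h2 := trace_re_le_of_le h1
  rw [trace_re_smul] at h2
  -- The N connecting steps forget Y except for its trace, so the pasts and futures factorize. These
  -- steps are charged to the second slope s₂.
  have h3 := h.exp_smul_compAlong_le hK s₂ N (θ^[n] ω) hY0
  have h4 := (smul_le_smul_of_nonneg_left (hδ Y hY0)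
    (Real.exp_pos (-(K * (birkhoffSum θ F N (θ^[n] ω) + N * |s₂|)))).le).trans h3
  rw [← mul_smul] at h4
  have h5 := h.penalizedProb_ge_of_le_evolve hK s₂ N m (θ^[n] ω) hY0 h4
  have h6 : Y.trace.re = d * penalizedProb θ ψ f K s₁ n ω := by
    rw [penalizedProb, mul_div_cancel₀ _ hd]
  rw [h6] at h5
  have h7 := mul_le_mul_of_nonneg_left h5 (Real.exp_pos (-(K * e))).le
  rw [mul_div_assoc'] at h7
  refine le_trans (le_of_eq ?_) (h7.trans (div_le_div_of_nonneg_right h2 d.cast_nonneg))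
  ring

end RandomInstrument

end Penalty

/-! ## Existence and properties of the growth rates -/

section GrowthRates

open scoped MatrixOrder

variable {Ω A : Type*} [MeasurableSpace Ω] [Fintype A] {d : ℕ}

/-- A random instrument whose bounds are integrable and that is strictly positive after `N` steps
for an environment in a set `G` of positive probability. -/
structure MixingInstrument (P : Measure Ω) (θ : Ω → Ω) (ψ : Ω → A → (Mat d →ₗ[ℂ] Mat d))
    (f : Ω → A → ℝ) (F v : Ω → ℝ) (N : ℕ) (δ : ℝ) (G : Set Ω) : Prop
    extends RandomInstrument θ ψ f F where
  ergodic : Ergodic θ P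
  integrable_bound : Integrable F P
  lower_pos : ∀ ω, 0 < v ω
  lower_le : ∀ ω, v ω • (1 : Mat d) ≤ ∑ a, ψ ω a 1
  integrable_log_lower : Integrable (fun ω => Real.log (v ω)) P
  delta_pos : 0 < δ
  measurableSet : MeasurableSet G
  measure_ne_zero : P G ≠ 0
  le_compAlong : ∀ ω ∈ G, ∀ X : Mat d, 0 ≤ X →
    (δ * X.trace.re) • (1 : Mat d) ≤ compAlong θ (fun ω => ∑ a, ψ ω a) ω N X

/-- The logarithm of the penalized probability. -/
def logProb (θ : Ω → Ω) (ψ : Ω → A → (Mat d →ₗ[ℂ] Mat d)) (f : Ω → A → ℝ) (K s : ℝ) (n : ℕ)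
    (ω : Ω) : ℝ := Real.log (penalizedProb θ ψ f K s n ω)

theorem tendsto_measure_abs_sub_ge {P : Measure Ω} [IsProbabilityMeasure P] {X : ℕ → Ω → ℝ} {c : ℝ}
    (hX : ∀ n, Measurable (X n)) (h : ∀ᵐ ω ∂P, Tendsto (fun n => X n ω) atTop (nhds c)) {ε : ℝ}
    (hε : 0 < ε) : Tendsto (fun n => P {ω | ε ≤ |X n ω - c|}) atTop (nhds 0) := by
  have := tendstoInMeasure_of_tendsto_ae (μ := P) (f := X) (g := fun _ => c)
    (fun n => (hX n).aestronglyMeasurable) h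
  simpa [Real.norm_eq_abs] using tendstoInMeasure_iff_norm.1 this ε hε

/-- Events of probability bounded below are not covered by three events whose probabilities
vanish. -/
theorem eventually_exists_mem_of_tendsto_zero {P : Measure Ω} {A B₁ B₂ B₃ : ℕ → Set Ω} {p : ℝ≥0∞}
    (hp : p ≠ 0) (hA : ∀ n, p ≤ P (A n)) (h₁ : Tendsto (fun n => P (B₁ n)) atTop (nhds 0))
    (h₂ : Tendsto (fun n => P (B₂ n)) atTop (nhds 0))
    (h₃ : Tendsto (fun n => P (B₃ n)) atTop (nhds 0)) :
    ∀ᶠ n in atTop, ∃ ω ∈ A n, ω ∉ B₁ n ∧ ω ∉ B₂ n ∧ ω ∉ B₃ n := by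
  have hsum := (h₁.add h₂).add h₃
  simp only [add_zero] at hsum
  filter_upwards [hsum.eventually_lt_const (pos_iff_ne_zero.2 hp)] with n hn
  by_contra! hcon
  have hsub : A n ⊆ B₁ n ∪ B₂ n ∪ B₃ n := fun ω hω => by
    by_cases h1 : ω ∈ B₁ n
    · exact Or.inl (Or.inl h1)
    by_cases h2 : ω ∈ B₂ n
    · exact Or.inl (Or.inr h2)
    exact Or.inr (hcon ω hω h1 h2)
  exact absurd hn (not_lt.2 ((hA n).trans ((measure_mono hsub).trans
    ((measure_union_le _ _).trans (add_le_add (measure_union_le _ _) le_rfl)))))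

namespace RandomInstrument

variable {θ : Ω → Ω} {ψ : Ω → A → (Mat d →ₗ[ℂ] Mat d)} {f : Ω → A → ℝ} {F : Ω → ℝ}

theorem logProb_left_le [NeZero d] (h : RandomInstrument θ ψ f F) {K : ℝ} (hK : 0 ≤ K) (s : ℝ)
    (n : ℕ) (ω : Ω) : logProb θ ψ f K s (n + 1) ω ≤
      logProb θ ψ f K s n (θ ω) + (K * (|s| + F ω) + Real.log d) := by
  have hd : (d : ℝ) ≠ 0 := NeZero.ne _
  have h1 := Real.log_le_log (h.penalizedProb_pos hK s (n + 1) ω)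
    (h.penalizedProb_left_le hK s n ω)
  rw [Real.log_mul (mul_ne_zero (Real.exp_pos _).ne' hd) (h.penalizedProb_pos hK s n _).ne',
    Real.log_mul (Real.exp_pos _).ne' hd, Real.log_exp] at h1
  unfold logProb
  linarith

theorem logProb_left_iterate_le [NeZero d] (h : RandomInstrument θ ψ f F) {K : ℝ} (hK : 0 ≤ K)
    (s : ℝ) (N m : ℕ) (ω : Ω) : logProb θ ψ f K s (N + m) ω ≤
      logProb θ ψ f K s m (θ^[N] ω) + (K * (birkhoffSum θ F N ω + N * |s|) + N * Real.log d) := by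
  induction N generalizing ω with
  | zero => simp
  | succ N ih =>
    have h1 := h.logProb_left_le hK s (N + m) ω
    have h2 := ih (θ ω)
    rw [birkhoffSum_succ', Function.iterate_succ_apply, show N + 1 + m = N + m + 1 by ring]
    push_cast
    nlinarith

theorem logProb_right [NeZero d] (h : RandomInstrument θ ψ f F) {K : ℝ} (hK : 0 ≤ K) (s : ℝ)
    (n : ℕ) (ω : Ω) : logProb θ ψ f K s n ω - K * (|s| + F (θ^[n] ω)) ≤
      logProb θ ψ f K s (n + 1) ω := by
  have hpos := h.penalizedProb_pos hK s n ω
  have h1 := Real.log_le_log (mul_pos (Real.exp_pos _) hpos) (h.penalizedProb_right hK s n ω)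
  rw [Real.log_mul (Real.exp_pos _).ne' hpos.ne', Real.log_exp] at h1
  unfold logProb
  linarith

theorem logProb_right_iterate [NeZero d] (h : RandomInstrument θ ψ f F) {K : ℝ} (hK : 0 ≤ K)
    (s : ℝ) (n m : ℕ) (ω : Ω) :
    logProb θ ψ f K s n ω - K * (birkhoffSum θ F m (θ^[n] ω) + m * |s|) ≤
      logProb θ ψ f K s (n + m) ω := by
  induction m with
  | zero => simp
  | succ m ih =>
    have h1 := h.logProb_right hK s (n + m) ω
    rw [birkhoffSum_succ, ← Function.iterate_add_apply, ← add_assoc, add_comm m n]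
    push_cast
    linarith

theorem logProb_le_add_abs_sub [NeZero d] (h : RandomInstrument θ ψ f F) {K : ℝ} (hK : 0 ≤ K)
    (s s' : ℝ) (n : ℕ) (ω : Ω) :
    logProb θ ψ f K s n ω ≤ logProb θ ψ f K s' n ω + n * (K * |s - s'|) := by
  have hpos := h.penalizedProb_pos hK s' n ω
  have h1 : penalizedProb θ ψ f K s n ω ≤
      Real.exp (n * (K * |s - s'|)) * penalizedProb θ ψ f K s' n ω := by
    rw [penalizedProb, penalizedProb, mul_div_assoc']
    refine div_le_div_of_nonneg_right ?_ d.cast_nonneg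
    rw [← trace_re_smul, ← evolve_const_mul]
    refine trace_re_le_of_le (evolve_le_evolve h.map_nonneg h.abs_le ω n (fun x _ => ?_)
      zero_le_one)
    rw [penalty, penalty, ← Real.exp_add, Real.exp_le_exp]
    have h2 : |x - n * s'| ≤ |x - n * s| + n * |s - s'| := by
      have h3 : x - n * s' = (x - n * s) + n * (s - s') := by ring
      have h4 : |(n : ℝ) * (s - s')| = n * |s - s'| := by rw [abs_mul, Nat.abs_cast]
      rw [h3, ← h4]
      exact abs_add_le _ _
    nlinarith [mul_le_mul_of_nonneg_left h2 hK]
  have h2 := Real.log_le_log (h.penalizedProb_pos hK s n ω) h1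
  rw [Real.log_mul (Real.exp_pos _).ne' hpos.ne', Real.log_exp] at h2
  unfold logProb
  linarith

theorem measurable_logProb (h : RandomInstrument θ ψ f F) (K s : ℝ) (n : ℕ) :
    Measurable (logProb θ ψ f K s n) :=
  Real.measurable_log.comp (h.measurable_penalizedProb K s n)

end RandomInstrument

namespace MixingInstrument

variable {P : Measure Ω} {θ : Ω → Ω} {ψ : Ω → A → (Mat d →ₗ[ℂ] Mat d)}
  {f : Ω → A → ℝ} {F v : Ω → ℝ} {N : ℕ} {δ : ℝ} {G : Set Ω}

/-- The strictly positive steps consume the first N steps of the second piece.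
`logProb_left_iterate_le` gives them back, which is why their cost K(M + N|s₂|) appears twice in the
constant. -/
theorem logProb_superadd [NeZero d] (h : MixingInstrument P θ ψ f F v N δ G) {K : ℝ} (hK : 0 ≤ K)
    {s s₁ s₂ e M : ℝ} {n m : ℕ} (hm : N ≤ m) {ω : Ω} (hω : θ^[n] ω ∈ G)
    (hM : birkhoffSum θ F N (θ^[n] ω) ≤ M)
    (he : |((n + m : ℕ) : ℝ) * s - n * s₁ - m * s₂| ≤ e) :
    logProb θ ψ f K s₁ n ω + logProb θ ψ f K s₂ m (θ^[n] ω) -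
      (2 * (K * (M + N * |s₂|)) + N * Real.log d + |Real.log (δ * d)| + K * e) ≤
      logProb θ ψ f K s (n + m) ω := by
  obtain ⟨m, rfl⟩ := Nat.exists_eq_add_of_le hm
  have hd : (0 : ℝ) < d := by exact_mod_cast Nat.pos_of_ne_zero (NeZero.ne d)
  have hr := h.toRandomInstrument
  have h1 := hr.penalizedProb_superadd hK n N m ω he (h.le_compAlong _ hω)
  have p1 := hr.penalizedProb_pos hK s₁ n ω
  have p2 := hr.penalizedProb_pos hK s₂ m (θ^[N] (θ^[n] ω))
  have p3 : 0 < δ * d := mul_pos h.delta_pos hd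
  have h2 := Real.log_le_log (by positivity) h1
  rw [Real.log_mul (by positivity) (by positivity), Real.log_mul p1.ne' p2.ne',
    Real.log_mul (by positivity) (by positivity), Real.log_mul (by positivity) p3.ne',
    Real.log_exp, Real.log_exp] at h2
  have h3 := hr.logProb_left_iterate_le hK s₂ N m (θ^[n] ω)
  have h4 := mul_le_mul_of_nonneg_left hM hK
  have h5 := neg_abs_le (Real.log (δ * d))
  unfold logProb at h3 ⊢
  linarith

/-- The set of environments in `G` for which the observable is controlled during `N` steps. -/
def goodSet (θ : Ω → Ω) (F : Ω → ℝ) (N : ℕ) (G : Set Ω) (M : ℝ) : Set Ω :=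
  G ∩ {ω | birkhoffSum θ F N ω ≤ M}

theorem measurable_birkhoffSum (h : MixingInstrument P θ ψ f F v N δ G) (n : ℕ) :
    Measurable (birkhoffSum θ F n) :=
  Finset.measurable_sum _ fun i _ => h.measurable_bound.comp (h.measurable_shift.iterate i)

theorem measurableSet_goodSet (h : MixingInstrument P θ ψ f F v N δ G) (M : ℝ) :
    MeasurableSet (goodSet θ F N G M) :=
  h.measurableSet.inter (measurableSet_le (h.measurable_birkhoffSum N) measurable_const)

theorem exists_measure_goodSet_ne_zero (h : MixingInstrument P θ ψ f F v N δ G) :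
    ∃ M : ℝ, 0 ≤ M ∧ P (goodSet θ F N G M) ≠ 0 := by
  by_contra! hcon
  refine h.measure_ne_zero ?_
  have hG : G ⊆ ⋃ k : ℕ, goodSet θ F N G k := fun ω hω => by
    obtain ⟨k, hk⟩ := exists_nat_ge (birkhoffSum θ F N ω)
    exact mem_iUnion.2 ⟨k, hω, hk⟩
  exact measure_mono_null hG (measure_iUnion_null fun k => hcon k k.cast_nonneg)

theorem gappedSuperadditive [NeZero d] [IsProbabilityMeasure P]
    (h : MixingInstrument P θ ψ f F v N δ G) {K : ℝ} (hK : 0 ≤ K) (s : ℝ) {M : ℝ} (hM : 0 ≤ M)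
    (hPM : P (goodSet θ F N G M) ≠ 0) :
    GappedSuperadditive P θ (logProb θ ψ f K s)
      (fun ω => K * (|s| + F ω) + |Real.log (v ω)|) (goodSet θ F N G M)
      (2 * (K * (M + N * |s|)) + N * Real.log d + |Real.log (δ * d)|) where
  measurable n := h.measurable_logProb K s n
  zero ω := by rw [logProb, penalizedProb_zero, Real.log_one]
  nonpos n ω := Real.log_nonpos (h.penalizedProb_pos hK s n ω).le (h.penalizedProb_le_one hK s n ω)
  bound_nonneg ω := by
    have := h.bound_nonneg ω
    positivity
  bound_integrable :=
    (((integrable_const _).add h.integrable_bound).const_mul K).add h.integrable_log_lower.abs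
  right n ω := by
    have := h.logProb_right hK s n ω
    linarith [abs_nonneg (Real.log (v (θ^[n] ω)))]
  left n ω := by
    have p1 := h.penalizedProb_pos hK s n (θ ω)
    have p2 := h.lower_pos ω
    have h1 := Real.log_le_log (by positivity) (h.penalizedProb_left hK s n ω (h.lower_le ω))
    rw [Real.log_mul (by positivity) p1.ne', Real.log_mul (by positivity) p2.ne',
      Real.log_exp] at h1
    unfold logProb
    linarith [neg_abs_le (Real.log (v ω))]
  measurableSet := h.measurableSet_goodSet M
  measure_ne_zero := hPM
  superadd n m ω hω := by
    rcases le_or_gt N m with hm | hm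
    · have := h.logProb_superadd hK (s := s) (s₁ := s) (s₂ := s) (e := 0) hm hω.1 hω.2
        (by push_cast; rw [abs_nonpos_iff]; ring)
      linarith
    -- A second piece shorter than N cannot contain the connecting steps; it is discarded at bounded
    -- cost, since `logProb` is nonpositive.
    · have h1 := h.logProb_right_iterate hK s n m ω
      have h2 : logProb θ ψ f K s m (θ^[n] ω) ≤ 0 :=
        Real.log_nonpos (h.penalizedProb_pos hK s m _).le (h.penalizedProb_le_one hK s m _)
      have h3 : birkhoffSum θ F m (θ^[n] ω) ≤ M :=
        (birkhoffSum_mono_of_nonneg h.bound_nonneg _ hm.le).trans hω.2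
      have h4 : (m : ℝ) * |s| ≤ N * |s| :=
        mul_le_mul_of_nonneg_right (by exact_mod_cast hm.le) (abs_nonneg s)
      have h5 := mul_le_mul_of_nonneg_left (add_le_add h3 h4) hK
      have h6 : 0 ≤ K * (M + N * |s|) := by positivity
      have h7 : 0 ≤ N * Real.log d := mul_nonneg N.cast_nonneg (Real.log_natCast_nonneg d)
      linarith [abs_nonneg (Real.log (δ * d))]

theorem exists_growthRate [NeZero d] [IsProbabilityMeasure P]
    (h : MixingInstrument P θ ψ f F v N δ G) :
    ∃ Λ : ℕ → ℝ → ℝ, (∀ K s, Λ K s ≤ 0) ∧ ∀ (K : ℕ) (s : ℝ), ∀ᵐ ω ∂P,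
      Tendsto (fun n : ℕ => logProb θ ψ f K s n ω / n) atTop (nhds (Λ K s)) := by
  obtain ⟨M, hM, hPM⟩ := h.exists_measure_goodSet_ne_zero
  choose Λ h0 hΛ using fun (K : ℕ) (s : ℝ) =>
    (h.gappedSuperadditive K.cast_nonneg s hM hPM).exists_ae_tendsto h.ergodic
  exact ⟨Λ, h0, hΛ⟩

variable {Λ : ℕ → ℝ → ℝ}

theorem growthRate_le_add_abs_sub [NeZero d] [IsProbabilityMeasure P]
    (h : MixingInstrument P θ ψ f F v N δ G)
    (hΛ : ∀ (K : ℕ) (s : ℝ), ∀ᵐ ω ∂P,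
      Tendsto (fun n : ℕ => logProb θ ψ f K s n ω / n) atTop (nhds (Λ K s)))
    (K : ℕ) (s s' : ℝ) : Λ K s ≤ Λ K s' + K * |s - s'| := by
  obtain ⟨ω, h1, h2⟩ := ((hΛ K s).and (hΛ K s')).exists
  refine le_of_tendsto_of_tendsto h1 (h2.add_const _) ?_
  filter_upwards [eventually_gt_atTop 0] with n hn
  have hn' : (0 : ℝ) < n := by exact_mod_cast hn
  have := h.logProb_le_add_abs_sub K.cast_nonneg s s' n ω
  rw [div_le_iff₀ hn', add_mul, div_mul_cancel₀ _ hn'.ne']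
  linarith

theorem continuous_growthRate [NeZero d] [IsProbabilityMeasure P]
    (h : MixingInstrument P θ ψ f F v N δ G)
    (hΛ : ∀ (K : ℕ) (s : ℝ), ∀ᵐ ω ∂P,
      Tendsto (fun n : ℕ => logProb θ ψ f K s n ω / n) atTop (nhds (Λ K s)))
    (K : ℕ) : Continuous (Λ K) := by
  refine (LipschitzWith.of_le_add_mul (K : ℝ≥0) fun s s' => ?_).continuous
  simpa [Real.dist_eq] using h.growthRate_le_add_abs_sub hΛ K s s'

/-- For fixed K both sides are K-Lipschitz in s, so countably many exceptional sets, for rational s,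
suffice. -/
theorem ae_forall_tendsto [NeZero d] [IsProbabilityMeasure P]
    (h : MixingInstrument P θ ψ f F v N δ G)
    (hΛ : ∀ (K : ℕ) (s : ℝ), ∀ᵐ ω ∂P,
      Tendsto (fun n : ℕ => logProb θ ψ f K s n ω / n) atTop (nhds (Λ K s))) :
    ∀ᵐ ω ∂P, ∀ (K : ℕ) (s : ℝ),
      Tendsto (fun n : ℕ => logProb θ ψ f K s n ω / n) atTop (nhds (Λ K s)) := by
  have hQ : ∀ᵐ ω ∂P, ∀ (K : ℕ) (q : ℚ),
      Tendsto (fun n : ℕ => logProb θ ψ f K q n ω / n) atTop (nhds (Λ K q)) :=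
    ae_all_iff.2 fun K => ae_all_iff.2 fun q => hΛ K q
  filter_upwards [hQ] with ω hω K s
  rw [Metric.tendsto_nhds]
  intro ε hε
  have hK : (0 : ℝ) < 3 * (K + 1) := by positivity
  obtain ⟨q, hq1, hq2⟩ := exists_rat_btwn (show s < s + ε / (3 * (K + 1)) by
    linarith [div_pos hε hK])
  have hKs : K * |s - q| ≤ ε / 3 := by
    have h1 : |s - q| ≤ ε / (3 * (K + 1)) := by rw [abs_le]; constructor <;> linarith
    refine (mul_le_mul_of_nonneg_left h1 K.cast_nonneg).trans ?_
    rw [mul_div_assoc', div_le_div_iff₀ hK three_pos]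
    nlinarith
  have hKs' : K * |q - s| ≤ ε / 3 := by rwa [abs_sub_comm]
  filter_upwards [Metric.tendsto_nhds.1 (hω K q) (ε / 3) (by positivity),
    eventually_gt_atTop 0] with n hn hn0
  have hn' : (0 : ℝ) < n := by exact_mod_cast hn0
  have h1 := h.logProb_le_add_abs_sub K.cast_nonneg s q n ω
  have h2 := h.logProb_le_add_abs_sub K.cast_nonneg q s n ω
  have h3 := h.growthRate_le_add_abs_sub hΛ K s q
  have h4 := h.growthRate_le_add_abs_sub hΛ K q s
  rw [Real.dist_eq, abs_lt] at hn ⊢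
  have h5 : logProb θ ψ f K s n ω / n ≤ logProb θ ψ f K q n ω / n + K * |s - q| := by
    rw [div_le_iff₀ hn', add_mul, div_mul_cancel₀ _ hn'.ne']
    linarith
  have h6 : logProb θ ψ f K q n ω / n ≤ logProb θ ψ f K s n ω / n + K * |q - s| := by
    rw [div_le_iff₀ hn', add_mul, div_mul_cancel₀ _ hn'.ne']
    linarith
  constructor <;> linarith

/-- A record of length about aT near slope s₁ followed by one of length about bT near slope s₂ is a
record of length T near the mean slope. The second piece starts at a point moving with T, so almost
sure convergence is replaced by convergence in probability, which survives the measure preserving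
shift. -/
theorem growthRate_concave [NeZero d] [IsProbabilityMeasure P]
    (h : MixingInstrument P θ ψ f F v N δ G)
    (hΛ : ∀ (K : ℕ) (s : ℝ), ∀ᵐ ω ∂P,
      Tendsto (fun n : ℕ => logProb θ ψ f K s n ω / n) atTop (nhds (Λ K s)))
    (K : ℕ) {a b s₁ s₂ : ℝ} (ha : 0 < a) (hb : 0 < b) (hab : a + b = 1) :
    a * Λ K s₁ + b * Λ K s₂ ≤ Λ K (a * s₁ + b * s₂) := by
  obtain ⟨M, hM, hPM⟩ := h.exists_measure_goodSet_ne_zero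
  by_contra! hcon
  set s := a * s₁ + b * s₂ with hs
  -- A quarter of the supposed gap for each of the three deviations and for C/T.
  set η := (a * Λ K s₁ + b * Λ K s₂ - Λ K s) / 4 with hη
  have hη0 : 0 < η := by rw [hη]; linarith
  let n : ℕ → ℕ := fun T => ⌊a * (T : ℝ)⌋₊
  have hnT : ∀ T, n T ≤ T := fun T => by
    refine Nat.floor_le_of_le ?_
    have : (0 : ℝ) ≤ T := T.cast_nonneg
    nlinarith
  have hna : Tendsto (fun T : ℕ => (n T : ℝ) / T) atTop (nhds a) :=
    (tendsto_nat_floor_mul_div_atTop ha.le).comp tendsto_natCast_atTop_atTop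
  have hmb : Tendsto (fun T : ℕ => ((T - n T : ℕ) : ℝ) / T) atTop (nhds b) := by
    have h1 := (tendsto_const_nhds (x := (1 : ℝ))).sub hna
    rw [show 1 - a = b by linarith] at h1
    refine h1.congr' ?_
    filter_upwards [eventually_gt_atTop 0] with T hT
    have hT' : (T : ℝ) ≠ 0 := by exact_mod_cast hT.ne'
    rw [Nat.cast_sub (hnT T), sub_div, div_self hT']
  have htop : ∀ {k : ℕ → ℕ} {c : ℝ}, 0 < c →
      Tendsto (fun T : ℕ => (k T : ℝ) / T) atTop (nhds c) → Tendsto k atTop atTop := by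
    intro k c hc hk
    rw [← tendsto_natCast_atTop_iff (R := ℝ)]
    refine (hk.pos_mul_atTop hc tendsto_natCast_atTop_atTop).congr' ?_
    filter_upwards [eventually_gt_atTop 0] with T hT
    have hT' : (T : ℝ) ≠ 0 := by exact_mod_cast hT.ne'
    field_simp
  have hlim : ∀ {k : ℕ → ℕ} {c s : ℝ}, 0 < c →
      Tendsto (fun T : ℕ => (k T : ℝ) / T) atTop (nhds c) →
      Tendsto (fun T => P {ω | η ≤ |logProb θ ψ f K s (k T) ω / T - c * Λ K s|}) atTop
        (nhds 0) := by
    intro k c s hc hk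
    refine tendsto_measure_abs_sub_ge (fun T => (h.measurable_logProb K s _).div_const _) ?_ hη0
    filter_upwards [hΛ K s] with ω hω
    refine (hk.mul (hω.comp (htop hc hk))).congr' ?_
    filter_upwards [(htop hc hk).eventually_gt_atTop 0] with T hT
    have hT' : ((k T : ℕ) : ℝ) ≠ 0 := by exact_mod_cast hT.ne'
    simp only [Function.comp_apply]
    field_simp
  have hone : Tendsto (fun T : ℕ => ((id T : ℕ) : ℝ) / T) atTop (nhds 1) := by
    refine tendsto_const_nhds.congr' ?_
    filter_upwards [eventually_gt_atTop 0] with T hT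
    have hT' : (T : ℝ) ≠ 0 := by exact_mod_cast hT.ne'
    simp [hT']
  have hmp : ∀ k, MeasurePreserving (θ^[k]) P P := fun k => h.ergodic.toMeasurePreserving.iterate k
  have hlim₂ : Tendsto (fun T => P ((θ^[n T]) ⁻¹'
      {ω | η ≤ |logProb θ ψ f K s₂ (T - n T) ω / T - b * Λ K s₂|})) atTop (nhds 0) := by
    refine (hlim (s := s₂) hb hmb).congr fun T => ?_
    refine ((hmp _).measure_preimage (MeasurableSet.nullMeasurableSet ?_)).symm
    exact measurableSet_le measurable_const
      (((h.measurable_logProb K s₂ _).div_const _).sub_const _).abs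
  -- The cutting point is good with a fixed positive probability while the three exceptional
  -- probabilities vanish, so some ω meets all requirements for large T.
  have hev := eventually_exists_mem_of_tendsto_zero (A := fun T => (θ^[n T]) ⁻¹' goodSet θ F N G M)
    hPM (fun T => ((hmp _).measure_preimage (h.measurableSet_goodSet M).nullMeasurableSet).ge)
    (hlim (s := s₁) ha hna) hlim₂ (hlim (s := s) one_pos hone)
  set C := 2 * (K * (M + N * |s₂|)) + N * Real.log d + |Real.log (δ * d)| + K * |s₁ - s₂|
  have hC : ∀ᶠ T : ℕ in atTop, C / T < η :=
    (tendsto_const_div_atTop_nhds_zero_nat C).eventually_lt_const hη0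
  obtain ⟨T, ⟨ω, hωG, hω1, hω2, hω3⟩, hCT, hmN, hT⟩ := (hev.and (hC.and
    (((htop hb hmb).eventually_ge_atTop N).and (eventually_gt_atTop 0)))).exists
  have hT' : (0 : ℝ) < T := by exact_mod_cast hT
  simp only [mem_preimage, mem_ofPred_eq, not_le, id_eq, one_mul, abs_lt] at hω1 hω2 hω3
  have hcast : ((T - n T : ℕ) : ℝ) = T - n T := Nat.cast_sub (hnT T)
  have h1 := h.logProb_superadd K.cast_nonneg (s := s) (s₁ := s₁) (s₂ := s₂) (e := |s₁ - s₂|)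
    hmN hωG.1 hωG.2 (by
      rw [Nat.add_sub_cancel' (hnT T), hcast]
      have h2 : (T : ℝ) * s - n T * s₁ - (T - n T) * s₂ = (a * T - n T) * (s₁ - s₂) := by
        have : b = 1 - a := by linarith
        rw [hs, this]
        ring
      rw [h2, abs_mul]
      -- Rounding aT to an integer is the only source of the error e = |s₁ - s₂|.
      have h3 : |a * (T : ℝ) - n T| ≤ 1 := by
        have h4 : (n T : ℝ) ≤ a * T := Nat.floor_le (by positivity)
        have h5 : a * T < n T + 1 := Nat.lt_floor_add_one _
        rw [abs_le]
        constructor <;> linarith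
      exact mul_le_of_le_one_left (abs_nonneg _) h3)
  rw [Nat.add_sub_cancel' (hnT T)] at h1
  have h2 := div_le_div_of_nonneg_right h1 hT'.le
  rw [sub_div, add_div] at h2
  change _ - C / T ≤ _ at h2
  linarith [hω1.1, hω2.1, hω3.2]

/-- The reversed environment R n ω changes with n, so the limits are again compared in probability,
using that each R n preserves P. -/
theorem growthRate_reverse [NeZero d] [IsProbabilityMeasure P]
    (h : MixingInstrument P θ ψ f F v N δ G)
    (hΛ : ∀ (K : ℕ) (s : ℝ), ∀ᵐ ω ∂P,
      Tendsto (fun n : ℕ => logProb θ ψ f K s n ω / n) atTop (nhds (Λ K s)))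
    {R : ℕ → Ω → Ω} (hR : ∀ n, MeasurePreserving (R n) P P) {K : ℕ} {s : ℝ}
    (hrev : ∀ n : ℕ, 0 < n → ∀ ω, logProb θ ψ f (K + 1 : ℕ) s n ω ≤
      n * s + logProb θ ψ f K (-s) n (R n ω)) :
    Λ (K + 1) s ≤ s + Λ K (-s) := by
  by_contra! hcon
  set η := (Λ (K + 1) s - (s + Λ K (-s))) / 2 with hη
  have hη0 : 0 < η := by rw [hη]; linarith
  have hlim : ∀ (K : ℕ) (s : ℝ),
      Tendsto (fun n : ℕ => P {ω | η ≤ |logProb θ ψ f K s n ω / n - Λ K s|}) atTop (nhds 0) :=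
    fun K s => tendsto_measure_abs_sub_ge (fun n => (h.measurable_logProb K s _).div_const _)
      (hΛ K s) hη0
  have hlim₂ : Tendsto (fun n : ℕ => P ((R n) ⁻¹'
      {ω | η ≤ |logProb θ ψ f K (-s) n ω / n - Λ K (-s)|})) atTop (nhds 0) := by
    refine (hlim K (-s)).congr fun n => ?_
    refine ((hR _).measure_preimage (MeasurableSet.nullMeasurableSet ?_)).symm
    exact measurableSet_le measurable_const
      (((h.measurable_logProb K _ _).div_const _).sub_const _).abs
  have hev := eventually_exists_mem_of_tendsto_zero (A := fun _ => univ) (p := 1) one_ne_zero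
    (fun T => (measure_univ (μ := P)).ge) (hlim (K + 1) s) hlim₂ hlim₂
  obtain ⟨n, ⟨ω, -, hω1, hω2, -⟩, hn⟩ := (hev.and (eventually_gt_atTop 0)).exists
  have hn' : (0 : ℝ) < n := by exact_mod_cast hn
  simp only [mem_preimage, mem_ofPred_eq, not_le, abs_lt] at hω1 hω2
  have h1 := div_le_div_of_nonneg_right (hrev n hn ω) hn'.le
  rw [add_div, mul_div_cancel_left₀ _ hn'.ne'] at h1
  linarith [hω1.1, hω2.2]

end MixingInstrument

/-! ## Properties of the rate function -/

theorem lowerSemicontinuous_rateFunction {Λ : ℕ → ℝ → ℝ} (h : ∀ K, Continuous (Λ K)) :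
    LowerSemicontinuous (rateFunction Λ) :=
  lowerSemicontinuous_iSup fun K =>
    (ENNReal.continuous_ofReal.comp (h K).neg).lowerSemicontinuous

theorem convexOn_rateFunction {Λ : ℕ → ℝ → ℝ}
    (h : ∀ (K : ℕ) {a b s₁ s₂ : ℝ}, 0 < a → 0 < b → a + b = 1 →
      a * Λ K s₁ + b * Λ K s₂ ≤ Λ K (a * s₁ + b * s₂)) :
    ConvexOn ℝ≥0 univ (rateFunction Λ) := by
  refine ⟨convex_univ, fun x _ y _ a b _ _ hab => ?_⟩
  rcases eq_or_ne a 0 with rfl | ha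
  · obtain rfl : b = 1 := by simpa using hab
    simp
  rcases eq_or_ne b 0 with rfl | hb
  · obtain rfl : a = 1 := by simpa using hab
    simp
  refine iSup_le fun K => ?_
  have h1 := h K (s₁ := x) (s₂ := y) (NNReal.coe_pos.2 (pos_iff_ne_zero.2 ha))
    (NNReal.coe_pos.2 (pos_iff_ne_zero.2 hb)) (by exact_mod_cast hab)
  have h2 : -Λ K (a • x + b • y) ≤ a * -Λ K x + b * -Λ K y := by
    simp only [NNReal.smul_def, smul_eq_mul]
    linarith
  refine (ENNReal.ofReal_le_ofReal h2).trans (ENNReal.ofReal_add_le.trans ?_)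
  rw [ENNReal.ofReal_mul a.coe_nonneg, ENNReal.ofReal_mul b.coe_nonneg, ENNReal.ofReal_coe_nnreal,
    ENNReal.ofReal_coe_nnreal, ENNReal.smul_def, ENNReal.smul_def, smul_eq_mul, smul_eq_mul]
  gcongr
  · exact le_iSup (fun K => ENNReal.ofReal (-Λ K x)) K
  · exact le_iSup (fun K => ENNReal.ofReal (-Λ K y)) K

/-- Bounding -Λ_K(-s) by s - Λ_{K+1}(s) raises K by one, which is harmless under the supremum. The
sign of Λ gives J(s) + s ≥ 0, so truncation at zero loses nothing. -/
theorem rateFunction_neg_le {Λ : ℕ → ℝ → ℝ} (h0 : ∀ K s, Λ K s ≤ 0)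
    (h : ∀ K s, Λ (K + 1) s ≤ s + Λ K (-s)) (s : ℝ) :
    (rateFunction Λ (-s) : EReal) ≤ (rateFunction Λ s : EReal) + (s : EReal) := by
  rcases eq_or_ne (rateFunction Λ s) ⊤ with htop | htop
  · rw [htop]
    simp
  set j := (rateFunction Λ s).toReal with hj
  have hjs : rateFunction Λ s = ENNReal.ofReal j := (ENNReal.ofReal_toReal htop).symm
  have hΛj : ∀ K, -Λ K s ≤ j := fun K => by
    rw [hj, ← ENNReal.ofReal_le_iff_le_toReal htop]
    exact le_iSup (fun K => ENNReal.ofReal (-Λ K s)) K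
  have h1 : ∀ K, -Λ K (-s) ≤ j + s := fun K => by linarith [h K s, hΛj (K + 1)]
  have hjs0 : 0 ≤ j + s := by linarith [h1 0, h0 0 (-s)]
  have h2 : rateFunction Λ (-s) ≤ ENNReal.ofReal (j + s) :=
    iSup_le fun K => ENNReal.ofReal_le_ofReal (h1 K)
  refine (EReal.coe_ennreal_le_coe_ennreal_iff.2 h2).trans ?_
  rw [hjs, EReal.coe_ennreal_ofReal, EReal.coe_ennreal_ofReal, max_eq_left hjs0,
    max_eq_left ENNReal.toReal_nonneg, EReal.coe_add]

theorem rateFunction_neg {Λ : ℕ → ℝ → ℝ} (h0 : ∀ K s, Λ K s ≤ 0)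
    (h : ∀ K s, Λ (K + 1) s ≤ s + Λ K (-s)) (s : ℝ) :
    (rateFunction Λ (-s) : EReal) = (rateFunction Λ s : EReal) + (s : EReal) := by
  refine le_antisymm (rateFunction_neg_le h0 h s) ?_
  have h1 := rateFunction_neg_le h0 h (-s)
  rw [neg_neg] at h1
  have h2 := add_le_add_left h1 (s : EReal)
  rwa [EReal.coe_neg, add_assoc, ← EReal.coe_neg, ← EReal.coe_add, neg_add_cancel, EReal.coe_zero,
    add_zero] at h2

end GrowthRates

/-! ## Positive maps: trace norm, irreducibility, strict positivity -/

section PositiveMaps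

open scoped MatrixOrder

variable {d : ℕ}

/-- The square root of A* A is A itself, by functional calculus, and its trace is the sum of the
square roots of the eigenvalues of A* A. -/
theorem traceNorm_of_nonneg {A : Mat d} (hA : 0 ≤ A) : traceNorm A = A.trace.re := by
  have hsa : IsSelfAdjoint A := IsSelfAdjoint.of_nonneg hA
  have hH := Matrix.isHermitian_conjTranspose_mul_self A
  have h1 : cfc Real.sqrt (A.conjTranspose * A) = A := by
    have h2 : A.conjTranspose * A = cfc (fun x : ℝ => x * x) A := by
      rw [cfc_mul .., cfc_id' ℝ A]
      congr 1
    rw [h2, ← cfc_comp' ..]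
    conv_rhs => rw [← cfc_id' ℝ A]
    exact cfc_congr fun x hx => Real.sqrt_mul_self (spectrum_nonneg_of_nonneg hA hx)
  have h3 : A.trace = ∑ i, ((√(hH.eigenvalues i) : ℝ) : ℂ) := by
    conv_lhs => rw [← h1, hH.cfc_eq, Matrix.IsHermitian.cfc, Unitary.conjStarAlgAut_apply,
      Matrix.trace_mul_comm, ← mul_assoc, Unitary.coe_star_mul_self, one_mul]
    simp [Matrix.trace]
  rw [h3, traceNorm, Complex.re_sum]
  simp

theorem posSemidef_of_forall_nonneg {A : Mat d} (h : ∀ x, 0 ≤ star x ⬝ᵥ (A.mulVec x)) :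
    A.PosSemidef := by
  rw [← Matrix.isPositive_toEuclideanLin_iff, LinearMap.isPositive_iff_complex]
  intro x
  have hx : 0 ≤ inner ℂ (Matrix.toEuclideanLin A x) x := by
    rw [← inner_conj_symm, starRingEnd_apply, star_nonneg_iff,
      EuclideanSpace.inner_eq_star_dotProduct, dotProduct_comm]
    exact h x.ofLp
  obtain ⟨h1, h2⟩ := Complex.nonneg_iff.1 hx
  exact ⟨Complex.ext (by simp) (by simpa using h2), h1⟩

/-- The rank one matrix `x xᴴ`. -/
def rankOne (x : Fin d → ℂ) : Mat d := Matrix.vecMulVec x (star x)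

theorem rankOne_nonneg (x : Fin d → ℂ) : 0 ≤ rankOne x :=
  Matrix.nonneg_iff_posSemidef.2 (Matrix.posSemidef_vecMulVec_self_star x)

theorem trace_rankOne_mul (x : Fin d → ℂ) (A : Mat d) :
    (rankOne x * A).trace = star x ⬝ᵥ (A.mulVec x) := by
  rw [rankOne, Matrix.trace_mul_comm, Matrix.mul_vecMulVec, Matrix.trace_vecMulVec,
    dotProduct_comm]

theorem trace_mul_nonneg {A B : Mat d} (hA : 0 ≤ A) (hB : 0 ≤ B) : 0 ≤ (A * B).trace := by
  obtain ⟨k, u, rfl⟩ := Matrix.posSemidef_iff_eq_sum_vecMulVec.1 (Matrix.nonneg_iff_posSemidef.1 hA)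
  rw [Finset.sum_mul, Matrix.trace_sum]
  refine Finset.sum_nonneg fun i _ => ?_
  exact (trace_rankOne_mul (u i) B).ge.trans'
    ((Matrix.nonneg_iff_posSemidef.1 hB).dotProduct_mulVec_nonneg (u i))

theorem hsAdjoint_nonneg {φ : Mat d →ₗ[ℂ] Mat d} (hφ : ∀ X, 0 ≤ X → 0 ≤ φ X) {X : Mat d}
    (hX : 0 ≤ X) : 0 ≤ hsAdjoint φ X := by
  refine Matrix.nonneg_iff_posSemidef.2 (posSemidef_of_forall_nonneg fun x => ?_)
  have h1 := trace_hsAdjoint φ X (rankOne x)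
  have h2 := (Matrix.nonneg_iff_posSemidef.1 (rankOne_nonneg x)).1
  have h3 := (Matrix.nonneg_iff_posSemidef.1 (hφ _ (rankOne_nonneg x))).1
  rw [h2, h3, trace_rankOne_mul] at h1
  rw [h1]
  exact trace_mul_nonneg (hφ _ (rankOne_nonneg x)) hX

theorem traceNorm_hsAdjoint {φ : Mat d →ₗ[ℂ] Mat d} (hφ : ∀ X, 0 ≤ X → 0 ≤ φ X) {X : Mat d}
    (hX : 0 ≤ X) : traceNorm (hsAdjoint φ X) = (φ 1 * X).trace.re := by
  rw [traceNorm_of_nonneg (hsAdjoint_nonneg hφ hX)]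
  have h1 := trace_hsAdjoint φ X 1
  rw [Matrix.conjTranspose_one, one_mul,
    (Matrix.nonneg_iff_posSemidef.1 (hφ _ zero_le_one)).1] at h1
  rw [h1]

theorem star_dotProduct_mulVec_mono {A B : Mat d} (h : A ≤ B) (x : Fin d → ℂ) :
    star x ⬝ᵥ A.mulVec x ≤ star x ⬝ᵥ B.mulVec x := by
  rw [← sub_nonneg, ← dotProduct_sub, ← Matrix.sub_mulVec]
  exact (Matrix.le_iff.1 h).dotProduct_mulVec_nonneg x

theorem star_dotProduct_smul_one_mulVec (c : ℝ) (x : Fin d → ℂ) :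
    star x ⬝ᵥ (c • (1 : Mat d)).mulVec x = c * (star x ⬝ᵥ x) := by
  rw [Matrix.smul_mulVec, Matrix.one_mulVec, dotProduct_smul, Complex.real_smul]

/-- By duality ‖φ*(X)‖₁ = tr(φ(1) X), so testing on normalized rank one states shows that v(φ*)
bounds the quadratic form of φ(1) from below. This is how (A1) controls the first step of an
evolution. -/
theorem vMin_smul_one_le {φ : Mat d →ₗ[ℂ] Mat d} (hφ : ∀ X, 0 ≤ X → 0 ≤ φ X) :
    vMin (hsAdjoint φ) • (1 : Mat d) ≤ φ 1 := by
  refine Matrix.le_iff.2 (posSemidef_of_forall_nonneg fun x => ?_)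
  rw [Matrix.sub_mulVec, dotProduct_sub, star_dotProduct_smul_one_mulVec, sub_nonneg]
  rcases eq_or_ne x 0 with rfl | hx
  · simp
  have hN : 0 < star x ⬝ᵥ x := Matrix.dotProduct_star_self_pos_iff.2 hx
  obtain ⟨N, hN0, hNx⟩ : ∃ N : ℝ, 0 < N ∧ (N : ℂ) = star x ⬝ᵥ x := by
    obtain ⟨h1, h2⟩ := Complex.pos_iff.1 hN
    exact ⟨_, h1, Complex.ext (by simp) (by simpa using h2)⟩
  have hmem : N⁻¹ • rankOne x ∈ densityMatrices d := by
    refine ⟨Matrix.nonneg_iff_posSemidef.1 (smul_nonneg (inv_pos.2 hN0).le (rankOne_nonneg x)), ?_⟩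
    rw [Matrix.trace_smul, rankOne, Matrix.trace_vecMulVec, dotProduct_comm, ← hNx,
      Complex.real_smul, ← Complex.ofReal_mul, inv_mul_cancel₀ hN0.ne', Complex.ofReal_one]
  have h1 : vMin (hsAdjoint φ) ≤ traceNorm (hsAdjoint φ (N⁻¹ • rankOne x)) :=
    csInf_le ⟨0, by
      rintro _ ⟨X, hX, rfl⟩
      exact Finset.sum_nonneg fun i _ => Real.sqrt_nonneg _⟩ (mem_image_of_mem _ hmem)
  rw [traceNorm_hsAdjoint hφ (Matrix.nonneg_iff_posSemidef.2 hmem.1), Matrix.mul_smul,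
    trace_re_smul, Matrix.trace_mul_comm, trace_rankOne_mul, inv_mul_eq_div, le_div_iff₀ hN0] at h1
  have h2 := Complex.nonneg_iff.1
    ((Matrix.nonneg_iff_posSemidef.1 (hφ _ zero_le_one)).dotProduct_mulVec_nonneg x)
  rw [← hNx, ← Complex.ofReal_mul, Complex.le_def]
  exact ⟨by simpa using h1, by simpa using h2.2⟩

theorem posDef_of_dotProduct_mulVec_ne_zero {A : Mat d} (hA : 0 ≤ A)
    (h : ∀ x, star x ⬝ᵥ A.mulVec x = 0 → x = 0) : A.PosDef := by
  have hA' := Matrix.nonneg_iff_posSemidef.1 hA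
  refine Matrix.PosDef.of_dotProduct_mulVec_pos hA'.1 fun x hx => ?_
  exact (hA'.dotProduct_mulVec_nonneg x).lt_of_ne' fun h0 => hx (h x h0)

/-- An irreducible positive and trace preserving map sends the identity to a positive definite
matrix. -/
theorem posDef_map_one_of_isIrreducibleMap [NeZero d] {φ : Mat d →ₗ[ℂ] Mat d}
    (hφ : ∀ X, 0 ≤ X → 0 ≤ φ X) (htr : ∀ X, (φ X).trace = X.trace) (hirr : IsIrreducibleMap φ) :
    (φ 1).PosDef := by
  refine posDef_of_dotProduct_mulVec_ne_zero (hφ _ zero_le_one) fun x hx => ?_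
  by_contra hx0
  -- If x is isotropic for φ(1), it is so for every φ(X), because X ≤ tr(X) 1.
  have hzero : ∀ X : Mat d, 0 ≤ X → star x ⬝ᵥ (φ X).mulVec x = 0 := by
    intro X hX
    refine le_antisymm ?_ ((Matrix.nonneg_iff_posSemidef.1 (hφ X hX)).dotProduct_mulVec_nonneg x)
    have h1 := star_dotProduct_mulVec_mono (map_le_map_of_nonneg hφ (le_trace_smul_one hX)) x
    rwa [map_real_smul, Matrix.smul_mulVec, dotProduct_smul, hx, smul_zero] at h1
  -- Hence powers of id + φ do not change the quadratic form at x. Applied to φ(1), which is nonzero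
  -- and vanishes at x, this contradicts irreducibility.
  have hpow : ∀ (k : ℕ) (X : Mat d), 0 ≤ X →
      0 ≤ (((1 : Module.End ℂ (Mat d)) + φ) ^ k) X ∧
      star x ⬝ᵥ ((((1 : Module.End ℂ (Mat d)) + φ) ^ k) X).mulVec x = star x ⬝ᵥ X.mulVec x := by
    intro k X hX
    induction k with
    | zero => exact ⟨hX, rfl⟩
    | succ k ih =>
      rw [pow_succ', Module.End.mul_apply, LinearMap.add_apply, Module.End.one_apply]
      refine ⟨add_nonneg ih.1 (hφ _ ih.1), ?_⟩
      rw [Matrix.add_mulVec, dotProduct_add, hzero _ ih.1, add_zero, ih.2]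
  have hne : φ 1 ≠ 0 := fun h0 => by
    have h1 := htr 1
    rw [h0, Matrix.trace_zero, Matrix.trace_one, Fintype.card_fin] at h1
    exact NeZero.ne (d : ℂ) h1.symm
  have h1 :=
    (hirr (φ 1) (Matrix.nonneg_iff_posSemidef.1 (hφ _ zero_le_one)) hne).dotProduct_mulVec_pos
    hx0
  rw [(hpow _ _ (hφ _ zero_le_one)).2, hx] at h1
  exact lt_irrefl _ h1

theorem vMin_pos [NeZero d] {φ : Mat d →ₗ[ℂ] Mat d} (hφ : ∀ X, 0 ≤ X → 0 ≤ φ X)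
    (h : (φ 1).PosDef) : 0 < vMin (hsAdjoint φ) := by
  obtain ⟨c, hc, hcφ⟩ := exists_smul_one_le_of_posDef h
  refine hc.trans_le (le_csInf ?_ ?_)
  · refine Set.Nonempty.image _ ⟨(d : ℝ)⁻¹ • 1, ?_, ?_⟩
    · exact Matrix.nonneg_iff_posSemidef.1 (smul_nonneg (by positivity) zero_le_one)
    · have hd : (d : ℂ) ≠ 0 := NeZero.ne _
      simp [Matrix.trace_smul, hd]
  · rintro _ ⟨X, hX, rfl⟩
    have hX0 := Matrix.nonneg_iff_posSemidef.2 hX.1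
    have h1 := Complex.nonneg_iff.1 (trace_mul_nonneg (sub_nonneg.2 hcφ) hX0)
    rw [sub_mul, Matrix.trace_sub, smul_mul_assoc, one_mul, Complex.sub_re, trace_re_smul,
      hX.2, Complex.one_re, mul_one] at h1
    refine le_of_le_of_eq ?_ (traceNorm_hsAdjoint hφ hX0).symm
    linarith [h1.1]

/-- The form (x, y) ↦ ⟨y, φ(x x*) y⟩ is positive on the product of unit spheres, so compactness
gives a minimum δ > 0. Homogeneity extends the bound to all vectors, and a positive matrix is a sum
of rank one matrices. -/
theorem exists_smul_one_le_of_isPositivityImproving {φ : Mat d →ₗ[ℂ] Mat d}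
    (h : IsPositivityImproving φ) :
    ∃ δ > (0 : ℝ), ∀ X : Mat d, 0 ≤ X → (δ * X.trace.re) • (1 : Mat d) ≤ φ X := by
  have hφ : ∀ X, 0 ≤ X → 0 ≤ φ X := fun X hX => by
    rcases eq_or_ne X 0 with rfl | hX0
    · simp
    · exact Matrix.nonneg_iff_posSemidef.2 (h X (Matrix.nonneg_iff_posSemidef.1 hX) hX0).posSemidef
  let S := Metric.sphere (0 : EuclideanSpace ℂ (Fin d)) 1
  let q : EuclideanSpace ℂ (Fin d) × EuclideanSpace ℂ (Fin d) → ℝ := fun p =>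
    (star p.2.ofLp ⬝ᵥ (φ (rankOne p.1.ofLp)).mulVec p.2.ofLp).re
  have hq : Continuous q := by
    have h1 : Continuous fun p : EuclideanSpace ℂ (Fin d) × EuclideanSpace ℂ (Fin d) =>
        φ (rankOne p.1.ofLp) := by
      refine (LinearMap.continuous_of_finiteDimensional φ).comp ?_
      unfold rankOne
      refine Continuous.matrix_vecMulVec (by fun_prop) (by fun_prop)
    refine Complex.continuous_re.comp (Continuous.dotProduct (by fun_prop) ?_)
    exact h1.matrix_mulVec (by fun_prop)
  have hne : ∀ x ∈ S, x.ofLp ≠ 0 := by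
    intro x hx h0
    have h1 : x = 0 := by ext i; simp [h0]
    simp [S, h1] at hx
  have hqpos : ∀ p ∈ S ×ˢ S, 0 < q p := by
    rintro ⟨x, y⟩ ⟨hx, hy⟩
    refine (Complex.pos_iff.1 (Matrix.PosDef.dotProduct_mulVec_pos
      (h _ (Matrix.nonneg_iff_posSemidef.1 (rankOne_nonneg x.ofLp)) ?_) (hne y hy))).1
    intro h0
    have h1 : (rankOne x.ofLp).trace = 0 := by rw [h0, Matrix.trace_zero]
    rw [rankOne, Matrix.trace_vecMulVec, dotProduct_comm,
      dotProduct_star_self_eq_zero] at h1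
    exact hne x hx h1
  obtain ⟨δ, hδ, hδq⟩ : ∃ δ > (0 : ℝ), ∀ p ∈ S ×ˢ S, δ ≤ q p := by
    have hcomp : IsCompact (S ×ˢ S) := (isCompact_sphere _ _).prod (isCompact_sphere _ _)
    rcases (S ×ˢ S).eq_empty_or_nonempty with hem | hnonem
    · exact ⟨1, one_pos, by simp [hem]⟩
    · obtain ⟨p, hp, hmin⟩ := hcomp.exists_isMinOn hnonem hq.continuousOn
      exact ⟨q p, hqpos p hp, fun p' hp' => hmin hp'⟩
  have hhom : ∀ (a b : ℝ) (x y : EuclideanSpace ℂ (Fin d)),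
      q (a • x, b • y) = a ^ 2 * b ^ 2 * q (x, y) := by
    intro a b x y
    have h1 : rankOne (a • x).ofLp = (a ^ 2) • rankOne x.ofLp := by
      ext i j
      simp only [rankOne, Matrix.vecMulVec_apply, Matrix.smul_apply, PiLp.smul_apply,
        Pi.star_apply, Complex.real_smul, star_mul', RCLike.star_def, Complex.conj_ofReal]
      push_cast
      ring
    have h2 : (star (b • y).ofLp ⬝ᵥ (φ (rankOne x.ofLp)).mulVec (b • y).ofLp) =
        ((b ^ 2 : ℝ) : ℂ) * (star y.ofLp ⬝ᵥ (φ (rankOne x.ofLp)).mulVec y.ofLp) := by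
      rw [WithLp.ofLp_smul, star_smul, smul_dotProduct, Matrix.mulVec_smul, dotProduct_smul,
        smul_smul, star_trivial, Complex.real_smul, sq]
    simp only [q]
    rw [h1, map_real_smul, Matrix.smul_mulVec, dotProduct_smul, h2, Complex.real_smul, ← mul_assoc,
      ← Complex.ofReal_mul, Complex.re_ofReal_mul]
  have hquad : ∀ x y : EuclideanSpace ℂ (Fin d), δ * ‖x‖ ^ 2 * ‖y‖ ^ 2 ≤ q (x, y) := by
    intro x y
    rcases eq_or_ne x 0 with rfl | hx
    · simpa using (hhom 0 1 0 y).ge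
    rcases eq_or_ne y 0 with rfl | hy
    · simpa using (hhom 1 0 x 0).ge
    have hx' : ‖x‖ ≠ 0 := norm_ne_zero_iff.2 hx
    have hy' : ‖y‖ ≠ 0 := norm_ne_zero_iff.2 hy
    have h1 := hδq (‖x‖⁻¹ • x, ‖y‖⁻¹ • y) ⟨by simp [S, norm_smul, hx'], by simp [S, norm_smul, hy']⟩
    have h2 := hhom ‖x‖ ‖y‖ (‖x‖⁻¹ • x) (‖y‖⁻¹ • y)
    rw [smul_inv_smul₀ hx', smul_inv_smul₀ hy'] at h2
    rw [h2]
    nlinarith [mul_le_mul_of_nonneg_left h1 (show 0 ≤ ‖x‖ ^ 2 * ‖y‖ ^ 2 by positivity)]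
  refine ⟨δ, hδ, fun X hX => ?_⟩
  obtain ⟨k, u, rfl⟩ := Matrix.posSemidef_iff_eq_sum_vecMulVec.1 (Matrix.nonneg_iff_posSemidef.1 hX)
  rw [Matrix.trace_sum, Complex.re_sum, Finset.mul_sum, Finset.sum_smul, map_sum]
  refine Finset.sum_le_sum fun i _ => Matrix.le_iff.2 (posSemidef_of_forall_nonneg fun y => ?_)
  rw [Matrix.sub_mulVec, dotProduct_sub, star_dotProduct_smul_one_mulVec, sub_nonneg]
  have hnorm : ∀ z : Fin d → ℂ, ((‖WithLp.toLp 2 z‖ ^ 2 : ℝ) : ℂ) = star z ⬝ᵥ z := fun z => by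
    have h1 := inner_self_eq_norm_sq_to_K (𝕜 := ℂ) (WithLp.toLp 2 z)
    rw [EuclideanSpace.inner_eq_star_dotProduct, dotProduct_comm] at h1
    push_cast
    exact h1.symm
  have h1 := hquad (WithLp.toLp 2 (u i)) (WithLp.toLp 2 y)
  have h2 := Complex.nonneg_iff.1 ((Matrix.nonneg_iff_posSemidef.1
    (hφ _ (rankOne_nonneg (u i)))).dotProduct_mulVec_nonneg y)
  rw [Matrix.trace_vecMulVec, dotProduct_comm, ← hnorm, ← hnorm, Complex.ofReal_re,
    ← Complex.ofReal_mul, Complex.le_def]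
  exact ⟨h1, (Complex.ofReal_im _).trans h2.2⟩

end PositiveMaps

/-! ## Measurable families of matrices -/

section MeasurableEntries

variable {Ω : Type*} [MeasurableSpace Ω] {l m n : Type*}

/-- A family of matrices with measurable entries. -/
def MeasurableEntries (X : Ω → Matrix m n ℂ) : Prop := ∀ i j, Measurable fun ω => X ω i j

namespace MeasurableEntries

theorem const (X : Matrix m n ℂ) : MeasurableEntries fun _ : Ω => X := fun _ _ => measurable_const

theorem sub {X Y : Ω → Matrix m n ℂ} (hX : MeasurableEntries X) (hY : MeasurableEntries Y) :
    MeasurableEntries fun ω => X ω - Y ω := fun i j => (hX i j).sub (hY i j)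

theorem smul {c : Ω → ℂ} {X : Ω → Matrix m n ℂ} (hc : Measurable c) (hX : MeasurableEntries X) :
    MeasurableEntries fun ω => c ω • X ω := fun i j => hc.mul (hX i j)

theorem sum {ι : Type*} {s : Finset ι} {X : ι → Ω → Matrix m n ℂ}
    (hX : ∀ i ∈ s, MeasurableEntries (X i)) : MeasurableEntries fun ω => ∑ i ∈ s, X i ω :=
  fun i j => by
    simp only [Matrix.sum_apply]
    exact Finset.measurable_sum _ fun k hk => hX k hk i j

theorem mul [Fintype m] {X : Ω → Matrix l m ℂ} {Y : Ω → Matrix m n ℂ} (hX : MeasurableEntries X)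
    (hY : MeasurableEntries Y) : MeasurableEntries fun ω => X ω * Y ω := fun i j => by
  simp only [Matrix.mul_apply]
  exact Finset.measurable_sum _ fun k _ => (hX i k).mul (hY k j)

theorem pow [Fintype m] [DecidableEq m] {X : Ω → Matrix m m ℂ} (hX : MeasurableEntries X) (k : ℕ) :
    MeasurableEntries fun ω => X ω ^ k := by
  induction k with
  | zero => simpa using const (Ω := Ω) (1 : Matrix m m ℂ)
  | succ k ih => simpa only [pow_succ] using ih.mul hX

theorem conjTranspose {X : Ω → Matrix m n ℂ} (hX : MeasurableEntries X) :
    MeasurableEntries fun ω => (X ω).conjTranspose := fun i j =>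
  Complex.continuous_conj.measurable.comp (hX j i)

theorem kronecker {m' n' : Type*} {X : Ω → Matrix m n ℂ} {Y : Ω → Matrix m' n' ℂ}
    (hX : MeasurableEntries X) (hY : MeasurableEntries Y) :
    MeasurableEntries fun ω => X ω ⊗ₖ Y ω := fun i j => (hX i.1 j.1).mul (hY i.2 j.2)

theorem trace [Fintype m] {X : Ω → Matrix m m ℂ} (hX : MeasurableEntries X) :
    Measurable fun ω => (X ω).trace :=
  Finset.measurable_sum _ fun i _ => hX i i

theorem of_tendsto {X : ℕ → Ω → Matrix m n ℂ} {Y : Ω → Matrix m n ℂ}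
    (hX : ∀ k, MeasurableEntries (X k)) (h : ∀ ω, Tendsto (fun k => X k ω) atTop (nhds (Y ω))) :
    MeasurableEntries Y := fun i j =>
  measurable_of_tendsto_metrizable (fun k => hX k i j) (tendsto_pi_nhds.2 fun ω =>
    ((continuous_apply_apply i j).tendsto (Y ω)).comp (h ω))

end MeasurableEntries

end MeasurableEntries

/-! ## Partial traces -/

section PartialTrace

variable {d m : ℕ}

theorem partialTrace_one_kronecker_mul (B : Mat m) (Z : Matrix (Fin d × Fin m) (Fin d × Fin m) ℂ) :
    partialTrace (((1 : Mat d) ⊗ₖ B) * Z) = partialTrace (Z * ((1 : Mat d) ⊗ₖ B)) := by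
  ext i j
  have h1 : ∀ k, (((1 : Mat d) ⊗ₖ B) * Z) (i, k) (j, k) = ∑ l, B k l * Z (i, l) (j, k) :=
      fun k => by
    simp [Matrix.mul_apply, Fintype.sum_prod_type, Matrix.one_apply]
  have h2 : ∀ k, (Z * ((1 : Mat d) ⊗ₖ B)) (i, k) (j, k) = ∑ l, B l k * Z (i, k) (j, l) :=
      fun k => by
    rw [Matrix.mul_apply, Fintype.sum_prod_type, Finset.sum_comm]
    simp [Matrix.one_apply, mul_comm]
  simp only [partialTrace, Matrix.of_apply, h1, h2]
  exact Finset.sum_comm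

theorem trace_mul_partialTrace (X : Mat d) (Z : Matrix (Fin d × Fin m) (Fin d × Fin m) ℂ) :
    (X * partialTrace Z).trace = ((X ⊗ₖ (1 : Mat m)) * Z).trace := by
  simp only [partialTrace, Matrix.trace, Matrix.diag_apply, Matrix.of_apply, Matrix.mul_apply,
    Fintype.sum_prod_type, Matrix.kroneckerMap_apply, Matrix.one_apply, mul_ite, mul_one, mul_zero,
    ite_mul, zero_mul, Finset.sum_ite_eq, Finset.mem_univ, if_true, Finset.mul_sum]
  refine Finset.sum_congr rfl fun i _ => ?_
  rw [Finset.sum_comm]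

theorem posSemidef_partialTrace {Z : Matrix (Fin d × Fin m) (Fin d × Fin m) ℂ}
    (hZ : Z.PosSemidef) : (partialTrace Z).PosSemidef := by
  have h : partialTrace Z = ∑ k, Z.submatrix (fun i => (i, k)) fun j => (j, k) := by
    ext i j
    simp [partialTrace, Matrix.sum_apply]
  rw [h]
  exact Matrix.posSemidef_sum _ fun k _ => hZ.submatrix _

end PartialTrace

/-! ## The two-time measurement model as a random instrument -/

namespace TwoTimeModel

variable {Ω : Type*} [MeasurableSpace Ω] {d m : ℕ} (M : TwoTimeModel Ω d m)

/-- The eigenvalues `exp (-β E)` of the probe state. -/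
def weight (ω : Ω) (ε : Fin m) : ℝ := Real.exp (-(M.β ω * M.E ω ε))

theorem weight_pos (ω : Ω) (ε : Fin m) : 0 < M.weight ω ε := Real.exp_pos _

theorem weight_strictAnti (ω : Ω) : StrictAnti (M.weight ω) := fun _ _ h =>
  Real.exp_lt_exp.2 (neg_lt_neg (mul_lt_mul_of_pos_left (M.E_strictMono ω h) (M.β_pos ω)))

theorem xi_eq_sum (ω : Ω) : M.ξ ω = ∑ ε, (M.weight ω ε : ℂ) • M.π ω ε := by
  rw [M.ξ_eq]
  simp [weight]

theorem pi_mul_pi (ω : Ω) (ε ε' : Fin m) :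
    M.π ω ε * M.π ω ε' = if ε = ε' then M.π ω ε else 0 := by
  split_ifs with h
  · rw [← h, M.π_idem]
  · exact M.π_orthogonal ω ε ε' h

theorem pi_mul_xi (ω : Ω) (ε : Fin m) : M.π ω ε * M.ξ ω = (M.weight ω ε : ℂ) • M.π ω ε := by
  simp [xi_eq_sum, Finset.mul_sum, pi_mul_pi, smul_ite]

theorem pi_posSemidef (ω : Ω) (ε : Fin m) : (M.π ω ε).PosSemidef := by
  have h := Matrix.posSemidef_conjTranspose_mul_self (M.π ω ε)
  rwa [M.π_isHermitian, M.π_idem] at h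

theorem pi_ne_zero (ω : Ω) (ε : Fin m) : M.π ω ε ≠ 0 := fun h => by
  have := M.π_rank ω ε
  simp [h] at this

theorem trace_pi_ne_zero (ω : Ω) (ε : Fin m) : (M.π ω ε).trace ≠ 0 := fun h =>
  M.pi_ne_zero ω ε ((M.pi_posSemidef ω ε).trace_eq_zero_iff.1 h)

theorem instrument_apply (ω : Ω) (a : Fin m × Fin m) (X : Mat d) :
    M.instrument ω a X = partialTrace (((1 : Mat d) ⊗ₖ M.π ω a.2) *
      (M.U ω * (X ⊗ₖ (M.π ω a.1 * M.ξ ω)) * (M.U ω).conjTranspose)) := rfl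

/-- Apart from the weight, the two measured projectors and the two matrices enter symmetrically;
time reversal exploits this. -/
theorem trace_mul_instrument (ω : Ω) (a : Fin m × Fin m) (X Y : Mat d) :
    (X * M.instrument ω a Y).trace = M.weight ω a.1 *
      ((X ⊗ₖ M.π ω a.2) * (M.U ω * (Y ⊗ₖ M.π ω a.1) * (M.U ω).conjTranspose)).trace := by
  rw [instrument_apply, trace_mul_partialTrace, ← mul_assoc, ← Matrix.mul_kronecker_mul, mul_one,
    one_mul, pi_mul_xi, Matrix.kronecker_smul, Matrix.mul_smul, Matrix.smul_mul, Matrix.mul_smul,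
    Matrix.trace_smul, smul_eq_mul]

/-- The projector is idempotent, and cyclicity of the partial trace in the second factor moves one
copy to the right, leaving a congruence of a positive matrix. -/
theorem instrument_posSemidef (ω : Ω) (a : Fin m × Fin m) {X : Mat d} (hX : X.PosSemidef) :
    (M.instrument ω a X).PosSemidef := by
  have hV : ((1 : Mat d) ⊗ₖ M.π ω a.2) = ((1 : Mat d) ⊗ₖ M.π ω a.2).conjTranspose := by
    rw [Matrix.conjTranspose_kronecker, Matrix.conjTranspose_one, M.π_isHermitian]
  have hidem : ((1 : Mat d) ⊗ₖ M.π ω a.2) =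
      ((1 : Mat d) ⊗ₖ M.π ω a.2) * ((1 : Mat d) ⊗ₖ M.π ω a.2) := by
    rw [← Matrix.mul_kronecker_mul, M.π_idem, one_mul]
  rw [instrument_apply, hidem, mul_assoc, partialTrace_one_kronecker_mul]
  refine posSemidef_partialTrace ?_
  nth_rewrite 2 [hV]
  refine Matrix.PosSemidef.mul_mul_conjTranspose_same ?_ _
  refine Matrix.PosSemidef.mul_mul_conjTranspose_same ?_ _
  refine hX.kronecker ?_
  rw [pi_mul_xi]
  exact (M.pi_posSemidef ω a.1).smul (by exact_mod_cast (M.weight_pos ω a.1).le)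

theorem trace_channel (ω : Ω) (X : Mat d) : (M.channel ω X).trace = X.trace := by
  have hU : (M.U ω).conjTranspose * M.U ω = 1 := Matrix.mem_unitaryGroup_iff'.1 (M.unitary_U ω)
  have h1 : ∀ a, (M.instrument ω a X).trace = M.weight ω a.1 *
      (((1 : Mat d) ⊗ₖ M.π ω a.2) * (M.U ω * (X ⊗ₖ M.π ω a.1) * (M.U ω).conjTranspose)).trace :=
    fun a => by rw [← M.trace_mul_instrument, one_mul]
  rw [channel, LinearMap.sum_apply, Matrix.trace_sum, Fintype.sum_prod_type]
  simp only [h1]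
  have h2 : ∀ ε, ∑ ε', (M.weight ω ε : ℂ) *
      (((1 : Mat d) ⊗ₖ M.π ω ε') * (M.U ω * (X ⊗ₖ M.π ω ε) * (M.U ω).conjTranspose)).trace =
      X.trace * ((M.weight ω ε : ℂ) • M.π ω ε).trace := by
    intro ε
    rw [← Finset.mul_sum, ← Matrix.trace_sum, ← Finset.sum_mul]
    have h3 : ∑ ε', (1 : Mat d) ⊗ₖ M.π ω ε' = 1 := by
      have h4 : (1 : Mat d) ⊗ₖ ∑ ε', M.π ω ε' = ∑ ε', (1 : Mat d) ⊗ₖ M.π ω ε' := by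
        ext p q
        simp [Matrix.sum_apply, Finset.mul_sum]
      rw [← h4, M.π_sum, Matrix.one_kronecker_one]
    rw [h3, one_mul, Matrix.trace_mul_comm, ← mul_assoc, hU, one_mul, Matrix.trace_kronecker,
      Matrix.trace_smul, smul_eq_mul]
    ring
  rw [Finset.sum_congr rfl fun ε _ => h2 ε, ← Finset.mul_sum, ← Matrix.trace_sum, ← xi_eq_sum,
    M.ξ_trace, mul_one]

/-! ### Measurability of the spectral decomposition -/

/-- The part of the probe state on the eigenspaces of index at least `ε`. -/
def tailState (ω : Ω) (ε : Fin m) : Mat m :=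
  M.ξ ω - ∑ ε' ∈ Finset.Iio ε, (M.weight ω ε' : ℂ) • M.π ω ε'

theorem tailState_eq_sum (ω : Ω) (ε : Fin m) :
    M.tailState ω ε = ∑ ε' ∈ Finset.Ici ε, (M.weight ω ε' : ℂ) • M.π ω ε' := by
  rw [tailState, xi_eq_sum, sub_eq_iff_eq_add, add_comm]
  have h : (Finset.univ : Finset (Fin m)) = Finset.Iio ε ∪ Finset.Ici ε := by
    ext x
    simpa using lt_or_ge x ε
  rw [h, Finset.sum_union]
  rw [Finset.disjoint_left]
  intro x hx hx'
  simp only [Finset.mem_Iio, Finset.mem_Ici] at hx hx'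
  omega

theorem tailState_pow_succ (ω : Ω) (ε : Fin m) (k : ℕ) :
    M.tailState ω ε ^ (k + 1) =
      ∑ ε' ∈ Finset.Ici ε, ((M.weight ω ε' ^ (k + 1) : ℝ) : ℂ) • M.π ω ε' := by
  induction k with
  | zero => simp [tailState_eq_sum]
  | succ k ih =>
    rw [pow_succ, ih, tailState_eq_sum, Finset.sum_mul]
    refine Finset.sum_congr rfl fun ε' hε' => ?_
    rw [Finset.mul_sum, Finset.sum_eq_single_of_mem ε' hε']
    · rw [Matrix.smul_mul, Matrix.mul_smul, M.π_idem, smul_smul]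
      push_cast
      rw [pow_succ _ (k + 1)]
    · intro b _ hb
      rw [Matrix.smul_mul, Matrix.mul_smul, M.π_orthogonal ω _ _ hb.symm, smul_zero, smul_zero]

/-- Power iteration: ε carries the strictly largest weight among the indices in `Finset.Ici ε`, so
normalized powers converge to its projector. -/
theorem tendsto_tailState_pow (ω : Ω) (ε : Fin m) :
    Tendsto (fun k : ℕ => ((M.weight ω ε ^ (k + 1) : ℝ) : ℂ)⁻¹ • M.tailState ω ε ^ (k + 1)) atTop
      (nhds (M.π ω ε)) := by
  have h1 : ∀ k : ℕ, ((M.weight ω ε ^ (k + 1) : ℝ) : ℂ)⁻¹ • M.tailState ω ε ^ (k + 1) =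
      ∑ ε' ∈ Finset.Ici ε, (((M.weight ω ε' / M.weight ω ε) ^ (k + 1) : ℝ) : ℂ) • M.π ω ε' := by
    intro k
    rw [tailState_pow_succ, Finset.smul_sum]
    refine Finset.sum_congr rfl fun ε' _ => ?_
    rw [smul_smul, div_pow]
    push_cast
    rw [inv_mul_eq_div]
  have h2 : M.π ω ε = ∑ ε' ∈ Finset.Ici ε, (if ε' = ε then (1 : ℂ) else 0) • M.π ω ε' := by
    rw [Finset.sum_eq_single_of_mem ε (Finset.mem_Ici.2 le_rfl)]
    · simp
    · intro b _ hb
      simp [hb]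
  simp_rw [h1]
  rw [h2]
  refine tendsto_finsetSum _ fun ε' hε' => Tendsto.smul_const ?_ _
  split_ifs with h
  · subst h
    simp [(M.weight_pos ω ε').ne']
  · have hlt : M.weight ω ε' / M.weight ω ε < 1 :=
      (div_lt_one (M.weight_pos ω ε)).2
        (M.weight_strictAnti ω (lt_of_le_of_ne (Finset.mem_Ici.1 hε') (Ne.symm h)))
    have h3 := (tendsto_pow_atTop_nhds_zero_of_lt_one
      (div_pos (M.weight_pos ω ε') (M.weight_pos ω ε)).le hlt).comp (tendsto_add_atTop_nat 1)
    exact (Complex.continuous_ofReal.tendsto 0).comp h3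

theorem tendsto_trace_tailState_div (ω : Ω) (ε : Fin m) :
    Tendsto (fun k : ℕ => (M.tailState ω ε ^ (k + 1 + 1)).trace /
      (M.tailState ω ε ^ (k + 1)).trace) atTop (nhds (M.weight ω ε : ℂ)) := by
  have hw : (M.weight ω ε : ℂ) ≠ 0 := by exact_mod_cast (M.weight_pos ω ε).ne'
  have htr : Tendsto (fun k : ℕ =>
      (((M.weight ω ε ^ (k + 1) : ℝ) : ℂ)⁻¹ • M.tailState ω ε ^ (k + 1)).trace) atTop
      (nhds (M.π ω ε).trace) :=
    (continuous_id.matrix_trace.tendsto _).comp (M.tendsto_tailState_pow ω ε)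
  have h := ((htr.comp (tendsto_add_atTop_nat 1)).div htr (M.trace_pi_ne_zero ω ε)).const_mul
    (M.weight ω ε : ℂ)
  rw [div_self (M.trace_pi_ne_zero ω ε), mul_one] at h
  refine h.congr fun k => ?_
  simp only [Function.comp_apply, Pi.div_apply, Matrix.trace_smul, smul_eq_mul]
  push_cast
  rw [pow_succ (M.weight ω ε : ℂ) (k + 1)]
  field_simp

/-- Only ξ is known to be measurable. The eigenvalues and projectors are recovered in decreasing
order of the eigenvalues: the earlier ones are subtracted, and power iteration exhibits the next
pair as a pointwise limit. -/
theorem measurable_spectral (ε : Fin m) :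
    (Measurable fun ω => (M.weight ω ε : ℂ)) ∧ MeasurableEntries fun ω => M.π ω ε := by
  induction ε using WellFoundedLT.induction with
  | _ ε ih =>
  have htail : MeasurableEntries fun ω => M.tailState ω ε :=
    MeasurableEntries.sub M.measurable_ξ (MeasurableEntries.sum fun ε' hε' =>
      (ih ε' (Finset.mem_Iio.1 hε')).2.smul (ih ε' (Finset.mem_Iio.1 hε')).1)
  have hw : Measurable fun ω => (M.weight ω ε : ℂ) :=
    measurable_of_tendsto_metrizable (fun k => (htail.pow (k + 1 + 1)).trace.div
      (htail.pow (k + 1)).trace) (tendsto_pi_nhds.2 fun ω => M.tendsto_trace_tailState_div ω ε)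
  refine ⟨hw, MeasurableEntries.of_tendsto (fun k => ?_) fun ω => M.tendsto_tailState_pow ω ε⟩
  refine (htail.pow (k + 1)).smul ?_
  push_cast
  exact (hw.pow_const (k + 1)).inv

theorem measurable_weight (ε : Fin m) : Measurable fun ω => M.weight ω ε := by
  have h : Measurable fun ω => (M.weight ω ε : ℂ).re :=
    Complex.measurable_re.comp (M.measurable_spectral ε).1
  simpa only [Complex.ofReal_re] using h

theorem entropyChange_eq_log (ω : Ω) (a : Fin m × Fin m) :
    M.entropyChange ω a = Real.log (M.weight ω a.1) - Real.log (M.weight ω a.2) := by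
  rw [weight, weight, Real.log_exp, Real.log_exp, entropyChange]
  ring

theorem measurable_entropyChange (a : Fin m × Fin m) : Measurable fun ω => M.entropyChange ω a := by
  simp only [entropyChange_eq_log]
  exact (Real.measurable_log.comp (M.measurable_weight _)).sub
    (Real.measurable_log.comp (M.measurable_weight _))

theorem measurableEntries_instrument (a : Fin m × Fin m) (X : Mat d) :
    MeasurableEntries fun ω => M.instrument ω a X := by
  have hU : MeasurableEntries M.U := M.measurable_U
  have hξ : MeasurableEntries M.ξ := M.measurable_ξ
  have h := ((MeasurableEntries.const (1 : Mat d)).kronecker (M.measurable_spectral a.2).2).mul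
    ((hU.mul ((MeasurableEntries.const X).kronecker ((M.measurable_spectral a.1).2.mul hξ))).mul
      hU.conjTranspose)
  intro i j
  simp only [instrument_apply, partialTrace, Matrix.of_apply]
  exact Finset.measurable_sum _ fun k _ => h (i, k) (j, k)

/-- The largest size of the entropy change. -/
def entropyBound (ω : Ω) : ℝ := ⨆ a, |M.entropyChange ω a|

open scoped MatrixOrder in
theorem randomInstrument {θ : Ω → Ω} (hθ : Measurable θ) :
    RandomInstrument θ M.instrument M.entropyChange M.entropyBound where
  map_nonneg ω a X hX := Matrix.nonneg_iff_posSemidef.2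
    (M.instrument_posSemidef ω a (Matrix.nonneg_iff_posSemidef.1 hX))
  trace_sum ω X := by
    rw [← M.trace_channel ω X, channel, LinearMap.sum_apply]
  abs_le ω a := le_ciSup (f := fun a => |M.entropyChange ω a|) (finite_range _).bddAbove a
  bound_nonneg ω := Real.iSup_nonneg fun a => abs_nonneg _
  measurable_shift := hθ
  measurable_apply a X := M.measurableEntries_instrument a X
  measurable_observable := M.measurable_entropyChange
  measurable_bound := Measurable.iSup fun a => (M.measurable_entropyChange a).abs

theorem integrable_entropyBound {P : Measure Ω} (hA3 : AssumptionA3 P M.entropyChange) :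
    Integrable M.entropyBound P := by
  refine (hA3 1).mono' (Measurable.iSup fun a =>
    (M.measurable_entropyChange a).abs).aestronglyMeasurable (ae_of_all _ fun ω => ?_)
  have h : 0 ≤ M.entropyBound ω := Real.iSup_nonneg fun a => abs_nonneg _
  rw [Real.norm_eq_abs, abs_of_nonneg h, one_mul]
  exact (by linarith : M.entropyBound ω ≤ M.entropyBound ω + 1).trans (Real.add_one_le_exp _)

end TwoTimeModel

/-! ## Strict positivity on an event of positive probability -/

section StrictPositivity

open scoped MatrixOrder

variable {Ω : Type*} [MeasurableSpace Ω] {d : ℕ}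

theorem isClosed_nonneg : IsClosed {X : Mat d | 0 ≤ X} := by
  have h : {X : Mat d | 0 ≤ X} = ⋂ x : Fin d → ℂ, {X | 0 ≤ star x ⬝ᵥ X.mulVec x} := by
    ext X
    simp only [mem_ofPred_eq, mem_iInter]
    exact ⟨fun hX => (Matrix.nonneg_iff_posSemidef.1 hX).dotProduct_mulVec_nonneg,
      fun hX => Matrix.nonneg_iff_posSemidef.2 (posSemidef_of_forall_nonneg hX)⟩
  rw [h]
  refine isClosed_iInter fun x => ?_
  refine isClosed_le continuous_const ?_
  exact continuous_const.dotProduct (continuous_id.matrix_mulVec continuous_const)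

/-- For each X the inequality is a closed condition on the values of the map at the matrix units, so
the uncountable intersection over X is still closed. -/
theorem measurableSet_forall_smul_one_le {φ : Ω → (Mat d →ₗ[ℂ] Mat d)}
    (hφ : ∀ X i j, Measurable fun ω => φ ω X i j) (δ : ℝ) :
    MeasurableSet {ω | ∀ X : Mat d, 0 ≤ X → (δ * X.trace.re) • (1 : Mat d) ≤ φ ω X} := by
  let T : Mat d → (Fin d → Fin d → Fin d → Fin d → ℂ) → Mat d := fun X c =>
    ∑ k, ∑ l, X k l • (Matrix.of (c k l) : Mat d) - (δ * X.trace.re) • (1 : Mat d)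
  have hT : ∀ X, Continuous (T X) := fun X => by
    refine Continuous.sub (continuous_finsetSum _ fun k _ => continuous_finsetSum _ fun l _ => ?_)
      continuous_const
    exact (continuous_apply_apply k l).const_smul (X k l)
  let S : Set (Fin d → Fin d → Fin d → Fin d → ℂ) := ⋂ X : {X : Mat d // 0 ≤ X}, {c | 0 ≤ T X c}
  have hS : IsClosed S := isClosed_iInter fun X => isClosed_nonneg.preimage (hT X)
  let c : Ω → Fin d → Fin d → Fin d → Fin d → ℂ := fun ω k l => φ ω (Matrix.single k l 1)
  have hc : Measurable c := by
    refine measurable_pi_iff.2 fun k => measurable_pi_iff.2 fun l => measurable_pi_iff.2 fun i =>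
      measurable_pi_iff.2 fun j => hφ _ i j
  have heq : {ω | ∀ X : Mat d, 0 ≤ X → (δ * X.trace.re) • (1 : Mat d) ≤ φ ω X} = c ⁻¹' S := by
    ext ω
    have h1 : ∀ X : Mat d, φ ω X = ∑ k, ∑ l, X k l • (Matrix.of (c ω k l) : Mat d) := fun X => by
      ext i j
      rw [map_apply_eq_sum]
      simp only [Matrix.sum_apply]
      rfl
    simp only [S, T, mem_preimage, mem_iInter, mem_ofPred_eq, Subtype.forall, sub_nonneg, ← h1]
  rw [heq]
  have : BorelSpace (Fin d → ℂ) := Pi.borelSpace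
  have : BorelSpace (Fin d → Fin d → ℂ) := Pi.borelSpace
  have : BorelSpace (Fin d → Fin d → Fin d → ℂ) := Pi.borelSpace
  have : BorelSpace (Fin d → Fin d → Fin d → Fin d → ℂ) := Pi.borelSpace
  exact hc hS.measurableSet

/-- The event of being positivity improving is covered by countably many events with constants δ =
1/(k + 1), so one of them is not null. -/
theorem exists_uniform_strictPositivity {P : Measure Ω} {φ : Ω → (Mat d →ₗ[ℂ] Mat d)}
    (h : 0 < P {ω | IsPositivityImproving (φ ω)}) :
    ∃ δ > (0 : ℝ), P {ω | ∀ X : Mat d, 0 ≤ X → (δ * X.trace.re) • (1 : Mat d) ≤ φ ω X} ≠ 0 := by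
  by_contra! hcon
  refine h.ne' ?_
  have hsub : {ω | IsPositivityImproving (φ ω)} ⊆ ⋃ k : ℕ,
      {ω | ∀ X : Mat d, 0 ≤ X → (1 / ((k : ℝ) + 1) * X.trace.re) • (1 : Mat d) ≤ φ ω X} := by
    intro ω hω
    obtain ⟨δ, hδ, hδφ⟩ := exists_smul_one_le_of_isPositivityImproving hω
    obtain ⟨k, hk⟩ := exists_nat_one_div_lt hδ
    refine mem_iUnion.2 ⟨k, fun X hX => le_trans ?_ (hδφ X hX)⟩
    exact smul_le_smul_of_nonneg_right
      (mul_le_mul_of_nonneg_right hk.le (trace_re_nonneg hX)) zero_le_one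
  exact measure_mono_null hsub (measure_iUnion_null fun k => hcon _ Nat.one_div_pos_of_nat)

theorem TwoTimeModel.exists_mixingInstrument [NeZero d] {m : ℕ} {P : Measure Ω} {θ : Ω → Ω}
    (hθ : Ergodic θ P) (M : TwoTimeModel Ω d m) (hirr : ∀ ω, IsIrreducibleMap (M.channel ω))
    (hA1 : AssumptionA1 P M.channel) (hA2 : AssumptionA2 P θ M.channel)
    (hA3 : AssumptionA3 P M.entropyChange) :
    ∃ v N δ G, MixingInstrument P θ M.instrument M.entropyChange M.entropyBound v N δ G := by
  obtain ⟨N, -, hN⟩ := hA2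
  obtain ⟨δ, hδ, hPδ⟩ := exists_uniform_strictPositivity hN
  have hr := M.randomInstrument hθ.measurable
  have hnn : ∀ ω X, 0 ≤ X → 0 ≤ M.channel ω X := fun ω X hX => by
    rw [channel, LinearMap.sum_apply]
    exact Finset.sum_nonneg fun a _ => hr.map_nonneg ω a X hX
  refine ⟨fun ω => vMin (hsAdjoint (M.channel ω)), N, δ, _, ⟨hr, hθ, M.integrable_entropyBound hA3,
    fun ω => ?_, fun ω => ?_, hA1, hδ, measurableSet_forall_smul_one_le (fun X i j => ?_) δ, hPδ,
    fun ω hω => hω⟩⟩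
  · exact vMin_pos (hnn ω) (posDef_map_one_of_isIrreducibleMap (hnn ω) (M.trace_channel ω) (hirr ω))
  · have := vMin_smul_one_le (hnn ω)
    rwa [channel, LinearMap.sum_apply] at this
  · change Measurable fun ω => compAlong θ (fun ω => ∑ a, M.instrument ω a) ω N X i j
    simp only [← evolve_one_eq_compAlong (f := M.entropyChange), evolve_apply_eq_sum, one_smul,
      Matrix.sum_apply]
    exact Finset.measurable_sum _ fun a _ => hr.measurable_stateAfter X N a i j

end StrictPositivity

/-! ## Conjugation of matrices by an antiunitary map -/

section ConjBy

open scoped MatrixOrder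

variable {n n' : Type*} [Fintype n] [Fintype n']

/-- Conjugation of the matrix `X` by the antilinear map `x ↦ A x̄`. -/
def conjBy (A X : Matrix n n ℂ) : Matrix n n ℂ := A * X.map star * A.conjTranspose

theorem map_star_mul (X Y : Matrix n n ℂ) : (X * Y).map star = X.map star * Y.map star := by
  ext i j
  simp [Matrix.mul_apply]

theorem conjBy_conjTranspose (A X : Matrix n n ℂ) :
    conjBy A X.conjTranspose = (conjBy A X).conjTranspose := by
  rw [conjBy, conjBy, Matrix.conjTranspose_mul, Matrix.conjTranspose_mul,
    Matrix.conjTranspose_conjTranspose, mul_assoc]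
  rfl

theorem conjBy_kronecker (A X : Matrix n n ℂ) (B Y : Matrix n' n' ℂ) :
    conjBy (A ⊗ₖ B) (X ⊗ₖ Y) = conjBy A X ⊗ₖ conjBy B Y := by
  have h : (X ⊗ₖ Y).map star = X.map star ⊗ₖ Y.map star := by
    ext i j
    simp
  rw [conjBy, conjBy, conjBy, h, Matrix.conjTranspose_kronecker, Matrix.mul_kronecker_mul,
    Matrix.mul_kronecker_mul]

theorem conjBy_sum_smul {ι : Type*} (s : Finset ι) (A : Matrix n n ℂ) (c : ι → ℝ)
    (X : ι → Matrix n n ℂ) :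
    conjBy A (∑ i ∈ s, (c i : ℂ) • X i) = ∑ i ∈ s, (c i : ℂ) • conjBy A (X i) := by
  have h : (∑ i ∈ s, (c i : ℂ) • X i).map star = ∑ i ∈ s, (c i : ℂ) • (X i).map star := by
    ext j k
    simp [Matrix.sum_apply]
  rw [conjBy, h, Finset.mul_sum, Finset.sum_mul]
  exact Finset.sum_congr rfl fun i _ => by rw [Matrix.mul_smul, Matrix.smul_mul, conjBy]

theorem conjBy_zero (A : Matrix n n ℂ) : conjBy A 0 = 0 := by
  simpa using conjBy_sum_smul (∅ : Finset ℕ) A (fun _ => 0) fun _ => 0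

theorem conjBy_sum {ι : Type*} (s : Finset ι) (A : Matrix n n ℂ) (X : ι → Matrix n n ℂ) :
    conjBy A (∑ i ∈ s, X i) = ∑ i ∈ s, conjBy A (X i) := by
  simpa using conjBy_sum_smul s A (fun _ => 1) X

/-- The inverse of `conjBy A`. -/
def conjByInv (A X : Matrix n n ℂ) : Matrix n n ℂ := (A.conjTranspose * X * A).map star

variable [DecidableEq n] [DecidableEq n']

theorem conjBy_one {A : Matrix n n ℂ} (hA : A.conjTranspose * A = 1) : conjBy A 1 = 1 := by
  have h : (1 : Matrix n n ℂ).map star = 1 := by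
    ext i j
    simp [Matrix.one_apply]
  rw [conjBy, h, mul_one, mul_eq_one_comm.1 hA]

theorem conjBy_mul {A : Matrix n n ℂ} (hA : A.conjTranspose * A = 1) (X Y : Matrix n n ℂ) :
    conjBy A (X * Y) = conjBy A X * conjBy A Y := by
  have h : conjBy A X * conjBy A Y =
      A * X.map star * (A.conjTranspose * A) * Y.map star * A.conjTranspose := by
    simp only [conjBy, mul_assoc]
  rw [h, hA, mul_one, conjBy, map_star_mul]
  simp only [mul_assoc]

theorem trace_conjBy {A : Matrix n n ℂ} (hA : A.conjTranspose * A = 1) (X : Matrix n n ℂ) :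
    (conjBy A X).trace = star X.trace := by
  rw [conjBy, Matrix.trace_mul_comm, ← mul_assoc, hA, one_mul]
  simp [Matrix.trace]

theorem conjBy_conjByInv {A : Matrix n n ℂ} (hA : A.conjTranspose * A = 1) (X : Matrix n n ℂ) :
    conjBy A (conjByInv A X) = X := by
  have h : (conjByInv A X).map star = A.conjTranspose * X * A := by
    ext i j
    simp only [conjByInv, Matrix.map_apply, star_star]
  have h' := mul_eq_one_comm.1 hA
  calc conjBy A (conjByInv A X) = (A * A.conjTranspose) * X * (A * A.conjTranspose) := by
        rw [conjBy, h]; simp only [mul_assoc]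
    _ = X := by rw [h', one_mul, mul_one]

theorem posDef_conjByInv {A X : Matrix n n ℂ} (hA : A.conjTranspose * A = 1) (hX : X.PosDef) :
    (conjByInv A X).PosDef := by
  have hu : IsUnit A := IsUnit.of_mul_eq_one_right _ hA
  have h1 : (A.conjTranspose * X * A).PosDef :=
    hX.conjTranspose_mul_mul_same (Matrix.mulVec_injective_of_isUnit hu)
  have h2 : conjByInv A X = (A.conjTranspose * X * A).transpose := by
    ext i j
    exact congr_fun (congr_fun h1.1 j) i
  rw [h2]
  exact h1.transpose

end ConjBy

/-! ### Matrices of antiunitary maps and uniqueness of spectral decompositions. -/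

section Antiunitary

open scoped MatrixOrder

variable {d m : ℕ}

/-- The matrix of an antilinear map. -/
def antiMatrix (τ : EuclideanSpace ℂ (Fin d) ≃ₗᵢ⋆[ℂ] EuclideanSpace ℂ (Fin d)) : Mat d :=
  Matrix.of fun i j => τ (EuclideanSpace.single j 1) i

theorem ofLp_antiunitary (τ : EuclideanSpace ℂ (Fin d) ≃ₗᵢ⋆[ℂ] EuclideanSpace ℂ (Fin d))
    (x : EuclideanSpace ℂ (Fin d)) : (τ x).ofLp = (antiMatrix τ).mulVec (star x.ofLp) := by
  have hx : x = ∑ i, x i • EuclideanSpace.single i (1 : ℂ) := by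
    ext j
    simp [Pi.single_apply]
  conv_lhs => rw [hx]
  ext q
  simp [map_sum, LinearIsometryEquiv.map_smulₛₗ, Matrix.mulVec, dotProduct, antiMatrix, mul_comm]

theorem antiMatrix_unitary (τ : EuclideanSpace ℂ (Fin d) ≃ₗᵢ⋆[ℂ] EuclideanSpace ℂ (Fin d)) :
    (antiMatrix τ).conjTranspose * antiMatrix τ = 1 := by
  have hnorm : ∀ z : EuclideanSpace ℂ (Fin d),
      ((‖z‖ ^ 2 : ℝ) : ℂ) = star z.ofLp ⬝ᵥ z.ofLp := fun z => by
    have h1 := inner_self_eq_norm_sq_to_K (𝕜 := ℂ) z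
    rw [EuclideanSpace.inner_eq_star_dotProduct, dotProduct_comm] at h1
    push_cast
    exact h1.symm
  -- Isometry says that the quadratic form of A* A - 1 vanishes; both signs of this matrix are then
  -- positive semidefinite, so it is zero.
  have hq : ∀ x : Fin d → ℂ,
      star x ⬝ᵥ ((antiMatrix τ).conjTranspose * antiMatrix τ - 1).mulVec x = 0 := by
    intro x
    have h1 := hnorm (τ (WithLp.toLp 2 (star x)))
    rw [τ.norm_map, hnorm, ofLp_antiunitary, star_star, Matrix.star_mulVec,
      ← Matrix.dotProduct_mulVec, Matrix.mulVec_mulVec] at h1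
    change x ⬝ᵥ star x = _ at h1
    rw [Matrix.sub_mulVec, dotProduct_sub, Matrix.one_mulVec, ← h1, dotProduct_comm, sub_self]
  rw [← sub_eq_zero]
  refine le_antisymm ?_ (Matrix.nonneg_iff_posSemidef.2 (posSemidef_of_forall_nonneg fun x =>
    (hq x).ge))
  rw [← neg_nonneg]
  refine Matrix.nonneg_iff_posSemidef.2 (posSemidef_of_forall_nonneg fun x => ?_)
  rw [Matrix.neg_mulVec, dotProduct_neg, hq, neg_zero]

theorem ofLp_antiTensor (τ : EuclideanSpace ℂ (Fin d) ≃ₗᵢ⋆[ℂ] EuclideanSpace ℂ (Fin d))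
    (τ' : EuclideanSpace ℂ (Fin m) ≃ₗᵢ⋆[ℂ] EuclideanSpace ℂ (Fin m))
    (x : EuclideanSpace ℂ (Fin d × Fin m)) :
    (antiTensor τ τ' x).ofLp = (antiMatrix τ ⊗ₖ antiMatrix τ').mulVec (star x.ofLp) := by
  ext q
  simp [antiTensor, tensorVec, Matrix.mulVec, dotProduct, antiMatrix, mul_comm]

theorem conjTranspose_kronecker_mul_self {A : Mat d} {B : Mat m} (hA : A.conjTranspose * A = 1)
    (hB : B.conjTranspose * B = 1) : (A ⊗ₖ B).conjTranspose * (A ⊗ₖ B) = 1 := by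
  rw [Matrix.conjTranspose_kronecker, ← Matrix.mul_kronecker_mul, hA, hB, Matrix.one_kronecker_one]

theorem conjBy_eq_of_intertwine {n : Type*} [Fintype n] [DecidableEq n] {A X Y : Matrix n n ℂ}
    (hA : A.conjTranspose * A = 1)
    (h : ∀ x, A.mulVec (star (X.mulVec x)) = Y.mulVec (A.mulVec (star x))) : Y = conjBy A X := by
  have h1 : A * X.map star = Y * A := by
    refine Matrix.mulVec_injective (funext fun x => ?_)
    have h2 := h (star x)
    have h3 : star (X.mulVec (star x)) = (X.map star).mulVec x := by
      ext i
      simp [Matrix.mulVec, dotProduct, mul_comm]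
    rw [star_star, h3] at h2
    simpa only [Matrix.mulVec_mulVec] using h2
  rw [conjBy, h1, mul_assoc, mul_eq_one_comm.1 hA, mul_one]

/-- Uniqueness of the spectral decomposition with eigenvalues in decreasing order. -/
theorem spectral_decomposition_unique {w w' : Fin m → ℝ} (hw : StrictAnti w) (hw' : StrictAnti w')
    {p p' : Fin m → Mat m} (hp : ∀ ε ε', p ε * p ε' = if ε = ε' then p ε else 0)
    (hp' : ∀ ε ε', p' ε * p' ε' = if ε = ε' then p' ε else 0) (h0 : ∀ ε, p ε ≠ 0)
    (h0' : ∀ ε, p' ε ≠ 0) (h1 : ∑ ε, p ε = 1) (h1' : ∑ ε, p' ε = 1)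
    (h : ∑ ε, (w ε : ℂ) • p ε = ∑ ε, (w' ε : ℂ) • p' ε) : w = w' ∧ p = p' := by
  -- Sandwiching the common matrix between p ε and p' ε' evaluates it in both decompositions.
  have hmul : ∀ ε ε', p ε * p' ε' ≠ 0 → w ε = w' ε' := by
    intro ε ε' hne
    have h2 : p ε * (∑ δ, (w δ : ℂ) • p δ) * p' ε' = (w ε : ℂ) • (p ε * p' ε') := by
      simp [Finset.mul_sum, hp, smul_ite]
    have h3 : p ε * (∑ δ, (w' δ : ℂ) • p' δ) * p' ε' = (w' ε' : ℂ) • (p ε * p' ε') := by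
      simp [Finset.sum_mul, mul_assoc, hp', smul_ite]
    rw [h, h3] at h2
    exact_mod_cast (smul_left_injective ℂ hne h2).symm
  have hex : ∀ ε, ∃ ε', p ε * p' ε' ≠ 0 := by
    intro ε
    by_contra! hcon
    refine h0 ε ?_
    rw [← mul_one (p ε), ← h1', Finset.mul_sum, Finset.sum_eq_zero fun ε' _ => hcon ε']
  have hex' : ∀ ε', ∃ ε, p ε * p' ε' ≠ 0 := by
    intro ε'
    by_contra! hcon
    refine h0' ε' ?_
    rw [← one_mul (p' ε'), ← h1, Finset.sum_mul, Finset.sum_eq_zero fun ε _ => hcon ε]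
  have hrange : range w = range w' := by
    ext x
    constructor
    · rintro ⟨ε, rfl⟩
      obtain ⟨ε', hne⟩ := hex ε
      exact ⟨ε', (hmul ε ε' hne).symm⟩
    · rintro ⟨ε', rfl⟩
      obtain ⟨ε, hne⟩ := hex' ε'
      exact ⟨ε, hmul ε ε' hne⟩
  -- A strictly monotone enumeration by `Fin m` is determined by its range.
  have hww : w = w' := by
    have h2 : StrictMono fun ε => -w ε := fun _ _ hlt => neg_lt_neg (hw hlt)
    have h3 : StrictMono fun ε => -w' ε := fun _ _ hlt => neg_lt_neg (hw' hlt)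
    have h4 : (fun ε => -w ε) = fun ε => -w' ε := by
      refine (StrictMono.range_inj h2 h3).1 ?_
      change range (Neg.neg ∘ w) = range (Neg.neg ∘ w')
      rw [range_comp, range_comp, hrange]
    funext ε
    simpa using congr_fun h4 ε
  refine ⟨hww, funext fun ε => ?_⟩
  have hne : ∀ ε ε', ε ≠ ε' → p ε * p' ε' = 0 := by
    intro ε ε' hεε'
    by_contra hne
    have := hmul ε ε' hne
    rw [hww] at this
    exact hεε' (hw'.injective this)
  have h2 : p ε = p ε * p' ε := by
    conv_lhs => rw [← mul_one (p ε), ← h1', Finset.mul_sum]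
    exact Finset.sum_eq_single ε (fun ε' _ h' => hne ε ε' h'.symm) (by simp)
  have h3 : p' ε = p ε * p' ε := by
    conv_lhs => rw [← one_mul (p' ε), ← h1, Finset.sum_mul]
    exact Finset.sum_eq_single ε (fun ε' _ h' => hne ε' ε h') (by simp)
  rw [h2, ← h3]

end Antiunitary

/-! ## Splitting off the first outcome -/

section FirstOutcome

variable {Ω A : Type*} {d : ℕ} (θ : Ω → Ω)

/-- The evolution is defined by its last outcome, which becomes the first outcome under reversal;
both decompositions are needed. -/
theorem stateAfter_succ_eq_tail (ψ : Ω → A → (Mat d →ₗ[ℂ] Mat d)) (ω : Ω) (X : Mat d) (n : ℕ)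
    (a : Fin (n + 1) → A) :
    stateAfter θ ψ ω X (n + 1) a = stateAfter θ ψ (θ ω) (ψ ω (a 0) X) n (Fin.tail a) := by
  induction n with
  | zero => rfl
  | succ n ih =>
    rw [stateAfter, ih, stateAfter, Fin.tail_init_eq_init_tail]
    rfl

theorem recordSum_succ_eq_tail (f : Ω → A → ℝ) (ω : Ω) (n : ℕ) (a : Fin (n + 1) → A) :
    recordSum θ f ω (n + 1) a = f ω (a 0) + recordSum θ f (θ ω) n (Fin.tail a) := by
  induction n with
  | zero => simp [recordSum]
  | succ n ih =>
    rw [recordSum, ih, recordSum, Fin.tail_init_eq_init_tail, add_assoc]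
    rfl

end FirstOutcome

/-! ## Time reversal of the two-time measurement model -/

namespace TwoTimeModel

variable {Ω : Type*} [MeasurableSpace Ω] {d m : ℕ} (M : TwoTimeModel Ω d m)

/-- Time reversal of the instruments, in terms of the matrix `A` of the antiunitary involution. -/
structure ReversedBy (T : Ω → Ω) (A : Mat d) : Prop where
  unitary : A.conjTranspose * A = 1
  entropyChange_swap : ∀ ω a, M.entropyChange (T ω) a.swap = -M.entropyChange ω a
  trace_instrument : ∀ ω a X Y,
    (conjBy A X * M.instrument (T ω) a.swap (conjBy A Y)).trace =
      Real.exp (-M.entropyChange ω a) * star (Y * M.instrument ω a X).trace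

/-- Conjugation by τ' carries the spectral decomposition of ξ at ω to that at T ω with the same
ordered weights, by uniqueness. Together with U at T ω being the conjugate of U*, this gives
detailed balance for the instruments, with e^{-f} the ratio of the two probe weights. -/
theorem exists_reversedBy {P : Measure Ω} {θ : Ω ≃ᵐ Ω} {T : Ω → Ω}
    (hT : TimeReversalInvariant P θ M T) : ∃ A, M.ReversedBy T A := by
  obtain ⟨τ, τ', -, -, hU, hξ⟩ := hT.exists_antiunitary
  set A := antiMatrix τ
  set B := antiMatrix τ'
  have hA : A.conjTranspose * A = 1 := antiMatrix_unitary τ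
  have hB : B.conjTranspose * B = 1 := antiMatrix_unitary τ'
  have hAB := conjTranspose_kronecker_mul_self hA hB
  have hU' : ∀ ω, (M.U (T ω)).conjTranspose = conjBy (A ⊗ₖ B) (M.U ω) := fun ω => by
    refine conjBy_eq_of_intertwine hAB fun x => ?_
    have h1 := congr_arg WithLp.ofLp (hU ω (WithLp.toLp 2 x))
    rw [ofLp_antiTensor] at h1
    simpa [Matrix.toLpLin_apply, ofLp_antiTensor] using h1
  have hξ' : ∀ ω, M.ξ (T ω) = conjBy B (M.ξ ω) := fun ω => by
    refine conjBy_eq_of_intertwine hB fun x => ?_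
    have h1 := congr_arg WithLp.ofLp (hξ ω (WithLp.toLp 2 x))
    rw [ofLp_antiunitary] at h1
    simpa [Matrix.toLpLin_apply, ofLp_antiunitary] using h1
  have hspec : ∀ ω, M.weight (T ω) = M.weight ω ∧ M.π (T ω) = fun ε => conjBy B (M.π ω ε) := by
    intro ω
    refine spectral_decomposition_unique (M.weight_strictAnti _) (M.weight_strictAnti _)
      (M.pi_mul_pi _) (fun ε ε' => ?_) (M.pi_ne_zero _) (fun ε h0 => ?_) (M.π_sum _) ?_ ?_
    · rw [← conjBy_mul hB, M.pi_mul_pi]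
      split_ifs
      · rfl
      · exact conjBy_zero B
    · have h1 := trace_conjBy hB (M.π ω ε)
      rw [h0, Matrix.trace_zero] at h1
      exact M.trace_pi_ne_zero ω ε (star_eq_zero.1 h1.symm)
    · rw [← conjBy_sum, M.π_sum, conjBy_one hB]
    · rw [← conjBy_sum_smul, ← xi_eq_sum, ← xi_eq_sum, hξ']
  refine ⟨A, hA, fun ω a => ?_, fun ω a X Y => ?_⟩
  · rw [entropyChange_eq_log, entropyChange_eq_log, (hspec ω).1, Prod.fst_swap, Prod.snd_swap]
    ring
  · have hUT : M.U (T ω) = conjBy (A ⊗ₖ B) (M.U ω).conjTranspose := by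
      rw [conjBy_conjTranspose, ← hU', Matrix.conjTranspose_conjTranspose]
    have hexp : Real.exp (-M.entropyChange ω a) * M.weight ω a.1 = M.weight ω a.2 := by
      rw [entropyChange_eq_log, neg_sub, Real.exp_sub, Real.exp_log (M.weight_pos _ _),
        Real.exp_log (M.weight_pos _ _), div_mul_cancel₀ _ (M.weight_pos _ _).ne']
    have hcyc : ((X ⊗ₖ M.π ω a.1) *
        ((M.U ω).conjTranspose * (Y ⊗ₖ M.π ω a.2) * M.U ω)).trace =
        ((Y ⊗ₖ M.π ω a.2) * (M.U ω * (X ⊗ₖ M.π ω a.1) * (M.U ω).conjTranspose)).trace := by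
      rw [← mul_assoc, ← mul_assoc, Matrix.trace_mul_comm, ← mul_assoc, ← mul_assoc,
        Matrix.trace_mul_comm]
    rw [trace_mul_instrument, trace_mul_instrument, Prod.fst_swap, Prod.snd_swap, (hspec ω).1,
      (hspec ω).2, hU', hUT, ← conjBy_kronecker, ← conjBy_kronecker, ← conjBy_mul hAB,
      ← conjBy_mul hAB, ← conjBy_mul hAB, trace_conjBy hAB, hcyc, ← hexp,
      star_mul', RCLike.star_def, Complex.conj_ofReal, Complex.ofReal_mul, mul_assoc]

/-! ### Reversal of whole records and of the penalized probabilities. -/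

section Reversal

variable {M} {P : Measure Ω} {θ : Ω ≃ᵐ Ω} {T : Ω → Ω} {A : Mat d}

theorem tail_reverseRecord {n : ℕ} (a : Fin (n + 1) → Fin m × Fin m) :
    Fin.tail (reverseRecord a) = reverseRecord (Fin.init a) := by
  funext j
  simp [Fin.tail, Fin.init, reverseRecord, Fin.rev_succ]

theorem reverseRecord_zero {n : ℕ} (a : Fin (n + 1) → Fin m × Fin m) :
    reverseRecord a 0 = (a (Fin.last n)).swap := by
  simp [reverseRecord]

theorem reverseRecord_involutive (n : ℕ) :
    Function.Involutive (reverseRecord : (Fin n → Fin m × Fin m) → _) := fun a => by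
  funext j
  simp [reverseRecord]

theorem shift_reversal (hT : TimeReversalInvariant P θ M T) (n : ℕ) (ω : Ω) :
    θ (T (θ^[n + 1] ω)) = T (θ^[n] ω) := by
  rw [Function.iterate_succ_apply', hT.conj_shift, MeasurableEquiv.apply_symm_apply]

/-- Detailed balance iterated: the first reversed step is moved across the trace as the last forward
step, changing Y. This is why Y is general in the induction. -/
theorem trace_stateAfter_reverse (hT : TimeReversalInvariant P θ M T) (hA : M.ReversedBy T A)
    (ω : Ω) (n : ℕ) (a : Fin n → Fin m × Fin m) (X Y : Mat d) :
    (conjBy A X * stateAfter θ M.instrument (T (θ^[n - 1] ω)) (conjBy A Y) n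
      (reverseRecord a)).trace =
      Real.exp (-recordSum θ M.entropyChange ω n a) *
        star (Y * stateAfter θ M.instrument ω X n a).trace := by
  induction n generalizing Y with
  | zero =>
    simp only [stateAfter, recordSum, neg_zero, Real.exp_zero, Complex.ofReal_one, one_mul]
    rw [← conjBy_mul hA.unitary, trace_conjBy hA.unitary, Matrix.trace_mul_comm]
  | succ n ih =>
    set Z := stateAfter θ M.instrument ω X n (Fin.init a)
    set Y' := conjByInv A (M.instrument (T (θ^[n] ω)) (a (Fin.last n)).swap (conjBy A Y))
    have hY' : conjBy A Y' = M.instrument (T (θ^[n] ω)) (a (Fin.last n)).swap (conjBy A Y) :=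
      conjBy_conjByInv hA.unitary _
    -- One step after T(θⁿ ω) the reversed orbit is at T(θⁿ⁻¹ ω). For n = 0 the subtraction is
    -- truncated, but no outcome remains.
    have hstart : stateAfter θ M.instrument (θ (T (θ^[n] ω))) (conjBy A Y') n
        (reverseRecord (Fin.init a)) =
        stateAfter θ M.instrument (T (θ^[n - 1] ω)) (conjBy A Y') n
        (reverseRecord (Fin.init a)) := by
      cases n with
      | zero => rfl
      | succ n => rw [shift_reversal hT]; rfl
    have h1 := hA.trace_instrument (θ^[n] ω) (a (Fin.last n)) Z Y
    rw [← hY', ← conjBy_mul hA.unitary, trace_conjBy hA.unitary, Matrix.trace_mul_comm] at h1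
    rw [stateAfter_succ_eq_tail, tail_reverseRecord, reverseRecord_zero, Nat.add_sub_cancel, ← hY',
      hstart, ih, h1, ← mul_assoc, ← Complex.ofReal_mul, ← Real.exp_add, recordSum, neg_add]
    rfl

theorem recordSum_reverse (hT : TimeReversalInvariant P θ M T) (hA : M.ReversedBy T A)
    (ω : Ω) (n : ℕ) (a : Fin n → Fin m × Fin m) :
    recordSum θ M.entropyChange (T (θ^[n - 1] ω)) n (reverseRecord a) =
      -recordSum θ M.entropyChange ω n a := by
  induction n with
  | zero => simp [recordSum]
  | succ n ih =>
    have hstart : recordSum θ M.entropyChange (θ (T (θ^[n] ω))) n (reverseRecord (Fin.init a)) =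
        recordSum θ M.entropyChange (T (θ^[n - 1] ω)) n (reverseRecord (Fin.init a)) := by
      cases n with
      | zero => rfl
      | succ n => rw [shift_reversal hT]; rfl
    rw [recordSum_succ_eq_tail, tail_reverseRecord, reverseRecord_zero, Nat.add_sub_cancel,
      hA.entropyChange_swap, hstart, ih, recordSum, neg_add, add_comm]

/-- With the identity in place of X, the forward evolution no longer involves ρ, which survives only
as the conjugated observable. -/
theorem outcomeProb_reverse (hT : TimeReversalInvariant P θ M T) (hA : M.ReversedBy T A)
    (ω : Ω) (n : ℕ) (a : Fin n → Fin m × Fin m) (ρ : Mat d) :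
    outcomeProb θ M.instrument (T (θ^[n - 1] ω)) ρ n (reverseRecord a) =
      Real.exp (-recordSum θ M.entropyChange ω n a) *
        (conjByInv A ρ * stateAfter θ M.instrument ω 1 n a).trace.re := by
  have h1 := trace_stateAfter_reverse hT hA ω n a 1 (conjByInv A ρ)
  rw [conjBy_one hA.unitary, conjBy_conjByInv hA.unitary, one_mul] at h1
  rw [outcomeProb, h1, Complex.re_ofReal_mul, RCLike.star_def, Complex.conj_re]

open scoped MatrixOrder in
theorem penalizedProb_reverse (hT : TimeReversalInvariant P θ M T) (hA : M.ReversedBy T A)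
    (K s : ℝ) (n : ℕ) (ω : Ω) :
    penalizedProb θ M.instrument M.entropyChange (K + 1) s n ω ≤
      Real.exp (n * s) *
        penalizedProb θ M.instrument M.entropyChange K (-s) n (T (θ^[n - 1] ω)) := by
  have hr := M.randomInstrument θ.measurable
  rw [penalizedProb, penalizedProb, mul_div_assoc']
  refine div_le_div_of_nonneg_right ?_ d.cast_nonneg
  rw [trace_evolve_eq_sum, trace_evolve_eq_sum, Finset.mul_sum]
  refine (Finset.sum_le_sum fun a _ => ?_).trans_eq (Equiv.sum_comp
    (Function.Involutive.toPerm _ (reverseRecord_involutive (m := m) n)) fun a =>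
      Real.exp (n * s) * (penalty K (-s) n
        (recordSum θ M.entropyChange (T (θ^[n - 1] ω)) n a) *
        outcomeProb θ M.instrument (T (θ^[n - 1] ω)) 1 n a))
  have hinv : conjByInv A 1 = 1 := by
    rw [conjByInv, mul_one, hA.unitary]
    ext i j
    simp [Matrix.one_apply]
  rw [Function.Involutive.coe_toPerm, recordSum_reverse hT hA, outcomeProb_reverse hT hA, hinv,
    one_mul, ← mul_assoc, ← mul_assoc]
  refine mul_le_mul_of_nonneg_right ?_ (trace_re_nonneg
    (stateAfter_nonneg hr.map_nonneg ω n a zero_le_one))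
  set S := recordSum θ M.entropyChange ω n a
  rw [penalty, penalty, ← Real.exp_add, ← Real.exp_add, Real.exp_le_exp]
  have h1 : |-S - n * -s| = |S - n * s| := by rw [← abs_neg]; congr 1; ring
  rw [h1]
  -- The extra unit of K pays for the tilt: -(S - ns) ≥ -|S - ns|.
  linarith [le_abs_self (S - n * s), neg_abs_le (S - n * s)]

theorem logProb_reverse [NeZero d] (hT : TimeReversalInvariant P θ M T) (hA : M.ReversedBy T A)
    (K : ℕ) (s : ℝ) (n : ℕ) (ω : Ω) :
    logProb θ M.instrument M.entropyChange (K + 1 : ℕ) s n ω ≤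
      n * s + logProb θ M.instrument M.entropyChange K (-s) n (T (θ^[n - 1] ω)) := by
  have hr := M.randomInstrument θ.measurable
  have hK : (0 : ℝ) ≤ K := K.cast_nonneg
  have h1 := penalizedProb_reverse hT hA K s n ω
  have h2 := Real.log_le_log (hr.penalizedProb_pos (by positivity) s n ω) h1
  rw [Real.log_mul (Real.exp_pos _).ne' (hr.penalizedProb_pos hK _ n _).ne', Real.log_exp] at h2
  rw [logProb, logProb]
  push_cast
  exact h2

end Reversal

end TwoTimeModel

/-! ## Dependence on the initial state -/

section InitialState

open scoped MatrixOrder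

variable {d : ℕ}

theorem trace_mul_re_mono {X Y Z : Mat d} (h : X ≤ Y) (hZ : 0 ≤ Z) :
    (X * Z).trace.re ≤ (Y * Z).trace.re := by
  have h1 := (Complex.nonneg_iff.1 (trace_mul_nonneg (sub_nonneg.2 h) hZ)).1
  rw [Matrix.sub_mul, Matrix.trace_sub, Complex.sub_re] at h1
  linarith

theorem trace_smul_one_mul_re (c : ℝ) (Z : Mat d) :
    ((c • (1 : Mat d)) * Z).trace.re = c * Z.trace.re := by
  rw [Matrix.smul_mul, one_mul, trace_re_smul]

variable {Ω A : Type*} {θ : Ω → Ω} {ψ : Ω → A → (Mat d →ₗ[ℂ] Mat d)}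

theorem stateAfter_mono (hpos : ∀ ω a X, 0 ≤ X → 0 ≤ ψ ω a X) (ω : Ω) (n : ℕ) (a : Fin n → A)
    {X Y : Mat d} (h : X ≤ Y) : stateAfter θ ψ ω X n a ≤ stateAfter θ ψ ω Y n a := by
  induction n with
  | zero => exact h
  | succ n ih => exact map_le_map_of_nonneg (hpos _ _) (ih _)

theorem outcomeProb_mono (hpos : ∀ ω a X, 0 ≤ X → 0 ≤ ψ ω a X) (ω : Ω) (n : ℕ) (a : Fin n → A)
    {X Y : Mat d} (h : X ≤ Y) : outcomeProb θ ψ ω X n a ≤ outcomeProb θ ψ ω Y n a :=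
  trace_re_le_of_le (stateAfter_mono hpos ω n a h)

theorem stateAfter_real_smul (ω : Ω) (n : ℕ) (a : Fin n → A) (c : ℝ) (X : Mat d) :
    stateAfter θ ψ ω (c • X) n a = c • stateAfter θ ψ ω X n a := by
  induction n with
  | zero => rfl
  | succ n ih => rw [stateAfter, ih, map_real_smul, stateAfter]

theorem outcomeProb_real_smul (ω : Ω) (n : ℕ) (a : Fin n → A) (c : ℝ) (X : Mat d) :
    outcomeProb θ ψ ω (c • X) n a = c * outcomeProb θ ψ ω X n a := by
  rw [outcomeProb, stateAfter_real_smul, trace_re_smul, outcomeProb]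

theorem sum_outcomeProb {A : Type*} [Fintype A] [MeasurableSpace Ω]
    {ψ : Ω → A → (Mat d →ₗ[ℂ] Mat d)} {f : Ω → A → ℝ} {F : Ω → ℝ}
    (h : RandomInstrument θ ψ f F) (ω : Ω) (n : ℕ) (X : Mat d) :
    ∑ a, outcomeProb θ ψ ω X n a = X.trace.re := by
  rw [← h.trace_compAlong ω n X, ← evolve_one_eq_compAlong (f := f), trace_evolve_eq_sum]
  simp

end InitialState

/-! ## Comparison of growth rates -/

theorem abs_log_sub_log_le {c C q p : ℝ} (hc : 0 < c) (hq : 0 < q) (h1 : c * q ≤ p)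
    (h2 : p ≤ C * q) : |Real.log p - Real.log q| ≤ |Real.log c| + |Real.log C| := by
  have hp : 0 < p := (mul_pos hc hq).trans_le h1
  have hC : 0 < C := pos_of_mul_pos_left (hp.trans_le h2) hq.le
  have h3 := Real.log_le_log (mul_pos hc hq) h1
  have h4 := Real.log_le_log hp h2
  rw [Real.log_mul hc.ne' hq.ne'] at h3
  rw [Real.log_mul hC.ne' hq.ne'] at h4
  rw [abs_le]
  constructor <;> linarith [neg_abs_le (Real.log c), le_abs_self (Real.log C),
    abs_nonneg (Real.log c), abs_nonneg (Real.log C)]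

theorem tendsto_div_of_abs_sub_le {x y : ℕ → ℝ} {L B : ℝ} (h : ∀ n, |x n - y n| ≤ B)
    (hy : Tendsto (fun n : ℕ => y n / n) atTop (nhds L)) :
    Tendsto (fun n : ℕ => x n / n) atTop (nhds L) := by
  have h1 : Tendsto (fun n : ℕ => (x n - y n) / n) atTop (nhds 0) := by
    refine squeeze_zero_norm (fun n => ?_) (tendsto_const_div_atTop_nhds_zero_nat B)
    rw [Real.norm_eq_abs, abs_div, Nat.abs_cast]
    exact div_le_div_of_nonneg_right (h n) n.cast_nonneg
  simpa [← add_div] using h1.add hy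

theorem exp_neg_mul_abs_le {K B x y z : ℝ} (hK : 0 ≤ K) (h : |x - y| ≤ B) :
    Real.exp (-(K * |x - z|)) ≤ Real.exp (K * B) * Real.exp (-(K * |y - z|)) := by
  rw [← Real.exp_add, Real.exp_le_exp]
  have h1 : |y - z| ≤ |x - z| + B := by
    rw [abs_sub_comm] at h
    linarith [abs_sub_le y x z]
  nlinarith [mul_le_mul_of_nonneg_left h1 hK]

/-! ## The entropy production of the two-time measurement model -/

namespace TwoTimeModel

open scoped MatrixOrder

variable {Ω : Type*} [MeasurableSpace Ω] {d m : ℕ} {M : TwoTimeModel Ω d m} {P : Measure Ω}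
  {θ : Ω ≃ᵐ Ω} {T : Ω → Ω} {A : Mat d}

theorem outcomeProb_nonneg (ω : Ω) {ρ : Mat d} (hρ : 0 ≤ ρ) (n : ℕ) (a : Fin n → Fin m × Fin m) :
    0 ≤ outcomeProb θ M.instrument ω ρ n a :=
  trace_re_nonneg (stateAfter_nonneg (M.randomInstrument θ.measurable).map_nonneg ω n a hρ)

/-- The outcome probabilities of a faithful initial state are comparable with those of the identity
matrix. -/
theorem exists_outcomeProb_bounds {ρ : Mat d} (hρ : ρ.PosDef) : ∃ c C : ℝ, 0 < c ∧
    ∀ ω n a, c * outcomeProb θ M.instrument ω 1 n a ≤ outcomeProb θ M.instrument ω ρ n a ∧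
      outcomeProb θ M.instrument ω ρ n a ≤ C * outcomeProb θ M.instrument ω 1 n a := by
  have hpos := (M.randomInstrument θ.measurable).map_nonneg
  obtain ⟨c, hc, hcρ⟩ := exists_smul_one_le_of_posDef hρ
  refine ⟨c, ρ.trace.re, hc, fun ω n a => ⟨?_, ?_⟩⟩
  · rw [← outcomeProb_real_smul]
    exact outcomeProb_mono hpos ω n a hcρ
  · rw [← outcomeProb_real_smul]
    exact outcomeProb_mono hpos ω n a
      (le_trace_smul_one (Matrix.nonneg_iff_posSemidef.2 hρ.posSemidef))

/-- The tilt e^{-S} contributes exactly S to the logarithm. What remains compares two probabilities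
with the one started in the identity, using that ρ and its conjugate are both bounded above and
below by multiples of the identity. -/
theorem exists_abs_entropyProduction_sub_recordSum_le (hT : TimeReversalInvariant P θ M T)
    (hA : M.ReversedBy T A) {ρ : Mat d} (hρ : ρ.PosDef) : ∃ B : ℝ, ∀ ω n a,
      outcomeProb θ M.instrument ω ρ n a ≠ 0 →
        |M.entropyProduction θ T ω ρ n a - recordSum θ M.entropyChange ω n a| ≤ B := by
  have hpos := (M.randomInstrument θ.measurable).map_nonneg
  obtain ⟨c, C, hc, hbd⟩ := exists_outcomeProb_bounds (M := M) (θ := θ) hρ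
  have hρ' := posDef_conjByInv hA.unitary hρ
  obtain ⟨c', hc', hcρ'⟩ := exists_smul_one_le_of_posDef hρ'
  set C' := (conjByInv A ρ).trace.re
  have hCρ' := le_trace_smul_one (Matrix.nonneg_iff_posSemidef.2 hρ'.posSemidef)
  refine ⟨(|Real.log c| + |Real.log C|) + (|Real.log c'| + |Real.log C'|), fun ω n a hp => ?_⟩
  obtain ⟨h1, h2⟩ := hbd ω n a
  have hp' := (outcomeProb_nonneg (M := M) (θ := θ) ω
    (Matrix.nonneg_iff_posSemidef.2 hρ.posSemidef) n a).lt_of_ne' hp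
  have hZ := stateAfter_nonneg (θ := θ) hpos ω n a zero_le_one
  have hq : 0 < outcomeProb θ M.instrument ω 1 n a := by
    refine (trace_re_nonneg hZ).lt_of_ne' fun h0 => ?_
    rw [outcomeProb.eq_def θ M.instrument ω 1, h0, mul_zero] at h2
    exact hp'.not_ge h2
  have h3 := trace_mul_re_mono hcρ' hZ
  have h4 := trace_mul_re_mono hCρ' hZ
  rw [trace_smul_one_mul_re] at h3 h4
  have hr := (mul_pos hc' hq).trans_le h3
  rw [entropyProduction, outcomeProb_reverse hT hA,
    Real.log_div hp (mul_pos (Real.exp_pos _) hr).ne', Real.log_mul (Real.exp_pos _).ne' hr.ne',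
    Real.log_exp]
  have h5 := abs_log_sub_log_le hc hq h1 h2
  have h6 := abs_log_sub_log_le hc' hq h3 h4
  have h7 := (abs_sub _ _).trans (add_le_add h5 h6)
  refine le_of_eq_of_le (congr_arg _ ?_) h7
  ring

theorem penalized_eq_mul_penalizedProb [NeZero d] (K s : ℝ) (n : ℕ) (ω : Ω) :
    ∑ a, Real.exp (-(K * |recordSum θ M.entropyChange ω n a - n * s|)) *
      outcomeProb θ M.instrument ω 1 n a =
      d * penalizedProb θ M.instrument M.entropyChange K s n ω := by
  rw [penalizedProb, mul_div_cancel₀ _ (NeZero.ne (d : ℝ)), trace_evolve_eq_sum]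
  rfl

/-- The penalized expectations of the entropy production and those of the sum of the entropy
changes have the same growth. -/
theorem exists_abs_log_penalized_sub_logProb_le [NeZero d] (hT : TimeReversalInvariant P θ M T)
    (hA : M.ReversedBy T A) {ρ : Mat d} (hρ : ρ.PosDef) {K : ℝ} (hK : 0 ≤ K) (s : ℝ) :
    ∃ B : ℝ, ∀ ω n, |Real.log (penalized (fun n => outcomeProb θ M.instrument ω ρ n)
      (fun n => M.entropyProduction θ T ω ρ n) K s n) -
        logProb θ M.instrument M.entropyChange K s n ω| ≤ B := by
  obtain ⟨B, hB⟩ := exists_abs_entropyProduction_sub_recordSum_le hT hA hρ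
  obtain ⟨c, C, hc, hbd⟩ := exists_outcomeProb_bounds (M := M) (θ := θ) hρ
  have hd : (0 : ℝ) < d := by exact_mod_cast Nat.pos_of_ne_zero (NeZero.ne d)
  refine ⟨|Real.log (Real.exp (-(K * B)) * c * d)| + |Real.log (Real.exp (K * B) * C * d)|,
    fun ω n => ?_⟩
  have hρ0 : 0 ≤ ρ := Matrix.nonneg_iff_posSemidef.2 hρ.posSemidef
  refine abs_log_sub_log_le (mul_pos (mul_pos (Real.exp_pos _) hc) hd)
    ((M.randomInstrument θ.measurable).penalizedProb_pos hK s n ω) ?_ ?_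
  · rw [mul_assoc _ (d : ℝ), ← penalized_eq_mul_penalizedProb, Finset.mul_sum, penalized]
    refine Finset.sum_le_sum fun a _ => ?_
    obtain ⟨h1, -⟩ := hbd ω n a
    -- Records of probability zero, for which the entropy production is not controlled, also have
    -- probability zero from the identity.
    rcases eq_or_ne (outcomeProb θ M.instrument ω ρ n a) 0 with h0 | h0
    · have hq : outcomeProb θ M.instrument ω 1 n a = 0 :=
        le_antisymm (nonpos_of_mul_nonpos_right (h0 ▸ h1) hc)
          (outcomeProb_nonneg ω zero_le_one n a)
      rw [h0, hq, mul_zero, mul_zero, mul_zero]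
    · have h2 := exp_neg_mul_abs_le (z := n * s) hK ((abs_sub_comm _ _).trans_le (hB ω n a h0))
      calc _ = Real.exp (-(K * B)) *
            Real.exp (-(K * |recordSum θ M.entropyChange ω n a - n * s|)) *
              (c * outcomeProb θ M.instrument ω 1 n a) := by ring
        _ ≤ _ := by
            refine mul_le_mul ?_ h1 (mul_nonneg hc.le (outcomeProb_nonneg ω zero_le_one n a))
              (Real.exp_pos _).le
            rwa [Real.exp_neg, inv_mul_le_iff₀ (Real.exp_pos _)]
  · rw [mul_assoc _ (d : ℝ), ← penalized_eq_mul_penalizedProb, Finset.mul_sum, penalized]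
    refine Finset.sum_le_sum fun a _ => ?_
    obtain ⟨-, h1⟩ := hbd ω n a
    rcases eq_or_ne (outcomeProb θ M.instrument ω ρ n a) 0 with h0 | h0
    · rw [h0] at h1
      rw [h0, mul_zero]
      calc (0 : ℝ) ≤ Real.exp (K * B) *
            Real.exp (-(K * |recordSum θ M.entropyChange ω n a - n * s|)) *
              (C * outcomeProb θ M.instrument ω 1 n a) :=
            mul_nonneg (mul_pos (Real.exp_pos _) (Real.exp_pos _)).le h1
        _ = _ := by ring
    · have h2 := exp_neg_mul_abs_le (z := n * s) hK (hB ω n a h0)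
      refine (mul_le_mul h2 h1 (outcomeProb_nonneg ω hρ0 n a)
        (mul_pos (Real.exp_pos _) (Real.exp_pos _)).le).trans_eq ?_
      ring

theorem largeDeviationBounds_entropyProduction [NeZero d] (hT : TimeReversalInvariant P θ M T)
    (hA : M.ReversedBy T A) {ρ : Mat d} (hρ : ρ ∈ faithfulStates d) {Λ : ℕ → ℝ → ℝ} {ω : Ω}
    (hΛ : ∀ (K : ℕ) (s : ℝ), Tendsto
      (fun n : ℕ => logProb θ M.instrument M.entropyChange K s n ω / n) atTop (nhds (Λ K s)))
    {b : ℝ} (hb : Tendsto (fun n : ℕ => birkhoffSum θ M.entropyBound n ω / n) atTop (nhds b)) :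
    LargeDeviationBounds (fun n => outcomeProb θ M.instrument ω ρ n)
      (fun n => M.entropyProduction θ T ω ρ n) (rateFunction Λ) := by
  have hr := M.randomInstrument θ.measurable
  have hρ0 : 0 ≤ ρ := Matrix.nonneg_iff_posSemidef.2 hρ.1.posSemidef
  obtain ⟨B, hB⟩ := exists_abs_entropyProduction_sub_recordSum_le hT hA hρ.1
  -- In R = b + 2, b + 1 bounds the averages of the one-step bound eventually, and the last unit
  -- absorbs B once n ≥ B.
  refine largeDeviationBounds_of_tendsto_penalized (fun n a => outcomeProb_nonneg ω hρ0 n a)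
    (fun n => ?_) (fun K s => ?_) (R := b + 2) ?_
  · rw [sum_outcomeProb hr, hρ.2, Complex.one_re]
  · obtain ⟨B', hB'⟩ := exists_abs_log_penalized_sub_logProb_le hT hA hρ.1 K.cast_nonneg s
    exact tendsto_div_of_abs_sub_le (hB' ω) (hΛ K s)
  · filter_upwards [hb.eventually_lt_const (lt_add_one b), eventually_gt_atTop 0,
      tendsto_natCast_atTop_atTop.eventually_ge_atTop B] with n h1 hn h2 a ha
    have hn' : (0 : ℝ) < n := by exact_mod_cast hn
    rw [div_lt_iff₀ hn'] at h1
    have h3 := hB ω n a ha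
    have h4 := abs_recordSum_le (θ := θ) hr.abs_le ω n a
    have h5 := abs_sub_abs_le_abs_sub (M.entropyProduction θ T ω ρ n a)
      (recordSum θ M.entropyChange ω n a)
    linarith

end TwoTimeModel

theorem faithfulStates_zero : faithfulStates 0 = ∅ := by
  refine eq_empty_of_forall_notMem fun ρ hρ => ?_
  have h : ρ.trace = 0 := by simp [Matrix.trace]
  rw [hρ.2] at h
  exact one_ne_zero h

theorem convexOn_top : ConvexOn ℝ≥0 univ (fun _ : ℝ => (⊤ : ℝ≥0∞)) := by
  refine ⟨convex_univ, fun x _ y _ a b _ _ hab => ?_⟩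
  rcases eq_or_ne a 0 with rfl | ha
  · obtain rfl : b = 1 := by simpa using hab
    simp
  · simp [ENNReal.smul_top, ha]

end QMeas

end

theorem theorem2 {Ω : Type*} [MeasurableSpace Ω] (P : Measure Ω) [IsProbabilityMeasure P]
    (θ : Ω ≃ᵐ Ω) (hθ : Ergodic θ P) {d m : ℕ} (M : QMeas.TwoTimeModel Ω d m)
    (hirr : ∀ ω, QMeas.IsIrreducibleMap (M.channel ω))
    (hA1 : QMeas.AssumptionA1 P M.channel)
    (hA2 : QMeas.AssumptionA2 P θ M.channel)
    (hA3 : QMeas.AssumptionA3 P M.entropyChange)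
    (T : Ω → Ω) (hT : QMeas.TimeReversalInvariant P θ M T) :
    ∃ J : ℝ → ℝ≥0∞,
      LowerSemicontinuous J ∧ ConvexOn ℝ≥0 Set.univ J ∧
      (∀ᵐ ω ∂P, ∀ ρ ∈ QMeas.faithfulStates d,
        QMeas.LargeDeviationBounds
          (fun n => QMeas.outcomeProb θ M.instrument ω ρ n)
          (fun n => M.entropyProduction θ T ω ρ n) J) ∧
      ∀ s : ℝ, (J (-s) : EReal) = (J s : EReal) + (s : EReal) := by
  -- In dimension zero there is no faithful state, and the constant infinite rate satisfies every
  -- claim.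
  rcases Nat.eq_zero_or_pos d with rfl | hd
  · refine ⟨fun _ => ⊤, lowerSemicontinuous_const, QMeas.convexOn_top, ?_, fun s => by simp⟩
    simp [QMeas.faithfulStates_zero]
  have : NeZero d := ⟨hd.ne'⟩
  obtain ⟨v, N, δ, G, h⟩ := M.exists_mixingInstrument hθ hirr hA1 hA2 hA3
  obtain ⟨Λ, hΛ0, hΛ⟩ := h.exists_growthRate
  obtain ⟨A, hA⟩ := M.exists_reversedBy hT
  refine ⟨QMeas.rateFunction Λ,
    QMeas.lowerSemicontinuous_rateFunction (h.continuous_growthRate hΛ),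
    QMeas.convexOn_rateFunction (h.growthRate_concave hΛ), ?_,
    QMeas.rateFunction_neg hΛ0 fun K s => ?_⟩
  · filter_upwards [h.ae_forall_tendsto hΛ,
      QMeas.ae_tendsto_birkhoffSum_div hθ (M.integrable_entropyBound hA3)] with ω h1 h2 ρ hρ
    exact QMeas.TwoTimeModel.largeDeviationBounds_entropyProduction hT hA hρ h1 h2
  -- The reversal is R n = T ∘ θⁿ⁻¹, which preserves P for every n.
  · exact h.growthRate_reverse hΛ
      (fun n => hT.measurePreserving.comp (hθ.toMeasurePreserving.iterate (n - 1)))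
      fun n _ ω => QMeas.TwoTimeModel.logProb_reverse hT hA K s n ω
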